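/- Let $(M,F)$ be a connected $n$-dimensional Finsler manifold: $F:TM\to\mathbb R$ is $C^\infty$ at every $(x,y)$ with $y\neq 0$ and continuous at every $(x,0)$, $F(x,y)>0$ for $y\ne0$, $F(x,\lambda y)=|\lambda|F(x,y)$ for all $\lambda\in\mathbb R$, and $g_{ij}(x,y)=\frac12\,\partial^2F^2/\partial y^i\partial y^j$ is positive definite for $y\ne 0$. In induced coordinates let $\Gamma^i_{jk}=\frac12 g^{im}\bigl(\frac{\partial g_{mk}}{\partial x^j}+\frac{\partial g_{jm}}{\partial x^k}-\frac{\partial g_{jk}}{\partial x^m}\bigr)$, $N^i_j=\frac12\frac{\partial}{\partial y^j}(\Gamma^i_{kl}y^ky^l)$, $\frac{\delta}{\delta x^i}=\frac{\partial}{\partial x^i}-N^j_i\frac{\partial}{\partial y^j}$, let $(L^i_{jk},N^i_j,C^i_{jk})$ be the Cartan connection, with $L^i_{jk}=\frac12 g^{im}\bigl(\frac{\delta g_{mk}}{\delta x^j}+\frac{\delta g_{jm}}{\delta x^k}-\frac{\delta g_{jk}}{\delta x^m}\bigr)$ and $C^i_{jk}=\frac12 g^{im}\bigl(\frac{\partial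 g_{mk}}{\partial y^j}+\frac{\partial g_{jm}}{\partial y^k}-\frac{\partial g_{jk}}{\partial y^m}\bigr)$, let $R^i_{jk}=\frac{\delta N^i_j}{\delta x^k}-\frac{\delta N^i_k}{\delta x^j}$, and let $R^i_{hjk}=\frac{\delta L^i_{hj}}{\delta x^k}-\frac{\delta L^i_{hk}}{\delta x^j}+L^s_{hj}L^i_{sk}-L^s_{hk}L^i_{sj}+C^i_{hs}R^s_{jk}$ be its $h$-curvature. For vector fields $X,Y$ along a $C^\infty$ regular curve $c:[0,1]\to M$ put $g(X,Y)=g_{ij}(c,\dot c)X^iY^j$, $\|X\|^2=g(X,X)$, $$\Bigl(\frac{\nabla X}{dt}\Bigr)^i=\frac{dX^i}{dt}+X^m\Bigl[L^i_{mk}(c,\dot c)\,\dot c^k+C^i_{mk}(c,\dot c)\bigl(\ddot c^k+N^k_l(c,\dot c)\,\dot c^l\bigr)\Bigr],$$ $(R^2(X,\dot c)\dot c)^l=R^l_{ijk}(c,\dot c)\,\dot c^i\dot c^jX^k$ and $R^2(X,\dot c,Y,\dot c)=g(R^2(Y,\dot c)\dot c,X)$. The curve $c$ is a geodesic if $\nabla\dot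 c/dt=0$. A Jacobi field along $c$ is a $C^\infty$ field $J$ with $\frac{\nabla}{dt}\frac{\nabla J}{dt}+R^2(J,\dot c)\dot c=0$ on $[0,1]$. For $0\le a<b\le 1$, the point $c(b)$ is conjugate to $c(a)$ along $c$ if some Jacobi field that is not identically zero vanishes at $t=a$ and at $t=b$. Let $c:[0,1]\to M$ be a geodesic, and let $T_c^\perp\Omega$ be the space of continuous, piecewise $C^\infty$ vector fields $X$ along $c$ with $X(0)=0$, $X(1)=0$ and $g(X,\dot c)=0$. Then the following are equivalent: (i) no point $c(b)$ with $0<b\le 1$ is conjugate to $c(0)$ along $c$; (ii) the index form $I(X)=\int_0^1\bigl(\|\nabla X/dt\|^2-R^2(X,\dot c,X,\dot c)\bigr)\,dt$ is positive definite on $T_c^\perp\Omega$, that is, $I(X)>0$ for every $X\in T_c^\perp\Omega$ that is not identically zero. -/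

import Mathlib

open scoped Manifold ContDiff
open Set

namespace Finsler

noncomputable section

/-! ### Local expressions

Everything here is computed in induced coordinates `(x, y) = (x¹, …, xⁿ, y¹, …, yⁿ)` of the tangent
bundle.  The argument `f` is the fundamental function `F` written in these coordinates. -/

/-- The coordinate space `ℝⁿ`. -/
abbrev Coord (n : ℕ) : Type := EuclideanSpace ℝ (Fin n)

variable {n : ℕ}

/-- The partial derivative `∂h/∂xⁱ`. -/
def dx (i : Fin n) (h : Coord n × Coord n → ℝ) (p : Coord n × Coord n) : ℝ :=
  fderiv ℝ h p (EuclideanSpace.single i 1, 0)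

/-- The partial derivative `∂h/∂yⁱ`. -/
def dy (i : Fin n) (h : Coord n × Coord n → ℝ) (p : Coord n × Coord n) : ℝ :=
  fderiv ℝ h p (0, EuclideanSpace.single i 1)

/-- The fundamental tensor `g_{ij} = (1/2) ∂²F²/∂yⁱ∂yʲ`. -/
def g (f : Coord n × Coord n → ℝ) (i j : Fin n) (p : Coord n × Coord n) : ℝ :=
  1 / 2 * dy i (dy j (fun q => f q ^ 2)) p

/-- The inverse matrix `g^{ij}` of the fundamental tensor. -/
def gInv (f : Coord n × Coord n → ℝ) (i j : Fin n) (p : Coord n × Coord n) : ℝ :=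
  (Matrix.of fun k l => g f k l p)⁻¹ i j

/-- The formal Christoffel symbols
`Γ^i_{jk} = (1/2) g^{im} (∂g_{mk}/∂xʲ + ∂g_{jm}/∂xᵏ - ∂g_{jk}/∂xᵐ)`. -/
def Γ (f : Coord n × Coord n → ℝ) (i j k : Fin n) (p : Coord n × Coord n) : ℝ :=
  1 / 2 * ∑ m, gInv f i m p * (dx j (g f m k) p + dx k (g f j m) p - dx m (g f j k) p)

/-- The nonlinear connection `N^i_j = (1/2) ∂(Γ^i_{kl} yᵏ yˡ)/∂yʲ`. -/
def N (f : Coord n × Coord n → ℝ) (i j : Fin n) (p : Coord n × Coord n) : ℝ :=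
  1 / 2 * dy j (fun q => ∑ k, ∑ l, Γ f i k l q * q.2 k * q.2 l) p

/-- The horizontal derivative `δh/δxⁱ = ∂h/∂xⁱ - N^j_i ∂h/∂yʲ`. -/
def δ (f : Coord n × Coord n → ℝ) (i : Fin n) (h : Coord n × Coord n → ℝ)
    (p : Coord n × Coord n) : ℝ :=
  dx i h p - ∑ j, N f j i p * dy j h p

/-- The horizontal coefficients of the Cartan connection,
`L^i_{jk} = (1/2) g^{im} (δg_{mk}/δxʲ + δg_{jm}/δxᵏ - δg_{jk}/δxᵐ)`. -/
def L (f : Coord n × Coord n → ℝ) (i j k : Fin n) (p : Coord n × Coord n) : ℝ :=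
  1 / 2 * ∑ m, gInv f i m p * (δ f j (g f m k) p + δ f k (g f j m) p - δ f m (g f j k) p)

/-- The vertical coefficients of the Cartan connection,
`C^i_{jk} = (1/2) g^{im} (∂g_{mk}/∂yʲ + ∂g_{jm}/∂yᵏ - ∂g_{jk}/∂yᵐ)`. -/
def C (f : Coord n × Coord n → ℝ) (i j k : Fin n) (p : Coord n × Coord n) : ℝ :=
  1 / 2 * ∑ m, gInv f i m p * (dy j (g f m k) p + dy k (g f j m) p - dy m (g f j k) p)

/-- The curvature of the nonlinear connection, `R^i_{jk} = δN^i_j/δxᵏ - δN^i_k/δxʲ`. -/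
def RN (f : Coord n × Coord n → ℝ) (i j k : Fin n) (p : Coord n × Coord n) : ℝ :=
  δ f k (N f i j) p - δ f j (N f i k) p

/-- The `h`-curvature of the Cartan connection,
`R^i_{hjk} = δL^i_{hj}/δxᵏ - δL^i_{hk}/δxʲ + L^s_{hj} L^i_{sk} - L^s_{hk} L^i_{sj}
  + C^i_{hs} R^s_{jk}`. -/
def R (f : Coord n × Coord n → ℝ) (i h j k : Fin n) (p : Coord n × Coord n) : ℝ :=
  δ f k (L f i h j) p - δ f j (L f i h k) p
    + ∑ s, (L f s h j p * L f i s k p - L f s h k p * L f i s j p)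
    + ∑ s, C f i h s p * RN f s j k p

/-! ### Finsler manifolds -/

section Manifold

variable {M : Type*} [TopologicalSpace M] [ChartedSpace (Coord n) M] [IsManifold (𝓡 n) ∞ M]

/-- The induced coordinates `(x, y)` of a tangent vector, in the chart of `TM` that comes from the
preferred chart of `M` at `q`. -/
def coord (q : M) (w : TangentBundle (𝓡 n) M) : Coord n × Coord n :=
  extChartAt (𝓡 n).tangent (⟨q, 0⟩ : TangentBundle (𝓡 n) M) w

/-- A function on `TM` in the induced coordinates at `q`. -/
def inCoord (F : TangentBundle (𝓡 n) M → ℝ) (q : M) (p : Coord n × Coord n) : ℝ :=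
  F ((extChartAt (𝓡 n).tangent (⟨q, 0⟩ : TangentBundle (𝓡 n) M)).symm p)

/-- The tangent vector at `q` with components `a¹, …, aⁿ` in the preferred chart at `q`
(Mathlib's `T_qM` is the model space, identified through this chart). -/
def ofComponents (q : M) (a : Fin n → ℝ) : TangentSpace (𝓡 n) q :=
  (WithLp.toLp 2 a : Coord n)

/-- The bilinear form `g_{ij}(x, y) uⁱ vʲ` on `T_xM`. -/
def metric (F : TangentBundle (𝓡 n) M → ℝ) (x : M) (y u v : TangentSpace (𝓡 n) x) : ℝ :=
  ∑ i, ∑ j, g (inCoord F x) i j (coord x ⟨x, y⟩) * (coord x ⟨x, u⟩).2 i * (coord x ⟨x, v⟩).2 j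

/-- `F` is the fundamental function of a Finsler manifold. -/
structure IsFinsler (F : TangentBundle (𝓡 n) M → ℝ) : Prop where
  pos : ∀ (x : M) (y : TangentSpace (𝓡 n) x), y ≠ 0 → 0 < F ⟨x, y⟩
  homogeneous : ∀ (x : M) (a : ℝ) (y : TangentSpace (𝓡 n) x), F ⟨x, a • y⟩ = |a| * F ⟨x, y⟩
  posDef : ∀ (x : M) (y : TangentSpace (𝓡 n) x), y ≠ 0 →
    ∀ u : TangentSpace (𝓡 n) x, u ≠ 0 → 0 < metric F x y u u
  smooth : ∀ (x : M) (y : TangentSpace (𝓡 n) x), y ≠ 0 →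
    ContMDiffAt (𝓡 n).tangent 𝓘(ℝ, ℝ) ∞ F ⟨x, y⟩
  continuous_zero : ∀ x : M, ContinuousAt F ⟨x, 0⟩

/-! ### Vector fields along a curve

A curve `c : [0,1] → M` and a vector field along it are given by functions on `ℝ`, of which only the
restrictions to `[0,1]` matter. -/

/-- The velocity `ċ` of a curve (one-sided at `0` and `1`). -/
def velocity (c : ℝ → M) (t : ℝ) : TangentSpace (𝓡 n) (c t) :=
  mfderivWithin 𝓘(ℝ, ℝ) (𝓡 n) c (Icc 0 1) t (1 : ℝ)

/-- `c` is a `C^∞` regular curve on `[0,1]`. -/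
def IsRegularCurve (c : ℝ → M) : Prop :=
  ContMDiffOn 𝓘(ℝ, ℝ) (𝓡 n) ∞ c (Icc 0 1) ∧ ∀ t ∈ Icc (0 : ℝ) 1, velocity (n := n) c t ≠ 0

/-- The components `Xⁱ(s)` of a vector field along `c`, in the preferred chart at `q`. -/
def comp (c : ℝ → M) (q : M) (X : ∀ t, TangentSpace (𝓡 n) (c t)) (s : ℝ) : Coord n :=
  (coord q ⟨c s, X s⟩).2

/-- The derivatives `dXⁱ/dt` of the components, in the preferred chart at `q`. -/
def dcomp (c : ℝ → M) (q : M) (X : ∀ t, TangentSpace (𝓡 n) (c t)) (t : ℝ) : Coord n :=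
  derivWithin (comp c q X) (Icc 0 1) t

/-- The covariant derivative along `c` for the Cartan connection,
`(∇X/dt)ⁱ = dXⁱ/dt + Xᵐ [L^i_{mk}(c,ċ) ċᵏ + C^i_{mk}(c,ċ) (c̈ᵏ + N^k_l(c,ċ) ċˡ)]`,
computed at time `t` in the preferred chart at `c t`. -/
def covDeriv (F : TangentBundle (𝓡 n) M → ℝ) (c : ℝ → M)
    (X : ∀ t, TangentSpace (𝓡 n) (c t)) (t : ℝ) : TangentSpace (𝓡 n) (c t) :=
  let f := inCoord F (c t)
  let p := coord (c t) ⟨c t, velocity c t⟩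
  let x := comp c (c t) X t
  let v := comp c (c t) (velocity c) t
  let a := dcomp c (c t) (velocity c) t
  ofComponents (c t) fun i =>
    dcomp c (c t) X t i +
      ∑ m, x m * ∑ k, (L f i m k p * v k + C f i m k p * (a k + ∑ l, N f k l p * v l))

/-- The field `R²(X, ċ)ċ`, with components `R^l_{ijk}(c,ċ) ċⁱ ċʲ Xᵏ`. -/
def curv (F : TangentBundle (𝓡 n) M → ℝ) (c : ℝ → M)
    (X : ∀ t, TangentSpace (𝓡 n) (c t)) (t : ℝ) : TangentSpace (𝓡 n) (c t) :=
  let f := inCoord F (c t)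
  let p := coord (c t) ⟨c t, velocity c t⟩
  let x := comp c (c t) X t
  let v := comp c (c t) (velocity c) t
  ofComponents (c t) fun l => ∑ i, ∑ j, ∑ k, R f l i j k p * v i * v j * x k

/-- The scalar product `g(X,Y)(c(t)) = g_{ij}(c,ċ) Xⁱ Yʲ` along `c`. -/
def scalar (F : TangentBundle (𝓡 n) M → ℝ) (c : ℝ → M)
    (X Y : ∀ t, TangentSpace (𝓡 n) (c t)) (t : ℝ) : ℝ :=
  metric F (c t) (velocity c t) (X t) (Y t)

/-- `R²(X, ċ, Y, ċ) = g(R²(Y, ċ)ċ, X)`. -/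
def curv₂ (F : TangentBundle (𝓡 n) M → ℝ) (c : ℝ → M)
    (X Y : ∀ t, TangentSpace (𝓡 n) (c t)) (t : ℝ) : ℝ :=
  scalar F c (curv F c Y) X t

/-- `c` is a geodesic on `[0,1]`: a regular curve with `∇ċ/dt = 0`. -/
def IsGeodesic (F : TangentBundle (𝓡 n) M → ℝ) (c : ℝ → M) : Prop :=
  IsRegularCurve (n := n) c ∧ ∀ t ∈ Icc (0 : ℝ) 1, covDeriv F c (velocity (n := n) c) t = 0

/-- The vector field `X` along `c` is `C^∞` on the set `s` of parameters. -/
def SmoothFieldOn (c : ℝ → M) (X : ∀ t, TangentSpace (𝓡 n) (c t)) (s : Set ℝ) : Prop :=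
  ContMDiffOn 𝓘(ℝ, ℝ) (𝓡 n).tangent ∞ (fun t => (⟨c t, X t⟩ : TangentBundle (𝓡 n) M)) s

/-- `X` is a Jacobi field along `c`: `∇/dt (∇X/dt) + R²(X, ċ)ċ = 0`. -/
def IsJacobi (F : TangentBundle (𝓡 n) M → ℝ) (c : ℝ → M)
    (X : ∀ t, TangentSpace (𝓡 n) (c t)) : Prop :=
  SmoothFieldOn c X (Icc 0 1) ∧
    ∀ t ∈ Icc (0 : ℝ) 1, covDeriv F c (covDeriv F c X) t + curv F c X t = 0

/-- `c(b)` is a conjugate point of `c(a)` along `c`, where `0 ≤ a < b ≤ 1`: some Jacobi field which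
is not identically zero vanishes at `a` and at `b`. -/
def IsConjugate (F : TangentBundle (𝓡 n) M → ℝ) (c : ℝ → M) (a b : ℝ) : Prop :=
  0 ≤ a ∧ a < b ∧ b ≤ 1 ∧ ∃ J : ∀ t, TangentSpace (𝓡 n) (c t),
    IsJacobi F c J ∧ J a = 0 ∧ J b = 0 ∧ ∃ t ∈ Icc (0 : ℝ) 1, J t ≠ 0

/-- The space `T_cΩ` of continuous, piecewise `C^∞` vector fields along `c` which vanish at the
end points.  Piecewise `C^∞` means `C^∞` on each closed interval of some finite subdivision
`0 = τ₀ < τ₁ < … < τ_k = 1`. -/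
def variationFields (c : ℝ → M) : Set (∀ t, TangentSpace (𝓡 n) (c t)) :=
  {X | ContinuousOn (fun t => (⟨c t, X t⟩ : TangentBundle (𝓡 n) M)) (Icc 0 1) ∧
    (∃ (k : ℕ) (τ : Fin (k + 1) → ℝ), StrictMono τ ∧ τ 0 = 0 ∧ τ (Fin.last k) = 1 ∧
      ∀ i : Fin k, SmoothFieldOn c X (Icc (τ i.castSucc) (τ i.succ))) ∧
    X 0 = 0 ∧ X 1 = 0}

/-- The space `T_c^⊥Ω` of the fields in `T_cΩ` which are orthogonal to `ċ`. -/
def orthogonalFields (F : TangentBundle (𝓡 n) M → ℝ) (c : ℝ → M) :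
    Set (∀ t, TangentSpace (𝓡 n) (c t)) :=
  {X ∈ variationFields c | ∀ t ∈ Icc (0 : ℝ) 1, scalar F c X (velocity c) t = 0}

/-- The index form `I(X) = ∫₀¹ (‖∇X/dt‖² - R²(X, ċ, X, ċ)) dt`.  (The integrand has no meaning at
the finitely many break points of `X`, which do not contribute to the integral.) -/
def indexForm (F : TangentBundle (𝓡 n) M → ℝ) (c : ℝ → M)
    (X : ∀ t, TangentSpace (𝓡 n) (c t)) : ℝ :=
  ∫ t in (0 : ℝ)..1, (scalar F c (covDeriv F c X) (covDeriv F c X) t - curv₂ F c X X t)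

end Manifold

end

end Finsler

/-! Along a geodesic the Cartan connection behaves like a Levi-Civita connection. Homogeneity of `F`
gives `L^i_{jk} yᵏ = N^i_j` and `C^i_{hs} yʰ = 0` (`IsLocal.L_y`, `IsLocal.C_y`). Hence `∇ċ/dt = 0`
reads `c̈ + N ċ = 0`, the factor multiplying `C` vanishes, and `∇X/dt = X' + N X` for every field
`X`. In the same way `R^i_{hjk} yʰ yʲ` collapses to the Jacobi endomorphism `R^i_{jk} yʲ` of the
nonlinear connection, which is determined by the geodesic spray, is self-adjoint for `g` and kills
`ċ` (`IsLocal.g_jacobiCoeff_symm`, `jac_self`).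

The objects along `c` are computed at time `t` in the chart preferred at `c t`, so differentiating
in `t` requires their transformation laws. These come from the spray: the Euler-Lagrange equation of
`F²` determines it, so it is natural under changes of coordinates. Differentiating this naturality
gives the law of `N`, and differentiating again gives the tensoriality of the Jacobi endomorphism
(`IsTransition.fderiv_jac`).

Parallel transport preserves `g`, so there is a parallel orthonormal frame
(`IsGeodesic.exists_parallelFrame`). In it a field becomes a curve `u` in Euclidean space, `∇/dt`
becomes `d/dt`, Jacobi fields become the solutions of `u'' + S u = 0` with `S t` symmetric, and the
index form becomes `∫ ‖u'‖² - ⟪S u, u⟫`. The velocity becomes a constant vector in the kernel of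
every `S t`.

Without conjugate points, the operator solution `A` with `A 0 = 0`, `A' 0 = 1` is invertible on
`(0,1]`, and `U = A' A⁻¹` is a symmetric solution of the Riccati equation `U' = -S - U²`. Completing
the square, `‖w'‖² - ⟪S w, w⟫ = ‖w' - U w‖² + d/dt ⟪U w, w⟫`, and the boundary terms vanish. So the
index form is nonnegative on all of `variationFields c`; if it is zero, then `A⁻¹ w` is constant and
`w 1 = 0` forces `w = 0` (`integral_pos_of_no_conjugate`).

Conversely, a Jacobi field vanishing at `0` and at `b` has an affine tangential component with two
zeros, hence is orthogonal to `ċ`. Extended by zero beyond `b` it lies in `orthogonalFields F c`, is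
not zero by uniqueness for the Jacobi equation, and has index form `[⟪u', u⟫]₀ᵇ = 0`
(`IsParallelFrame.exists_indexForm_eq_zero`). -/

open scoped Manifold ContDiff
open Set

namespace Finsler

/-! ### Local calculus on the slit tangent bundle of a coordinate domain -/

section LocalCalculus

variable {n : ℕ} {f h : Coord n × Coord n → ℝ} {O : Set (Coord n)} {p : Coord n × Coord n}

/-- The slit tangent bundle over a set `O` of the coordinate space. -/
def slit (O : Set (Coord n)) : Set (Coord n × Coord n) := {p | p.1 ∈ O ∧ p.2 ≠ 0}

/-- `f` is the fundamental function of a Finsler metric on the coordinate domain `O`. -/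
structure IsLocal (f : Coord n × Coord n → ℝ) (O : Set (Coord n)) : Prop where
  isOpen : IsOpen O
  smooth : ∀ p ∈ slit O, ContDiffAt ℝ ∞ f p
  homogeneous : ∀ x ∈ O, ∀ (a : ℝ) (y : Coord n), f (x, a • y) = |a| * f (x, y)
  posDef : ∀ p ∈ slit O, ∀ u : Coord n, u ≠ 0 → 0 < ∑ i, ∑ j, g f i j p * u i * u j

/-- A scalar function is smooth on the slit tangent bundle over `O`. -/
def SlitSmooth (O : Set (Coord n)) (h : Coord n × Coord n → ℝ) : Prop :=
  ∀ p ∈ slit O, ContDiffAt ℝ ∞ h p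

theorem isOpen_slit (hO : IsOpen O) : IsOpen (slit O) :=
  (hO.preimage continuous_fst).inter (isOpen_ne.preimage continuous_snd)

theorem IsLocal.slit_mem_nhds (H : IsLocal f O) (hp : p ∈ slit O) : slit O ∈ nhds p :=
  (isOpen_slit H.isOpen).mem_nhds hp

theorem SlitSmooth.differentiableAt (hh : SlitSmooth O h) (hp : p ∈ slit O) :
    DifferentiableAt ℝ h p := (hh p hp).differentiableAt (by simp)

theorem IsLocal.fderiv_congr (H : IsLocal f O) {h₁ h₂ : Coord n × Coord n → ℝ}
    (he : ∀ q ∈ slit O, h₁ q = h₂ q) (hp : p ∈ slit O) : fderiv ℝ h₁ p = fderiv ℝ h₂ p :=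
  Filter.EventuallyEq.fderiv_eq (Filter.eventually_of_mem (H.slit_mem_nhds hp) he)

theorem SlitSmooth.fderiv_apply (hh : SlitSmooth O h) (v : Coord n × Coord n) :
    SlitSmooth O (fun q => fderiv ℝ h q v) := fun p hp =>
  ((hh p hp).fderiv_right (m := ∞) (by simp)).clm_apply contDiffAt_const

theorem SlitSmooth.dx (hh : SlitSmooth O h) (i : Fin n) : SlitSmooth O (dx i h) :=
  hh.fderiv_apply _

theorem SlitSmooth.dy (hh : SlitSmooth O h) (i : Fin n) : SlitSmooth O (dy i h) :=
  hh.fderiv_apply _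

theorem slitSmooth_const (a : ℝ) : SlitSmooth O (fun _ => a) := fun _ _ => contDiffAt_const

theorem slitSmooth_y (k : Fin n) : SlitSmooth O (fun q => q.2 k) := fun p _ => by
  have : (fun q : Coord n × Coord n => q.2 k) =
    fun q => (EuclideanSpace.proj k : Coord n →L[ℝ] ℝ) q.2 := rfl
  rw [this]
  exact (EuclideanSpace.proj k : Coord n →L[ℝ] ℝ).contDiff.contDiffAt.comp p contDiffAt_snd

theorem SlitSmooth.mul {h₁ h₂ : Coord n × Coord n → ℝ} (a : SlitSmooth O h₁)
    (b : SlitSmooth O h₂) : SlitSmooth O (fun q => h₁ q * h₂ q) :=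
  fun p hp => (a p hp).mul (b p hp)

theorem SlitSmooth.add {h₁ h₂ : Coord n × Coord n → ℝ} (a : SlitSmooth O h₁)
    (b : SlitSmooth O h₂) : SlitSmooth O (fun q => h₁ q + h₂ q) :=
  fun p hp => (a p hp).add (b p hp)

theorem SlitSmooth.sub {h₁ h₂ : Coord n × Coord n → ℝ} (a : SlitSmooth O h₁)
    (b : SlitSmooth O h₂) : SlitSmooth O (fun q => h₁ q - h₂ q) :=
  fun p hp => (a p hp).sub (b p hp)

theorem SlitSmooth.sum {ι : Type*} {s : Finset ι} {h : ι → Coord n × Coord n → ℝ}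
    (a : ∀ i, SlitSmooth O (h i)) : SlitSmooth O (fun q => ∑ i ∈ s, h i q) :=
  fun p hp => ContDiffAt.sum fun i _ => a i p hp

theorem SlitSmooth.prod {ι : Type*} {s : Finset ι} {h : ι → Coord n × Coord n → ℝ}
    (a : ∀ i, SlitSmooth O (h i)) : SlitSmooth O (fun q => ∏ i ∈ s, h i q) :=
  fun p hp => contDiffAt_prod fun i _ => a i p hp

theorem slitSmooth_det {A : Fin n → Fin n → Coord n × Coord n → ℝ}
    (hA : ∀ i j, SlitSmooth O (A i j)) :
    SlitSmooth O (fun q => (Matrix.of fun i j => A i j q).det) := by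
  simp only [Matrix.det_apply, Matrix.of_apply, Units.smul_def, zsmul_eq_mul]
  exact SlitSmooth.sum fun σ => (slitSmooth_const _).mul (SlitSmooth.prod fun i => hA _ _)

theorem IsLocal.smooth_energy (H : IsLocal f O) : SlitSmooth O (fun q => f q ^ 2) :=
  fun p hp => (H.smooth p hp).pow 2

theorem IsLocal.smooth_g (H : IsLocal f O) (i j : Fin n) : SlitSmooth O (g f i j) :=
  (slitSmooth_const _).mul ((H.smooth_energy.dy j).dy i)

theorem euclidean_eq_sum_single (u : Coord n) :
    u = ∑ i, u i • (EuclideanSpace.single i 1 : Coord n) := by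
  ext j
  simp [Finset.sum_apply, Pi.single_apply]

theorem fderiv_eq_sum (h : Coord n × Coord n → ℝ) (p : Coord n × Coord n) (u w : Coord n) :
    fderiv ℝ h p (u, w) = ∑ i, u i * dx i h p + ∑ i, w i * dy i h p := by
  have e : ((u, w) : Coord n × Coord n) =
      ∑ i, u i • ((EuclideanSpace.single i 1, 0) : Coord n × Coord n)
        + ∑ i, w i • ((0, EuclideanSpace.single i 1) : Coord n × Coord n) := by
    ext1
    · simpa [Prod.fst_sum] using euclidean_eq_sum_single u
    · simpa [Prod.snd_sum] using euclidean_eq_sum_single w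
  rw [e, map_add, map_sum, map_sum]
  simp only [map_smul, smul_eq_mul, dx, dy]

theorem SlitSmooth.fderiv_fderiv_symm (hh : SlitSmooth O h) (hp : p ∈ slit O)
    (v w : Coord n × Coord n) :
    fderiv ℝ (fun q => fderiv ℝ h q v) p w = fderiv ℝ (fun q => fderiv ℝ h q w) p v := by
  have hs : IsSymmSndFDerivAt ℝ h p := (hh p hp).isSymmSndFDerivAt (by
    rw [minSmoothness_of_isRCLikeNormedField]; exact WithTop.coe_le_coe.2 le_top)
  have hd : DifferentiableAt ℝ (fderiv ℝ h) p :=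
    ((hh p hp).fderiv_right (m := ∞) (by simp)).differentiableAt (by simp)
  rw [fderiv_clm_apply hd (differentiableAt_const _), fderiv_clm_apply hd (differentiableAt_const _)]
  simpa using hs w v

theorem SlitSmooth.dx_dx (hh : SlitSmooth O h) (hp : p ∈ slit O) (i j : Fin n) :
    Finsler.dx i (Finsler.dx j h) p = Finsler.dx j (Finsler.dx i h) p :=
  hh.fderiv_fderiv_symm hp _ _

theorem SlitSmooth.dx_dy (hh : SlitSmooth O h) (hp : p ∈ slit O) (i j : Fin n) :
    Finsler.dx i (Finsler.dy j h) p = Finsler.dy j (Finsler.dx i h) p :=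
  hh.fderiv_fderiv_symm hp _ _

theorem SlitSmooth.dy_dy (hh : SlitSmooth O h) (hp : p ∈ slit O) (i j : Fin n) :
    Finsler.dy i (Finsler.dy j h) p = Finsler.dy j (Finsler.dy i h) p :=
  hh.fderiv_fderiv_symm hp _ _

theorem fderiv_sum_mul {ι : Type*} {s : Finset ι} {a b : ι → Coord n × Coord n → ℝ}
    (ha : ∀ i, SlitSmooth O (a i)) (hb : ∀ i, SlitSmooth O (b i)) (hp : p ∈ slit O)
    (w : Coord n × Coord n) :
    fderiv ℝ (fun q => ∑ i ∈ s, a i q * b i q) p w =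
      ∑ i ∈ s, (fderiv ℝ (a i) p w * b i p + a i p * fderiv ℝ (b i) p w) := by
  rw [fderiv_fun_sum fun i _ => ((ha i).differentiableAt hp).fun_mul ((hb i).differentiableAt hp)]
  rw [sum_apply]
  refine Finset.sum_congr rfl fun i _ => ?_
  rw [fderiv_fun_mul ((ha i).differentiableAt hp) ((hb i).differentiableAt hp)]
  simp only [add_apply, smul_apply, smul_eq_mul]
  ring

theorem fderiv_y (k : Fin n) (p w : Coord n × Coord n) :
    fderiv ℝ (fun q : Coord n × Coord n => q.2 k) p w = w.2 k := by
  have : (fun q : Coord n × Coord n => q.2 k) =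
    ((EuclideanSpace.proj k : Coord n →L[ℝ] ℝ).comp
      (ContinuousLinearMap.snd ℝ (Coord n) (Coord n))) := rfl
  rw [this, ContinuousLinearMap.fderiv]
  rfl

theorem fderiv_sum_y {a : Fin n → Coord n × Coord n → ℝ}
    (ha : ∀ i, SlitSmooth O (a i)) (hp : p ∈ slit O) (w : Coord n × Coord n) :
    fderiv ℝ (fun q => ∑ k, a k q * q.2 k) p w =
      ∑ k, fderiv ℝ (a k) p w * p.2 k + ∑ k, a k p * w.2 k := by
  rw [fderiv_sum_mul ha slitSmooth_y hp, Finset.sum_add_distrib]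
  simp only [fderiv_y]

theorem dx_sum_y {a : Fin n → Coord n × Coord n → ℝ}
    (ha : ∀ i, SlitSmooth O (a i)) (hp : p ∈ slit O) (m : Fin n) :
    dx m (fun q => ∑ k, a k q * q.2 k) p = ∑ k, dx m (a k) p * p.2 k := by
  rw [dx, fderiv_sum_y ha hp]
  simp [dx]

theorem dy_sum_y {a : Fin n → Coord n × Coord n → ℝ}
    (ha : ∀ i, SlitSmooth O (a i)) (hp : p ∈ slit O) (m : Fin n) :
    dy m (fun q => ∑ k, a k q * q.2 k) p = ∑ k, dy m (a k) p * p.2 k + a m p := by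
  rw [dy, fderiv_sum_y ha hp]
  simp [dy]

theorem δ_eq_fderiv (f h : Coord n × Coord n → ℝ) (p : Coord n × Coord n) (i : Fin n) :
    δ f i h p =
      fderiv ℝ h p (EuclideanSpace.single i 1, WithLp.toLp 2 fun j => - N f j i p) := by
  rw [fderiv_eq_sum, δ]
  simp [sub_eq_add_neg]

theorem δ_sum_y {a : Fin n → Coord n × Coord n → ℝ}
    (ha : ∀ i, SlitSmooth O (a i)) (hp : p ∈ slit O) (m : Fin n) :
    δ f m (fun q => ∑ k, a k q * q.2 k) p =
      ∑ k, δ f m (a k) p * p.2 k - ∑ k, a k p * N f k m p := by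
  rw [δ_eq_fderiv, fderiv_sum_y ha hp]
  simp [δ_eq_fderiv, sub_eq_add_neg]

/-! ### Consequences of homogeneity -/

/-- The coefficients `2 Gⁱ = Γ^i_{kl} yᵏ yˡ` of the geodesic spray. -/
noncomputable def sprayCoeff (f : Coord n × Coord n → ℝ) (i : Fin n) (p : Coord n × Coord n) : ℝ :=
  ∑ k, ∑ l, Γ f i k l p * p.2 k * p.2 l

theorem N_eq (f : Coord n × Coord n → ℝ) (i j : Fin n) (p : Coord n × Coord n) :
    N f i j p = 1 / 2 * dy j (sprayCoeff f i) p := rfl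

/-- The derivative `yʲ ∂h/∂xʲ - 2 Gʲ ∂h/∂yʲ` along the geodesic spray. -/
noncomputable def sprayDeriv (f h : Coord n × Coord n → ℝ) (p : Coord n × Coord n) : ℝ :=
  fderiv ℝ h p (p.2, WithLp.toLp 2 fun j => - sprayCoeff f j p)

theorem sprayDeriv_eq (f h : Coord n × Coord n → ℝ) (p : Coord n × Coord n) :
    sprayDeriv f h p = ∑ j, p.2 j * dx j h p - ∑ j, sprayCoeff f j p * dy j h p := by
  rw [sprayDeriv, fderiv_eq_sum]
  simp [sub_eq_add_neg]

/-- The mixed second derivatives `(1/2) ∂²F²/∂xᵏ∂yᵐ`. -/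
noncomputable def mixed (f : Coord n × Coord n → ℝ) (m k : Fin n) (p : Coord n × Coord n) : ℝ :=
  1 / 2 * dx k (dy m fun q => f q ^ 2) p

theorem dx_const_mul (hh : SlitSmooth O h) (hp : p ∈ slit O) (a : ℝ) (i : Fin n) :
    dx i (fun q => a * h q) p = a * dx i h p := by
  rw [dx, fderiv_const_mul (hh.differentiableAt hp)]; rfl

theorem dy_const_mul (hh : SlitSmooth O h) (hp : p ∈ slit O) (a : ℝ) (i : Fin n) :
    dy i (fun q => a * h q) p = a * dy i h p := by
  rw [dy, fderiv_const_mul (hh.differentiableAt hp)]; rfl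

theorem IsLocal.dx_congr (H : IsLocal f O) {h₁ h₂ : Coord n × Coord n → ℝ}
    (he : ∀ q ∈ slit O, h₁ q = h₂ q) (hp : p ∈ slit O) (i : Fin n) :
    dx i h₁ p = dx i h₂ p := by rw [dx, dx, H.fderiv_congr he hp]

theorem IsLocal.dy_congr (H : IsLocal f O) {h₁ h₂ : Coord n × Coord n → ℝ}
    (he : ∀ q ∈ slit O, h₁ q = h₂ q) (hp : p ∈ slit O) (i : Fin n) :
    dy i h₁ p = dy i h₂ p := by rw [dy, dy, H.fderiv_congr he hp]

theorem IsLocal.δ_congr (H : IsLocal f O) {h₁ h₂ : Coord n × Coord n → ℝ}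
    (he : ∀ q ∈ slit O, h₁ q = h₂ q) (hp : p ∈ slit O) (i : Fin n) :
    δ f i h₁ p = δ f i h₂ p := by rw [δ_eq_fderiv, δ_eq_fderiv, H.fderiv_congr he hp]

theorem IsLocal.sprayDeriv_congr (H : IsLocal f O) {h₁ h₂ : Coord n × Coord n → ℝ}
    (he : ∀ q ∈ slit O, h₁ q = h₂ q) (hp : p ∈ slit O) :
    sprayDeriv f h₁ p = sprayDeriv f h₂ p := by
  rw [sprayDeriv, sprayDeriv, H.fderiv_congr he hp]

variable (H : IsLocal f O)
include H

theorem IsLocal.smooth_mixed (i j : Fin n) : SlitSmooth O (mixed f i j) :=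
  (slitSmooth_const _).mul ((H.smooth_energy.dy i).dx j)

theorem IsLocal.g_symm (hp : p ∈ slit O) (i j : Fin n) : g f i j p = g f j i p := by
  rw [g, g, H.smooth_energy.dy_dy hp]

/-- Total symmetry of the Cartan tensor: these are third vertical derivatives of `F²/2`, and the
order of differentiation is irrelevant. -/
theorem IsLocal.dy_g_symm (hp : p ∈ slit O) (i j k : Fin n) :
    dy i (g f j k) p = dy k (g f j i) p := by
  have e : ∀ a b c, dy a (g f b c) p = 1 / 2 * dy a (dy b (dy c fun q => f q ^ 2)) p :=
    fun a b c => dy_const_mul ((H.smooth_energy.dy c).dy b) hp _ _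
  rw [e, e, (H.smooth_energy.dy k).dy_dy hp,
    H.dy_congr (fun q hq => H.smooth_energy.dy_dy hq i k) hp, (H.smooth_energy.dy i).dy_dy hp,
    (H.smooth_energy.dy i).dy_dy hp, H.dy_congr (fun q hq => H.smooth_energy.dy_dy hq k i) hp,
    H.dy_congr (fun q hq => H.smooth_energy.dy_dy hq i k) hp]

/-- Euler's identity for the 2-homogeneous function `F²`: differentiate `F²(x, a y) = a² F²(x, y)`
at `a = 1`. The contraction identities with `y` below come from differentiating it. -/
theorem IsLocal.euler (hp : p ∈ slit O) :
    ∑ l, dy l (fun q => f q ^ 2) p * p.2 l = 2 * f p ^ 2 := by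
  have hd : HasFDerivAt (fun q => f q ^ 2) (fderiv ℝ (fun q => f q ^ 2) p) (p.1, (1 : ℝ) • p.2) := by
    simpa using (H.smooth_energy.differentiableAt hp).hasFDerivAt
  have hc : HasDerivAt (fun a : ℝ => (p.1, a • p.2)) (0, (1 : ℝ) • p.2) 1 :=
    (hasDerivAt_const _ _).prodMk ((hasDerivAt_id (1 : ℝ)).smul_const p.2)
  have h1 := hd.comp_hasDerivAt (1 : ℝ) hc
  have h2 : HasDerivAt (fun a : ℝ => a ^ 2 * f p ^ 2) (2 * f p ^ 2) 1 := by
    simpa using (hasDerivAt_pow 2 (1 : ℝ)).mul_const (f p ^ 2)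
  have h3 : ((fun q => f q ^ 2) ∘ fun a : ℝ => (p.1, a • p.2)) = fun a : ℝ => a ^ 2 * f p ^ 2 := by
    funext a
    simp only [Function.comp, H.homogeneous _ hp.1, mul_pow, sq_abs]
  rw [h3] at h1
  have h4 := h1.unique h2
  rw [one_smul, fderiv_eq_sum] at h4
  simp only [PiLp.zero_apply, zero_mul, Finset.sum_const_zero, zero_add] at h4
  rw [← h4]
  exact Finset.sum_congr rfl fun i _ => mul_comm _ _

theorem IsLocal.g_y (hp : p ∈ slit O) (m : Fin n) :
    ∑ l, g f m l p * p.2 l = 1 / 2 * dy m (fun q => f q ^ 2) p := by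
  have h1 := H.dy_congr (fun q hq => H.euler hq) hp m
  rw [dy_sum_y (fun i => H.smooth_energy.dy i) hp, dy_const_mul H.smooth_energy hp] at h1
  have h2 : ∑ l, g f m l p * p.2 l = 1 / 2 * ∑ l, dy m (dy l fun q => f q ^ 2) p * p.2 l := by
    rw [Finset.mul_sum]
    exact Finset.sum_congr rfl fun l _ => by rw [g]; ring
  rw [h2]; linarith

/-- A vertical derivative of `g_y`: the term produced by differentiating `yˡ` already equals the
right side. Equivalently, `g` is 0-homogeneous in `y`, which is why the Cartan tensor is annihilated
by `y`. -/
theorem IsLocal.dy_g_y (hp : p ∈ slit O) (k m : Fin n) :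
    ∑ l, dy k (g f m l) p * p.2 l = 0 := by
  have h1 := H.dy_congr (fun q hq => H.g_y hq m) hp k
  rw [dy_sum_y (fun i => H.smooth_g m i) hp, dy_const_mul (H.smooth_energy.dy m) hp] at h1
  have h2 : 1 / 2 * dy k (dy m fun q => f q ^ 2) p = g f k m p := rfl
  rw [h2, H.g_symm hp k m] at h1
  linarith

theorem IsLocal.dx_g_y (hp : p ∈ slit O) (k m : Fin n) :
    ∑ l, dx k (g f m l) p * p.2 l = mixed f m k p := by
  have h1 := H.dx_congr (fun q hq => H.g_y hq m) hp k
  rwa [dx_sum_y (fun i => H.smooth_g m i) hp, dx_const_mul (H.smooth_energy.dy m) hp] at h1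

theorem IsLocal.mixed_y (hp : p ∈ slit O) (k : Fin n) :
    ∑ m, mixed f m k p * p.2 m = dx k (fun q => f q ^ 2) p := by
  have h1 := H.dx_congr (fun q hq => H.euler hq) hp k
  rw [dx_sum_y (fun i => H.smooth_energy.dy i) hp, dx_const_mul H.smooth_energy hp] at h1
  have h2 : ∑ m, mixed f m k p * p.2 m = 1 / 2 * ∑ l, dx k (dy l fun q => f q ^ 2) p * p.2 l := by
    rw [Finset.mul_sum]
    exact Finset.sum_congr rfl fun l _ => by rw [mixed]; ring
  rw [h2]; linarith

theorem IsLocal.dy_mixed (hp : p ∈ slit O) (j m k : Fin n) :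
    dy j (mixed f m k) p = dx k (g f j m) p := by
  have e1 : dy j (mixed f m k) p = 1 / 2 * dy j (dx k (dy m fun q => f q ^ 2)) p :=
    dy_const_mul ((H.smooth_energy.dy m).dx k) hp _ _
  have e2 : dx k (g f j m) p = 1 / 2 * dx k (dy j (dy m fun q => f q ^ 2)) p :=
    dx_const_mul ((H.smooth_energy.dy m).dy j) hp _ _
  rw [e1, e2, (H.smooth_energy.dy m).dx_dy hp]

/-! ### The inverse of the fundamental tensor -/

theorem IsLocal.det_g_ne_zero (hp : p ∈ slit O) : (Matrix.of fun k l => g f k l p).det ≠ 0 := by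
  intro h0
  obtain ⟨v, hv, hv0⟩ := Matrix.exists_mulVec_eq_zero_iff.mpr h0
  have hpos := H.posDef p hp (WithLp.toLp 2 v) (fun h => hv (by simpa using h))
  have : ∑ i, ∑ j, g f i j p * v i * v j = 0 := by
    have : ∀ i, ∑ j, g f i j p * v i * v j = v i * ((Matrix.of fun k l => g f k l p).mulVec v) i := by
      intro i
      simp only [Matrix.mulVec, dotProduct, Matrix.of_apply, Finset.mul_sum]
      exact Finset.sum_congr rfl fun j _ => by ring
    simp [this, hv0]
  simp only at hpos
  linarith

theorem IsLocal.g_gInv (hp : p ∈ slit O) (i j : Fin n) :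
    ∑ k, g f i k p * gInv f k j p = if i = j then 1 else 0 := by
  have := Matrix.mul_nonsing_inv (Matrix.of fun k l => g f k l p)
    (isUnit_iff_ne_zero.mpr (H.det_g_ne_zero hp))
  have := congrFun (congrFun this i) j
  simpa [Matrix.mul_apply, gInv, Matrix.one_apply] using this

theorem IsLocal.gInv_g (hp : p ∈ slit O) (i j : Fin n) :
    ∑ k, gInv f i k p * g f k j p = if i = j then 1 else 0 := by
  have := Matrix.nonsing_inv_mul (Matrix.of fun k l => g f k l p)
    (isUnit_iff_ne_zero.mpr (H.det_g_ne_zero hp))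
  have := congrFun (congrFun this i) j
  simpa [Matrix.mul_apply, gInv, Matrix.one_apply] using this

/-- Lowering an index which was raised by `g^{im}`. -/
theorem IsLocal.g_sum_gInv (hp : p ∈ slit O) (m : Fin n) (a : Fin n → ℝ) :
    ∑ i, g f m i p * ∑ l, gInv f i l p * a l = a m := by
  simp only [Finset.mul_sum]
  rw [Finset.sum_comm]
  have : ∀ l, ∑ i, g f m i p * (gInv f i l p * a l) = (if m = l then 1 else 0) * a l := by
    intro l
    rw [← H.g_gInv hp, Finset.sum_mul]
    exact Finset.sum_congr rfl fun i _ => by ring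
  simp [this]

/-- Equality of vectors can be tested after lowering the index. -/
theorem IsLocal.eq_of_g_sum_eq (hp : p ∈ slit O) {a b : Fin n → ℝ}
    (hab : ∀ m, ∑ i, g f m i p * a i = ∑ i, g f m i p * b i) (i : Fin n) : a i = b i := by
  have key : ∀ c : Fin n → ℝ, ∑ m, gInv f i m p * ∑ j, g f m j p * c j = c i := by
    intro c
    simp only [Finset.mul_sum]
    rw [Finset.sum_comm]
    have : ∀ l, ∑ m, gInv f i m p * (g f m l p * c l) = (if i = l then 1 else 0) * c l := by
      intro l
      rw [← H.gInv_g hp, Finset.sum_mul]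
      exact Finset.sum_congr rfl fun i _ => by ring
    simp [this]
  rw [← key a, ← key b]
  simp only [hab]

/-- Cramer's rule: the entries are adjugate entries, which are determinants of smooth matrices,
divided by a nonvanishing determinant. -/
theorem IsLocal.smooth_gInv (i j : Fin n) : SlitSmooth O (gInv f i j) := by
  have hadj : SlitSmooth O fun q => (Matrix.of fun k l => g f k l q).adjugate i j := by
    have : ∀ q, (Matrix.of fun k l => g f k l q).adjugate i j =
        (Matrix.of fun k l => if k = j then (Pi.single i 1 : Fin n → ℝ) l else g f k l q).det := by
      intro q
      rw [Matrix.adjugate_apply]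
      congr 1
      ext k l
      simp [Matrix.updateRow_apply]
    simp only [this]
    refine slitSmooth_det (A := fun k l q => if k = j then (Pi.single i 1 : Fin n → ℝ) l
      else g f k l q) fun k l => ?_
    by_cases hk : k = j
    · simp only [hk, if_true]; exact slitSmooth_const _
    · simp only [hk, if_false]; exact H.smooth_g k l
  have hdet := slitSmooth_det H.smooth_g
  intro p hp
  have : gInv f i j = fun q => ((Matrix.of fun k l => g f k l q).det)⁻¹ *
      (Matrix.of fun k l => g f k l q).adjugate i j := by
    funext q
    simp [gInv, Matrix.inv_def, Ring.inverse_eq_inv']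
  rw [this]
  exact ((hdet p hp).inv (H.det_g_ne_zero hp)).mul (hadj p hp)

theorem IsLocal.smooth_Γ (i j k : Fin n) : SlitSmooth O (Γ f i j k) :=
  (slitSmooth_const _).mul (SlitSmooth.sum fun m => (H.smooth_gInv i m).mul
    ((((H.smooth_g m k).dx j).add ((H.smooth_g j m).dx k)).sub ((H.smooth_g j k).dx m)))

theorem IsLocal.smooth_sprayCoeff (i : Fin n) : SlitSmooth O (sprayCoeff f i) :=
  SlitSmooth.sum fun k => SlitSmooth.sum fun l =>
    ((H.smooth_Γ i k l).mul (slitSmooth_y k)).mul (slitSmooth_y l)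

theorem IsLocal.smooth_N (i j : Fin n) : SlitSmooth O (N f i j) :=
  (slitSmooth_const _).mul ((H.smooth_sprayCoeff i).dy j)

theorem IsLocal.smooth_δ (hh : SlitSmooth O h) (i : Fin n) : SlitSmooth O (δ f i h) :=
  (hh.dx i).sub (SlitSmooth.sum fun j => (H.smooth_N j i).mul (hh.dy j))

theorem IsLocal.smooth_L (i j k : Fin n) : SlitSmooth O (L f i j k) :=
  (slitSmooth_const _).mul (SlitSmooth.sum fun m => (H.smooth_gInv i m).mul
    (((H.smooth_δ (H.smooth_g m k) j).add (H.smooth_δ (H.smooth_g j m) k)).sub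
      (H.smooth_δ (H.smooth_g j k) m)))

theorem IsLocal.smooth_sprayDeriv (hh : SlitSmooth O h) : SlitSmooth O (sprayDeriv f h) := by
  have : sprayDeriv f h = fun p => ∑ j, p.2 j * Finsler.dx j h p
      - ∑ j, sprayCoeff f j p * Finsler.dy j h p := funext fun p => sprayDeriv_eq f h p
  rw [this]
  exact (SlitSmooth.sum fun j => (slitSmooth_y j).mul (hh.dx j)).sub
    (SlitSmooth.sum fun j => (H.smooth_sprayCoeff j).mul (hh.dy j))

end LocalCalculus

end Finsler

namespace Finsler

/-! ### Identities for the Cartan connection -/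

section CartanIdentities

variable {n : ℕ} {f h : Coord n × Coord n → ℝ} {O : Set (Coord n)} {p : Coord n × Coord n}

theorem sum_sum_sum_rotate {n : ℕ} (a : Fin n → Fin n → Fin n → ℝ) :
    ∑ k, ∑ l, ∑ m, a k l m = ∑ m, ∑ k, ∑ l, a k l m := by
  have : ∀ k, ∑ l, ∑ m, a k l m = ∑ m, ∑ l, a k l m := fun k => Finset.sum_comm
  simp only [this]
  rw [Finset.sum_comm]

variable (H : IsLocal f O)
include H

/-- Contracted with `yᵏ yˡ`, the first two Christoffel terms agree and the third is `∂F²/∂xᵐ`. What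
remains is half the Euler-Lagrange expression of `F²`, free of `g⁻¹`; working with lowered indices
avoids ever differentiating the inverse matrix. -/
theorem IsLocal.g_sprayCoeff (hp : p ∈ slit O) (m : Fin n) :
    ∑ i, g f m i p * sprayCoeff f i p =
      ∑ k, mixed f m k p * p.2 k - 1 / 2 * dx m (fun q => f q ^ 2) p := by
  have e : ∀ i, sprayCoeff f i p = ∑ m, gInv f i m p * (1 / 2 * ∑ k, ∑ l,
      (dx k (g f m l) p + dx l (g f k m) p - dx m (g f k l) p) * p.2 k * p.2 l) := by
    intro i
    simp only [sprayCoeff, Γ, Finset.mul_sum, Finset.sum_mul]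
    rw [sum_sum_sum_rotate]
    exact Finset.sum_congr rfl fun m _ => Finset.sum_congr rfl fun k _ =>
      Finset.sum_congr rfl fun l _ => by ring
  simp only [e]
  rw [H.g_sum_gInv hp]
  have e1 : ∑ k, ∑ l, dx k (g f m l) p * p.2 k * p.2 l = ∑ k, mixed f m k p * p.2 k :=
    Finset.sum_congr rfl fun k _ => by
      rw [← H.dx_g_y hp, Finset.sum_mul]
      exact Finset.sum_congr rfl fun l _ => by ring
  have e2 : ∑ k, ∑ l, dx l (g f k m) p * p.2 k * p.2 l = ∑ k, mixed f m k p * p.2 k := by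
    rw [Finset.sum_comm]
    refine Finset.sum_congr rfl fun k _ => ?_
    rw [← H.dx_g_y hp, Finset.sum_mul]
    exact Finset.sum_congr rfl fun l _ => by rw [H.dx_congr (fun q hq => H.g_symm hq l m) hp]
  have e3 : ∑ k, ∑ l, dx m (g f k l) p * p.2 k * p.2 l = dx m (fun q => f q ^ 2) p := by
    rw [← H.mixed_y hp]
    refine Finset.sum_congr rfl fun k _ => ?_
    rw [← H.dx_g_y hp, Finset.sum_mul]
    exact Finset.sum_congr rfl fun l _ => by ring
  simp only [sub_mul, add_mul, Finset.sum_sub_distrib, Finset.sum_add_distrib, e1, e2, e3]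
  ring

/-- The vertical derivative of `g_sprayCoeff`. Total symmetry of `∂g/∂y` turns the term in which `g`
is differentiated into the vertical part of the spray derivative of `g_{mj}`. The result splits into
a part symmetric in `m, j` and an antisymmetric part made of mixed derivatives. -/
theorem IsLocal.g_N (hp : p ∈ slit O) (m j : Fin n) :
    ∑ i, g f m i p * N f i j p =
      1 / 2 * (sprayDeriv f (g f m j) p + mixed f m j p - mixed f j m p) := by
  have h1 := H.dy_congr (fun q hq => H.g_sprayCoeff hq m) hp j
  rw [dy, fderiv_sum_mul (fun i => H.smooth_g m i) H.smooth_sprayCoeff hp] at h1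
  have h2 : dy j (fun q => ∑ k, mixed f m k q * q.2 k - 1 / 2 * dx m (fun q => f q ^ 2) q) p =
      ∑ k, dx k (g f m j) p * p.2 k + mixed f m j p - mixed f j m p := by
    have hs : SlitSmooth O fun q => ∑ k, mixed f m k q * q.2 k :=
      SlitSmooth.sum fun k => (H.smooth_mixed m k).mul (slitSmooth_y k)
    have hE := (slitSmooth_const (1 / 2 : ℝ)).mul (H.smooth_energy.dx m)
    rw [dy, fderiv_fun_sub (hs.differentiableAt hp) (hE.differentiableAt hp), sub_apply]
    change dy j (fun q => ∑ k, mixed f m k q * q.2 k) p -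
      dy j (fun q => 1 / 2 * dx m (fun q => f q ^ 2) q) p = _
    rw [dy_sum_y (fun k => H.smooth_mixed m k) hp, dy_const_mul (H.smooth_energy.dx m) hp,
      ← H.smooth_energy.dx_dy hp]
    have : ∀ k, dy j (mixed f m k) p = dx k (g f m j) p := fun k => by
      rw [H.dy_mixed hp, H.dx_congr (fun q hq => H.g_symm hq j m) hp]
    simp only [this, mixed]
  rw [h2, Finset.sum_add_distrib] at h1
  change ∑ i, dy j (g f m i) p * sprayCoeff f i p + ∑ i, g f m i p * dy j (sprayCoeff f i) p = _
    at h1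
  have h3 : ∑ i, g f m i p * N f i j p = 1 / 2 * ∑ i, g f m i p * dy j (sprayCoeff f i) p := by
    rw [Finset.mul_sum]
    exact Finset.sum_congr rfl fun i _ => by rw [N_eq]; ring
  have h4 : ∑ i, dy j (g f m i) p * sprayCoeff f i p =
      ∑ i, sprayCoeff f i p * dy i (g f m j) p :=
    Finset.sum_congr rfl fun i _ => by rw [H.dy_g_symm hp]; ring
  have h5 : ∑ k, dx k (g f m j) p * p.2 k = ∑ k, p.2 k * dx k (g f m j) p :=
    Finset.sum_congr rfl fun i _ => mul_comm _ _
  rw [h3, sprayDeriv_eq]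
  linarith

theorem IsLocal.sprayDeriv_g_y (hp : p ∈ slit O) (m : Fin n) :
    ∑ j, sprayDeriv f (g f m j) p * p.2 j = ∑ k, mixed f m k p * p.2 k := by
  simp only [sprayDeriv_eq, sub_mul, Finset.sum_mul, Finset.sum_sub_distrib]
  rw [Finset.sum_comm, Finset.sum_comm (f := fun j i => sprayCoeff f i p * _ * _)]
  have e1 : ∀ k, ∑ j, p.2 k * dx k (g f m j) p * p.2 j = mixed f m k p * p.2 k := fun k => by
    rw [← H.dx_g_y hp, Finset.sum_mul]
    exact Finset.sum_congr rfl fun l _ => by ring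
  have e2 : ∀ i, ∑ j, sprayCoeff f i p * dy i (g f m j) p * p.2 j = 0 := fun i => by
    rw [← mul_zero (sprayCoeff f i p), ← H.dy_g_y hp i m, Finset.mul_sum]
    exact Finset.sum_congr rfl fun l _ => by ring
  simp only [e1, e2, Finset.sum_const_zero, sub_zero]

/-- This is Euler's identity for the 2-homogeneous spray coefficients, obtained here by comparing
the lowered formulas for `N` and for the spray. -/
theorem IsLocal.N_y (hp : p ∈ slit O) (i : Fin n) :
    ∑ j, N f i j p * p.2 j = sprayCoeff f i p := by
  refine H.eq_of_g_sum_eq hp (a := fun i => ∑ j, N f i j p * p.2 j)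
    (b := fun i => sprayCoeff f i p) (fun m => ?_) i
  rw [H.g_sprayCoeff hp]
  have h1 : ∑ i, g f m i p * ∑ j, N f i j p * p.2 j =
      ∑ j, (∑ i, g f m i p * N f i j p) * p.2 j := by
    simp only [Finset.mul_sum, Finset.sum_mul]
    rw [Finset.sum_comm]
    exact Finset.sum_congr rfl fun m _ => Finset.sum_congr rfl fun k _ => by ring
  rw [h1, ← H.mixed_y hp]
  simp only [H.g_N hp]
  have h2 : ∑ j, 1 / 2 * (sprayDeriv f (g f m j) p + mixed f m j p - mixed f j m p) * p.2 j =
      1 / 2 * (∑ j, sprayDeriv f (g f m j) p * p.2 j + ∑ j, mixed f m j p * p.2 j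
        - ∑ j, mixed f j m p * p.2 j) := by
    rw [← Finset.sum_add_distrib, ← Finset.sum_sub_distrib, Finset.mul_sum]
    exact Finset.sum_congr rfl fun m _ => by ring
  rw [h2, H.sprayDeriv_g_y hp]
  ring

/-- Since `N y` is the vector of spray coefficients, the horizontal lift of `y` is the spray itself.
-/
theorem IsLocal.δ_y (hp : p ∈ slit O) (h : Coord n × Coord n → ℝ) :
    ∑ k, δ f k h p * p.2 k = sprayDeriv f h p := by
  simp only [δ, sub_mul, Finset.sum_sub_distrib, Finset.sum_mul, sprayDeriv_eq]
  rw [Finset.sum_comm (f := fun k j => N f j k p * dy j h p * p.2 k)]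
  congr 1
  · exact Finset.sum_congr rfl fun k _ => mul_comm _ _
  · refine Finset.sum_congr rfl fun k _ => ?_
    rw [← H.N_y hp, Finset.sum_mul]
    exact Finset.sum_congr rfl fun k _ => by ring

theorem IsLocal.δ_g_y (hp : p ∈ slit O) (j m : Fin n) :
    ∑ k, δ f j (g f m k) p * p.2 k = mixed f m j p := by
  simp only [δ, sub_mul, Finset.sum_sub_distrib, Finset.sum_mul]
  rw [Finset.sum_comm (f := fun k i => N f i j p * dy i (g f m k) p * p.2 k), H.dx_g_y hp]
  have e2 : ∀ i, ∑ k, N f i j p * dy i (g f m k) p * p.2 k = 0 := fun i => by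
    rw [← mul_zero (N f i j p), ← H.dy_g_y hp i m, Finset.mul_sum]
    exact Finset.sum_congr rfl fun l _ => by ring
  simp only [e2, Finset.sum_const_zero, sub_zero]

theorem IsLocal.L_symm (hp : p ∈ slit O) (i j k : Fin n) : L f i j k p = L f i k j p := by
  rw [L, L]
  congr 1
  refine Finset.sum_congr rfl fun m _ => ?_
  rw [H.δ_congr (fun q hq => H.g_symm hq m k) hp, H.δ_congr (fun q hq => H.g_symm hq j m) hp,
    H.δ_congr (fun q hq => H.g_symm hq j k) hp]
  ring

/-- After lowering the index, the contracted horizontal Christoffel formula consists of one spray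
derivative of `g` and two mixed derivatives, which is exactly `g_N`. This identity removes `L` from
the covariant derivative along a geodesic. -/
theorem IsLocal.L_y (hp : p ∈ slit O) (i j : Fin n) :
    ∑ k, L f i j k p * p.2 k = N f i j p := by
  refine H.eq_of_g_sum_eq hp (a := fun i => ∑ k, L f i j k p * p.2 k)
    (b := fun i => N f i j p) (fun m => ?_) i
  have e : ∀ i, ∑ k, L f i j k p * p.2 k = ∑ m, gInv f i m p * (1 / 2 * ∑ k,
      (δ f j (g f m k) p + δ f k (g f j m) p - δ f m (g f j k) p) * p.2 k) := by
    intro i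
    simp only [L, Finset.mul_sum, Finset.sum_mul]
    rw [Finset.sum_comm]
    exact Finset.sum_congr rfl fun m _ => Finset.sum_congr rfl fun k _ => by ring
  simp only [e]
  rw [H.g_sum_gInv hp, H.g_N hp]
  simp only [sub_mul, add_mul, Finset.sum_sub_distrib, Finset.sum_add_distrib, H.δ_g_y hp,
    H.δ_y hp]
  rw [H.sprayDeriv_congr (fun q hq => H.g_symm hq j m) hp]
  ring

theorem IsLocal.L_y' (hp : p ∈ slit O) (i j : Fin n) :
    ∑ h, L f i h j p * p.2 h = N f i j p := by
  rw [← H.L_y hp]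
  exact Finset.sum_congr rfl fun k _ => by rw [H.L_symm hp]

/-- By total symmetry each of the three terms can be written as a vertical derivative of some
`g_{·h}` contracted with `yʰ`, which vanishes by `dy_g_y`. -/
theorem IsLocal.C_y (hp : p ∈ slit O) (i s : Fin n) : ∑ h, C f i h s p * p.2 h = 0 := by
  simp only [C, Finset.mul_sum, Finset.sum_mul]
  rw [Finset.sum_comm]
  refine Finset.sum_eq_zero fun m _ => ?_
  have e : ∀ h, 1 / 2 * (gInv f i m p * (dy h (g f m s) p + dy s (g f h m) p - dy m (g f h s) p))
      * p.2 h = 1 / 2 * gInv f i m p * (dy s (g f m h) p * p.2 h) +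
        1 / 2 * gInv f i m p * (dy s (g f m h) p * p.2 h) -
        1 / 2 * gInv f i m p * (dy m (g f s h) p * p.2 h) := fun h => by
    rw [H.dy_g_symm hp h m s, H.dy_congr (fun q hq => H.g_symm hq h m) hp,
      H.dy_congr (fun q hq => H.g_symm hq h s) hp]
    ring
  simp only [e, Finset.sum_sub_distrib, Finset.sum_add_distrib, ← Finset.mul_sum, H.dy_g_y hp]
  ring

/-- Differentiate `L^i_{hj} yʰ = N^i_j` horizontally. Since `δyʰ/δxᵏ = -N^h_k`, this creates terms
`L N`, which cancel the contracted quadratic terms `L L`; the `C` term is annihilated by `y`. -/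
theorem IsLocal.R_y (hp : p ∈ slit O) (i j k : Fin n) :
    ∑ h, R f i h j k p * p.2 h = RN f i j k p := by
  have e1 : ∀ j k, ∑ h, δ f k (L f i h j) p * p.2 h =
      δ f k (N f i j) p + ∑ h, L f i h j p * N f h k p := fun j k => by
    rw [← H.δ_congr (fun q hq => H.L_y' hq i j) hp, δ_sum_y (fun h => H.smooth_L i h j) hp]
    ring
  have e2 : ∀ j k, ∑ h, (∑ s, L f s h j p * L f i s k p) * p.2 h =
      ∑ s, L f i s k p * N f s j p := fun j k => by
    simp only [Finset.sum_mul]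
    rw [Finset.sum_comm]
    refine Finset.sum_congr rfl fun s _ => ?_
    rw [← H.L_y' hp, Finset.mul_sum]
    exact Finset.sum_congr rfl fun k _ => by ring
  have e3 : ∑ h, (∑ s, C f i h s p * RN f s j k p) * p.2 h = 0 := by
    simp only [Finset.sum_mul]
    rw [Finset.sum_comm]
    refine Finset.sum_eq_zero fun s _ => ?_
    rw [← mul_zero (RN f s j k p), ← H.C_y hp i s, Finset.mul_sum]
    exact Finset.sum_congr rfl fun k _ => by ring
  simp only [R, add_mul, sub_mul, Finset.sum_sub_distrib, Finset.sum_add_distrib, e1, e2, e3]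
  rw [RN]
  ring

omit H in
/-- The Jacobi endomorphism `R^i_{jk} yʲ` of the nonlinear connection. -/
noncomputable def jacobiCoeff (f : Coord n × Coord n → ℝ) (i k : Fin n) (p : Coord n × Coord n) :
    ℝ := ∑ j, RN f i j k p * p.2 j

theorem IsLocal.R_y_y (hp : p ∈ slit O) (i k : Fin n) :
    ∑ h, ∑ j, R f i h j k p * p.2 h * p.2 j = jacobiCoeff f i k p := by
  rw [Finset.sum_comm]
  refine Finset.sum_congr rfl fun j _ => ?_
  rw [← H.R_y hp, Finset.sum_mul]

/-- Expresses the Jacobi endomorphism through the spray alone. This form is suited both to lowering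
the index and to changing coordinates. -/
theorem IsLocal.jacobiCoeff_eq (hp : p ∈ slit O) (i k : Fin n) :
    jacobiCoeff f i k p = dx k (sprayCoeff f i) p - ∑ j, N f i j p * N f j k p
      - sprayDeriv f (N f i k) p := by
  simp only [jacobiCoeff, RN, sub_mul, Finset.sum_sub_distrib, H.δ_y hp]
  -- The horizontal derivative of `N y = 2G`: one copy of `N N` comes from differentiating `y`, two
  -- copies from the vertical part of `δ(2G)`, leaving one.
  have h1 := H.δ_congr (fun q hq => H.N_y hq i) hp k
  rw [δ_sum_y (fun j => H.smooth_N i j) hp] at h1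
  have h2 : δ f k (sprayCoeff f i) p = dx k (sprayCoeff f i) p -
      2 * ∑ j, N f i j p * N f j k p := by
    rw [δ, Finset.mul_sum]
    congr 1
    exact Finset.sum_congr rfl fun j _ => by rw [N_eq f i]; ring
  linarith

/-- Symmetrising `g_N` cancels the mixed derivatives. This is metric compatibility of `N` along the
spray. -/
theorem IsLocal.sprayDeriv_g (hp : p ∈ slit O) (m j : Fin n) :
    sprayDeriv f (g f m j) p = ∑ i, g f m i p * N f i j p + ∑ i, g f j i p * N f i m p := by
  rw [H.g_N hp, H.g_N hp, H.sprayDeriv_congr (fun q hq => H.g_symm hq j m) hp]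
  ring

/-- The `x`-derivative of `g_sprayCoeff`. The term `∂g_{mi}/∂xᵏ · 2Gⁱ` is the vertical part of the
spray derivative of `mixed f m k`, because `∂/∂yⁱ` of that function is `∂g_{im}/∂xᵏ`. -/
theorem IsLocal.g_dx_sprayCoeff (hp : p ∈ slit O) (m k : Fin n) :
    ∑ l, g f m l p * dx k (sprayCoeff f l) p = sprayDeriv f (mixed f m k) p -
      1 / 2 * dx k (dx m fun q => f q ^ 2) p := by
  have h1 := H.dx_congr (fun q hq => H.g_sprayCoeff hq m) hp k
  rw [dx, fderiv_sum_mul (fun i => H.smooth_g m i) H.smooth_sprayCoeff hp] at h1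
  have h2 : dx k (fun q => ∑ j, mixed f m j q * q.2 j - 1 / 2 * dx m (fun q => f q ^ 2) q) p =
      ∑ j, dx j (mixed f m k) p * p.2 j - 1 / 2 * dx k (dx m fun q => f q ^ 2) p := by
    have hs : SlitSmooth O fun q => ∑ k, mixed f m k q * q.2 k :=
      SlitSmooth.sum fun k => (H.smooth_mixed m k).mul (slitSmooth_y k)
    have hE := (slitSmooth_const (1 / 2 : ℝ)).mul (H.smooth_energy.dx m)
    rw [dx, fderiv_fun_sub (hs.differentiableAt hp) (hE.differentiableAt hp), sub_apply]
    change dx k (fun q => ∑ k, mixed f m k q * q.2 k) p -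
      dx k (fun q => 1 / 2 * dx m (fun q => f q ^ 2) q) p = _
    rw [dx_sum_y (fun k => H.smooth_mixed m k) hp, dx_const_mul (H.smooth_energy.dx m) hp]
    have : ∀ j, dx k (mixed f m j) p = dx j (mixed f m k) p := fun j => by
      have e : ∀ a b, dx a (mixed f m b) p = 1 / 2 * dx a (dx b (dy m fun q => f q ^ 2)) p :=
        fun a b => dx_const_mul ((H.smooth_energy.dy m).dx b) hp _ _
      rw [e, e, (H.smooth_energy.dy m).dx_dx hp]
    simp only [this]
  rw [h2, Finset.sum_add_distrib] at h1
  change ∑ i, dx k (g f m i) p * sprayCoeff f i p + ∑ i, g f m i p * dx k (sprayCoeff f i) p = _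
    at h1
  have h4 : ∑ i, dx k (g f m i) p * sprayCoeff f i p =
      ∑ i, sprayCoeff f i p * dy i (mixed f m k) p :=
    Finset.sum_congr rfl fun i _ => by
      rw [H.dy_mixed hp, H.dx_congr (fun q hq => H.g_symm hq m i) hp]; ring
  have h5 : ∑ j, dx j (mixed f m k) p * p.2 j = ∑ j, p.2 j * dx j (mixed f m k) p :=
    Finset.sum_congr rfl fun i _ => mul_comm _ _
  rw [sprayDeriv_eq]
  linarith

/-- The Jacobi endomorphism is self-adjoint with respect to the fundamental tensor. -/
theorem IsLocal.g_jacobiCoeff_symm (hp : p ∈ slit O) (m k : Fin n) :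
    ∑ l, g f m l p * jacobiCoeff f l k p = ∑ l, g f k l p * jacobiCoeff f l m p := by
  -- In this expression every group of terms is visibly symmetric in `m` and `k`: symmetrised mixed
  -- derivatives, second `x`-derivatives of `F²`, the second spray derivative of `g_{mk}`, and
  -- `g(N_m, N_k)`.
  have key : ∀ m k, ∑ l, g f m l p * jacobiCoeff f l k p =
      1 / 2 * (sprayDeriv f (mixed f m k) p + sprayDeriv f (mixed f k m) p)
      - 1 / 2 * dx k (dx m fun q => f q ^ 2) p - 1 / 2 * sprayDeriv f (sprayDeriv f (g f m k)) p
      + ∑ l, ∑ i, g f l i p * N f i m p * N f l k p := by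
    intro m k
    have h1 : sprayDeriv f (fun q => ∑ l, g f m l q * N f l k q) p =
        1 / 2 * (sprayDeriv f (sprayDeriv f (g f m k)) p + sprayDeriv f (mixed f m k) p
          - sprayDeriv f (mixed f k m) p) := by
      rw [H.sprayDeriv_congr (fun q hq => H.g_N hq m k) hp]
      have a := (H.smooth_sprayDeriv (H.smooth_g m k)).differentiableAt hp
      have b := (H.smooth_mixed m k).differentiableAt hp
      have c := (H.smooth_mixed k m).differentiableAt hp
      rw [sprayDeriv, fderiv_const_mul ((a.fun_add b).fun_sub c), fderiv_fun_sub (a.fun_add b) c,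
        fderiv_fun_add a b]
      rfl
    rw [sprayDeriv, fderiv_sum_mul (fun l => H.smooth_g m l) (fun l => H.smooth_N l k) hp,
      Finset.sum_add_distrib] at h1
    change ∑ l, sprayDeriv f (g f m l) p * N f l k p + ∑ l, g f m l p * sprayDeriv f (N f l k) p
      = _ at h1
    have h2 : ∑ l, sprayDeriv f (g f m l) p * N f l k p =
        ∑ l, g f m l p * ∑ j, N f l j p * N f j k p +
        ∑ l, ∑ i, g f l i p * N f i m p * N f l k p := by
      simp only [H.sprayDeriv_g hp, add_mul, Finset.sum_add_distrib, Finset.sum_mul,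
        Finset.mul_sum]
      congr 1
      rw [Finset.sum_comm]
      exact Finset.sum_congr rfl fun m _ => Finset.sum_congr rfl fun k _ => by ring
    have h3 : ∑ l, g f m l p * jacobiCoeff f l k p = ∑ l, g f m l p * dx k (sprayCoeff f l) p
        - ∑ l, g f m l p * ∑ j, N f l j p * N f j k p
        - ∑ l, g f m l p * sprayDeriv f (N f l k) p := by
      simp only [H.jacobiCoeff_eq hp, mul_sub, Finset.sum_sub_distrib]
    rw [h3, H.g_dx_sprayCoeff hp]
    linarith
  rw [key m k, key k m, H.smooth_energy.dx_dx hp k m]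
  have h1 : sprayDeriv f (sprayDeriv f (g f m k)) p = sprayDeriv f (sprayDeriv f (g f k m)) p :=
    H.sprayDeriv_congr (fun q hq => H.sprayDeriv_congr (fun q hq => H.g_symm hq m k) hq) hp
  have h2 : ∑ l, ∑ i, g f l i p * N f i m p * N f l k p =
      ∑ l, ∑ i, g f l i p * N f i k p * N f l m p := by
    rw [Finset.sum_comm]
    exact Finset.sum_congr rfl fun m _ => Finset.sum_congr rfl fun k _ => by
      rw [H.g_symm hp]; ring
  rw [h1, h2]
  ring

end CartanIdentities

end Finsler

namespace Finsler

/-! ### Coordinate-free form of the local objects -/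

section Operators

variable {n : ℕ} {f h : Coord n × Coord n → ℝ} {O : Set (Coord n)} {p : Coord n × Coord n}

/-- The vector with components `2 Gⁱ`. -/
noncomputable def spray (f : Coord n × Coord n → ℝ) (p : Coord n × Coord n) : Coord n :=
  WithLp.toLp 2 fun i => sprayCoeff f i p

/-- The geodesic spray. -/
noncomputable def sprayField (f : Coord n × Coord n → ℝ) (p : Coord n × Coord n) :
    Coord n × Coord n := (p.2, -spray f p)

/-- The nonlinear connection as a linear map, `w ↦ N^i_j wʲ`. -/
noncomputable def conn (f : Coord n × Coord n → ℝ) (p : Coord n × Coord n) :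
    Coord n →L[ℝ] Coord n :=
  (1 / 2 : ℝ) • (fderiv ℝ (spray f) p).comp (ContinuousLinearMap.inr ℝ (Coord n) (Coord n))

/-- The Jacobi endomorphism as a map. -/
noncomputable def jac (f : Coord n × Coord n → ℝ) (p : Coord n × Coord n) (u : Coord n) :
    Coord n := WithLp.toLp 2 fun i => ∑ k, jacobiCoeff f i k p * u k

/-- The fundamental tensor as a bilinear form. -/
noncomputable def gForm (f : Coord n × Coord n → ℝ) (p : Coord n × Coord n) (u v : Coord n) : ℝ :=
  ∑ i, ∑ j, g f i j p * u i * v j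

theorem fderiv_apply_coord {E : Type*} [NormedAddCommGroup E] [NormedSpace ℝ E]
    {X : E → Coord n} {p : E} (hX : DifferentiableAt ℝ X p) (z : E) (i : Fin n) :
    (fderiv ℝ X p z) i = fderiv ℝ (fun q => X q i) p z := by
  have h1 := (EuclideanSpace.proj i : Coord n →L[ℝ] ℝ).hasFDerivAt.comp p hX.hasFDerivAt
  have h2 : ((EuclideanSpace.proj i : Coord n →L[ℝ] ℝ) ∘ X) = fun q => X q i := rfl
  rw [h2] at h1
  rw [h1.fderiv]
  rfl

variable (H : IsLocal f O)
include H

theorem IsLocal.contDiffAt_spray (hp : p ∈ slit O) : ContDiffAt ℝ ∞ (spray f) p :=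
  contDiffAt_euclidean.mpr fun i => H.smooth_sprayCoeff i p hp

theorem IsLocal.contDiffAt_sprayField (hp : p ∈ slit O) : ContDiffAt ℝ ∞ (sprayField f) p :=
  contDiffAt_snd.prodMk (H.contDiffAt_spray hp).neg

theorem IsLocal.contDiffAt_conn (hp : p ∈ slit O) : ContDiffAt ℝ ∞ (conn f) p :=
  (((H.contDiffAt_spray hp).fderiv_right (m := ∞) (by simp)).clm_comp
    contDiffAt_const).const_smul _

theorem IsLocal.differentiableAt_spray (hp : p ∈ slit O) : DifferentiableAt ℝ (spray f) p :=
  (H.contDiffAt_spray hp).differentiableAt (by simp)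

theorem IsLocal.differentiableAt_conn (hp : p ∈ slit O) : DifferentiableAt ℝ (conn f) p :=
  (H.contDiffAt_conn hp).differentiableAt (by simp)

theorem IsLocal.fderiv_spray_apply (hp : p ∈ slit O) (z : Coord n × Coord n) (i : Fin n) :
    (fderiv ℝ (spray f) p z) i = fderiv ℝ (sprayCoeff f i) p z :=
  fderiv_apply_coord (H.differentiableAt_spray hp) z i

omit H in
theorem fderiv_spray_inr (w : Coord n) : fderiv ℝ (spray f) p (0, w) = (2 : ℝ) • conn f p w := by
  simp [conn, smul_smul]

theorem IsLocal.conn_apply (hp : p ∈ slit O) (w : Coord n) (i : Fin n) :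
    (conn f p w) i = ∑ j, N f i j p * w j := by
  have : (conn f p w) i = 1 / 2 * (fderiv ℝ (spray f) p (0, w)) i := by simp [conn]
  rw [this, H.fderiv_spray_apply hp, fderiv_eq_sum]
  simp only [PiLp.zero_apply, zero_mul, Finset.sum_const_zero, zero_add, Finset.mul_sum]
  exact Finset.sum_congr rfl fun j _ => by rw [N_eq]; ring

theorem IsLocal.fderiv_conn_apply (hp : p ∈ slit O) (z : Coord n × Coord n) (u : Coord n)
    (i : Fin n) : (fderiv ℝ (conn f) p z u) i = ∑ j, fderiv ℝ (N f i j) p z * u j := by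
  have h1 : fderiv ℝ (fun q => conn f q u) p z = fderiv ℝ (conn f) p z u := by
    rw [fderiv_clm_apply (H.differentiableAt_conn hp) (differentiableAt_const _)]
    simp
  rw [← h1, fderiv_apply_coord ((H.differentiableAt_conn hp).clm_apply
    (differentiableAt_const _)), H.fderiv_congr (fun q hq => H.conn_apply hq u i) hp,
    fderiv_sum_mul (fun j => H.smooth_N i j) (fun j => slitSmooth_const (u j)) hp]
  simp

theorem IsLocal.jac_eq (hp : p ∈ slit O) (u : Coord n) :
    jac f p u = fderiv ℝ (spray f) p (u, 0) - conn f p (conn f p u)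
      - fderiv ℝ (conn f) p (sprayField f p) u := by
  ext i
  simp only [jac, PiLp.sub_apply, H.fderiv_spray_apply hp, H.fderiv_conn_apply hp,
    H.conn_apply hp, H.jacobiCoeff_eq hp, sub_mul, Finset.sum_sub_distrib, fderiv_eq_sum]
  simp only [PiLp.zero_apply, zero_mul, Finset.sum_const_zero, add_zero]
  have e1 : ∑ k, dx k (sprayCoeff f i) p * u k = ∑ k, u k * dx k (sprayCoeff f i) p :=
    Finset.sum_congr rfl fun k _ => mul_comm _ _
  have e2 : ∑ k, (∑ j, N f i j p * N f j k p) * u k = ∑ j, N f i j p * ∑ k, N f j k p * u k := by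
    simp only [Finset.sum_mul, Finset.mul_sum]
    rw [Finset.sum_comm]
    exact Finset.sum_congr rfl fun j _ => Finset.sum_congr rfl fun k _ => by ring
  rw [e1, e2]
  rfl

theorem IsLocal.contDiffAt_jac (hp : p ∈ slit O) {z : Coord n × Coord n → Coord n}
    (hz : ContDiffAt ℝ ∞ z p) : ContDiffAt ℝ ∞ (fun q => jac f q (z q)) p := by
  refine contDiffAt_euclidean.mpr fun i => ?_
  simp only [jac]
  refine ContDiffAt.sum fun k _ => ContDiffAt.mul ?_ ?_
  · have : ∀ j, SlitSmooth O (RN f i j k) := fun j =>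
      (H.smooth_δ (H.smooth_N i j) k).sub (H.smooth_δ (H.smooth_N i k) j)
    exact SlitSmooth.sum (fun j => (this j).mul (slitSmooth_y j)) p hp
  · exact contDiffAt_euclidean.mp hz k

omit H in
theorem SlitSmooth.fderiv_fderiv (hh : SlitSmooth O h) (hp : p ∈ slit O)
    (z w : Coord n × Coord n) :
    fderiv ℝ (fun q => fderiv ℝ h q w) p z = fderiv ℝ (fderiv ℝ h) p z w := by
  have hd : DifferentiableAt ℝ (fderiv ℝ h) p :=
    ((hh p hp).fderiv_right (m := ∞) (by simp)).differentiableAt (by simp)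
  rw [fderiv_clm_apply hd (differentiableAt_const _)]
  simp

omit H in
/-- The fundamental tensor is half of the vertical Hessian of the energy. -/
theorem SlitSmooth.gForm_eq (hh : SlitSmooth O fun q => f q ^ 2) (hp : p ∈ slit O)
    (u v : Coord n) :
    gForm f p u v = 1 / 2 * fderiv ℝ (fderiv ℝ fun q => f q ^ 2) p (0, u) (0, v) := by
  rw [← hh.fderiv_fderiv hp, fderiv_eq_sum]
  simp only [PiLp.zero_apply, zero_mul, Finset.sum_const_zero, zero_add, Finset.mul_sum, gForm]
  refine Finset.sum_congr rfl fun i _ => ?_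
  have : Finsler.dy i (fun q => fderiv ℝ (fun q => f q ^ 2) q (0, v)) p =
      ∑ j, Finsler.dy i (Finsler.dy j fun q => f q ^ 2) p * v j := by
    have e : (fun q => fderiv ℝ (fun q => f q ^ 2) q (0, v)) =
        fun q => ∑ j, Finsler.dy j (fun q => f q ^ 2) q * v j := by
      funext q
      rw [fderiv_eq_sum]
      simp [mul_comm]
    rw [e, Finsler.dy, fderiv_sum_mul (fun j => hh.dy j) (fun j => slitSmooth_const (v j)) hp]
    simp [Finsler.dy]
  rw [this, Finset.mul_sum, Finset.mul_sum]
  exact Finset.sum_congr rfl fun j _ => by rw [g]; ring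

theorem IsLocal.eq_zero_of_gForm (hp : p ∈ slit O) {u : Coord n}
    (hu : ∀ v, gForm f p u v = 0) : u = 0 := by
  by_contra h0
  exact (H.posDef p hp u h0).ne' (hu u)

theorem IsLocal.gForm_symm (hp : p ∈ slit O) (u v : Coord n) : gForm f p u v = gForm f p v u := by
  rw [gForm, gForm, Finset.sum_comm]
  exact Finset.sum_congr rfl fun i _ => Finset.sum_congr rfl fun j _ => by
    rw [H.g_symm hp]; ring

theorem IsLocal.gForm_jac (hp : p ∈ slit O) (u v : Coord n) :
    gForm f p (jac f p u) v = gForm f p u (jac f p v) := by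
  have key : ∀ u v, gForm f p u (jac f p v) =
      ∑ i, ∑ k, u i * v k * ∑ l, g f i l p * jacobiCoeff f l k p := by
    intro u v
    simp only [gForm, jac, Finset.mul_sum]
    refine Finset.sum_congr rfl fun i _ => ?_
    rw [Finset.sum_comm]
    exact Finset.sum_congr rfl fun k _ => Finset.sum_congr rfl fun l _ => by ring
  rw [H.gForm_symm hp, key, key, Finset.sum_comm]
  exact Finset.sum_congr rfl fun i _ => Finset.sum_congr rfl fun j _ => by
    rw [H.g_jacobiCoeff_symm hp]; ring

/-- The Euler-Lagrange equation satisfied by the geodesic spray. -/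
theorem IsLocal.fderiv_fderiv_sprayField (hp : p ∈ slit O) (v : Coord n) :
    fderiv ℝ (fderiv ℝ fun q => f q ^ 2) p (sprayField f p) (0, v) =
      fderiv ℝ (fun q => f q ^ 2) p (v, 0) := by
  have e1 : sprayField f p = (p.2, 0) - (0, spray f p) := by simp [sprayField]
  have e2 : fderiv ℝ (fderiv ℝ fun q => f q ^ 2) p (0, spray f p) (0, v) =
      2 * ∑ k, v k * (∑ j, mixed f k j p * p.2 j - 1 / 2 * dx k (fun q => f q ^ 2) p) := by
    have := H.smooth_energy.gForm_eq hp (spray f p) v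
    rw [show fderiv ℝ (fderiv ℝ fun q => f q ^ 2) p (0, spray f p) (0, v) =
      2 * gForm f p (spray f p) v by rw [this]; ring, H.gForm_symm hp]
    congr 1
    refine Finset.sum_congr rfl fun k _ => ?_
    rw [← H.g_sprayCoeff hp, Finset.mul_sum]
    exact Finset.sum_congr rfl fun j _ => by simp only [spray]; ring
  have e3 : fderiv ℝ (fderiv ℝ fun q => f q ^ 2) p (p.2, 0) (0, v) =
      2 * ∑ k, v k * ∑ j, mixed f k j p * p.2 j := by
    rw [← H.smooth_energy.fderiv_fderiv hp, fderiv_eq_sum]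
    have e : (fun q => fderiv ℝ (fun q => f q ^ 2) q (0, v)) =
        fun q => ∑ j, dy j (fun q => f q ^ 2) q * v j := by
      funext q
      rw [fderiv_eq_sum]
      simp [mul_comm]
    have : ∀ i, dx i (fun q => fderiv ℝ (fun q => f q ^ 2) q (0, v)) p =
        ∑ j, 2 * mixed f j i p * v j := by
      intro i
      rw [e, dx, fderiv_sum_mul (fun j => H.smooth_energy.dy j)
        (fun j => slitSmooth_const (v j)) hp]
      refine Finset.sum_congr rfl fun j _ => ?_
      simp only [mixed, dx, fderiv_fun_const]
      simp
    simp only [this, PiLp.zero_apply, zero_mul, Finset.sum_const_zero, add_zero, Finset.mul_sum]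
    rw [Finset.sum_comm]
    exact Finset.sum_congr rfl fun i _ => Finset.sum_congr rfl fun j _ => by ring
  rw [e1, map_sub, sub_apply, e2, e3, fderiv_eq_sum, Finset.mul_sum, Finset.mul_sum,
    ← Finset.sum_sub_distrib]
  simp only [PiLp.zero_apply, zero_mul, Finset.sum_const_zero, add_zero]
  exact Finset.sum_congr rfl fun i _ => by ring

/-- The vertical Hessian of `F²` is nondegenerate, so the Euler-Lagrange equation determines the
acceleration. This is how the spray is recognised in another chart without transforming Christoffel
symbols. -/
theorem IsLocal.eq_sprayField (hp : p ∈ slit O) {w : Coord n}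
    (hw : ∀ v, fderiv ℝ (fderiv ℝ fun q => f q ^ 2) p (p.2, w) (0, v) =
      fderiv ℝ (fun q => f q ^ 2) p (v, 0)) : (p.2, w) = sprayField f p := by
  have h0 : w + spray f p = 0 := by
    refine H.eq_zero_of_gForm hp fun v => ?_
    rw [H.smooth_energy.gForm_eq hp]
    have e : ((0, w + spray f p) : Coord n × Coord n) = (p.2, w) - sprayField f p := by
      simp [sprayField]
    rw [e, map_sub, sub_apply, hw, H.fderiv_fderiv_sprayField hp]
    simp
  rw [sprayField, eq_neg_of_add_eq_zero_left h0]

end Operators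

/-! ### Change of coordinates -/

section Transition

variable {n : ℕ} {f f' h : Coord n × Coord n → ℝ} {O O' : Set (Coord n)}
  {p : Coord n × Coord n} {φ : Coord n → Coord n}

/-- `φ` is an immersive smooth map between coordinate domains. -/
structure IsTransition (φ : Coord n → Coord n) (O' O : Set (Coord n)) : Prop where
  isOpen : IsOpen O'
  smooth : ∀ x ∈ O', ContDiffAt ℝ ∞ φ x
  mapsTo : MapsTo φ O' O
  injective : ∀ x ∈ O', ∀ y : Coord n, y ≠ 0 → fderiv ℝ φ x y ≠ 0

/-- The tangent map of `φ`. -/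
noncomputable def tangentLift (φ : Coord n → Coord n) (p : Coord n × Coord n) :
    Coord n × Coord n := (φ p.1, fderiv ℝ φ p.1 p.2)

variable (T : IsTransition φ O' O)
include T

theorem IsTransition.contDiffAt_fderiv {x : Coord n} (hx : x ∈ O') :
    ContDiffAt ℝ ∞ (fderiv ℝ φ) x := (T.smooth x hx).fderiv_right (m := ∞) (by simp)

theorem IsTransition.contDiffAt_tangentLift (hp : p.1 ∈ O') :
    ContDiffAt ℝ ∞ (tangentLift φ) p :=
  ((T.smooth _ hp).comp p contDiffAt_fst).prodMk
    (((T.contDiffAt_fderiv hp).comp p contDiffAt_fst).clm_apply contDiffAt_snd)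

theorem IsTransition.tangentLift_mem (hp : p ∈ slit O') : tangentLift φ p ∈ slit O :=
  ⟨T.mapsTo hp.1, T.injective _ hp.1 _ hp.2⟩

theorem IsTransition.slit_mem_nhds (hp : p ∈ slit O') : slit O' ∈ nhds p :=
  (isOpen_slit T.isOpen).mem_nhds hp

theorem IsTransition.surjective {x : Coord n} (hx : x ∈ O') :
    Function.Surjective (fderiv ℝ φ x) := by
  have : Function.Injective (fderiv ℝ φ x : Coord n →ₗ[ℝ] Coord n) := by
    rw [injective_iff_map_eq_zero]
    intro y hy
    by_contra h0
    exact T.injective x hx y h0 hy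
  exact LinearMap.injective_iff_surjective.mp this

theorem IsTransition.hess_symm {x : Coord n} (hx : x ∈ O') (u v : Coord n) :
    fderiv ℝ (fderiv ℝ φ) x u v = fderiv ℝ (fderiv ℝ φ) x v u :=
  (T.smooth x hx).isSymmSndFDerivAt (by
    rw [minSmoothness_of_isRCLikeNormedField]; exact WithTop.coe_le_coe.2 le_top) u v

theorem IsTransition.fderiv_comp_fst_apply (hp : p.1 ∈ O') (u : Coord n)
    (z : Coord n × Coord n) :
    fderiv ℝ (fun q : Coord n × Coord n => fderiv ℝ φ q.1 u) p z =
      fderiv ℝ (fderiv ℝ φ) p.1 z.1 u := by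
  have hd := (T.contDiffAt_fderiv hp).differentiableAt (by simp)
  have h1 : HasFDerivAt (fun q : Coord n × Coord n => fderiv ℝ φ q.1)
      ((fderiv ℝ (fderiv ℝ φ) p.1).comp (ContinuousLinearMap.fst ℝ (Coord n) (Coord n))) p :=
    hd.hasFDerivAt.comp p hasFDerivAt_fst
  rw [(h1.clm_apply (hasFDerivAt_const u p)).fderiv]
  simp

theorem IsTransition.fderiv_tangentLift (hp : p.1 ∈ O') (z : Coord n × Coord n) :
    fderiv ℝ (tangentLift φ) p z =
      (fderiv ℝ φ p.1 z.1, fderiv ℝ (fderiv ℝ φ) p.1 z.1 p.2 + fderiv ℝ φ p.1 z.2) := by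
  have hd := (T.contDiffAt_fderiv hp).differentiableAt (by simp)
  have hd0 := (T.smooth _ hp).differentiableAt (by simp)
  have h1 : HasFDerivAt (fun q : Coord n × Coord n => fderiv ℝ φ q.1)
      ((fderiv ℝ (fderiv ℝ φ) p.1).comp (ContinuousLinearMap.fst ℝ (Coord n) (Coord n))) p :=
    hd.hasFDerivAt.comp p hasFDerivAt_fst
  have h2 : HasFDerivAt (fun q : Coord n × Coord n => φ q.1)
      ((fderiv ℝ φ p.1).comp (ContinuousLinearMap.fst ℝ (Coord n) (Coord n))) p :=
    hd0.hasFDerivAt.comp p hasFDerivAt_fst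
  have h3 : HasFDerivAt (tangentLift φ) _ p := h2.prodMk (h1.clm_apply hasFDerivAt_snd)
  rw [h3.fderiv]
  simp [add_comm]

/-- The second derivative of a pulled back function, once in a vertical direction. -/
theorem IsTransition.fderiv_fderiv_comp (hh : SlitSmooth O h) (hp : p ∈ slit O')
    (z : Coord n × Coord n) (v : Coord n) :
    fderiv ℝ (fderiv ℝ (h ∘ tangentLift φ)) p z (0, v) =
      fderiv ℝ (fderiv ℝ h) (tangentLift φ p) (fderiv ℝ (tangentLift φ) p z)
        (0, fderiv ℝ φ p.1 v)
      + fderiv ℝ h (tangentLift φ p) (0, fderiv ℝ (fderiv ℝ φ) p.1 z.1 v) := by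
  have hs : SlitSmooth O' (h ∘ tangentLift φ) := fun q hq =>
    (hh _ (T.tangentLift_mem hq)).comp q (T.contDiffAt_tangentLift hq.1)
  rw [← hs.fderiv_fderiv hp]
  have e : (fun q => fderiv ℝ (h ∘ tangentLift φ) q (0, v)) =ᶠ[nhds p]
      fun q => fderiv ℝ h (tangentLift φ q) (0, fderiv ℝ φ q.1 v) := by
    filter_upwards [T.slit_mem_nhds hp] with q hq
    rw [fderiv_comp q (hh.differentiableAt (T.tangentLift_mem hq))
      ((T.contDiffAt_tangentLift hq.1).differentiableAt (by simp)),
      ContinuousLinearMap.comp_apply, T.fderiv_tangentLift hq.1]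
    simp
  rw [e.fderiv_eq]
  have hd : DifferentiableAt ℝ (fderiv ℝ h) (tangentLift φ p) :=
    ((hh _ (T.tangentLift_mem hp)).fderiv_right (m := ∞) (by simp)).differentiableAt (by simp)
  have hl : DifferentiableAt ℝ (tangentLift φ) p :=
    (T.contDiffAt_tangentLift hp.1).differentiableAt (by simp)
  have h1 := hd.hasFDerivAt.comp p hl.hasFDerivAt
  have hd2 : DifferentiableAt ℝ (fun q : Coord n × Coord n => fderiv ℝ φ q.1 v) p :=
    (((T.contDiffAt_fderiv hp.1).comp p contDiffAt_fst).clm_apply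
      contDiffAt_const).differentiableAt (by simp)
  have h2 : HasFDerivAt (fun q : Coord n × Coord n => ((0 : Coord n), fderiv ℝ φ q.1 v)) _ p :=
    (hasFDerivAt_const _ _).prodMk hd2.hasFDerivAt
  have h3 := h1.clm_apply h2
  simp only [Function.comp_def] at h3
  rw [h3.fderiv]
  simp [T.fderiv_comp_fst_apply hp.1, add_comm]

/-- The fundamental tensor is a tensor. -/
theorem IsTransition.gForm_tangentLift (hh : SlitSmooth O fun q => f q ^ 2)
    (hf : ∀ q ∈ slit O', f' q = f (tangentLift φ q)) (hp : p ∈ slit O') (u v : Coord n) :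
    gForm f' p u v = gForm f (tangentLift φ p) (fderiv ℝ φ p.1 u) (fderiv ℝ φ p.1 v) := by
  have hs : SlitSmooth O' ((fun q => f q ^ 2) ∘ tangentLift φ) := fun q hq =>
    (hh _ (T.tangentLift_mem hq)).comp q (T.contDiffAt_tangentLift hq.1)
  have he : ∀ q ∈ slit O', (fun q => f' q ^ 2) q = ((fun q => f q ^ 2) ∘ tangentLift φ) q :=
    fun q hq => by simp [hf q hq]
  have he' : ∀ q ∈ slit O', (fun q => f' q ^ 2) =ᶠ[nhds q] ((fun q => f q ^ 2) ∘ tangentLift φ) :=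
    fun q hq => Filter.eventually_of_mem (T.slit_mem_nhds hq) he
  have hs' : SlitSmooth O' fun q => f' q ^ 2 := fun q hq =>
    (hs q hq).congr_of_eventuallyEq (he' q hq)
  rw [hs'.gForm_eq hp, hh.gForm_eq (T.tangentLift_mem hp), (he' p hp).fderiv.fderiv_eq,
    T.fderiv_fderiv_comp hh hp, T.fderiv_tangentLift hp.1]
  simp only [map_zero, zero_apply, zero_add, Prod.mk_zero_zero, add_zero]

variable (H : IsLocal f O) (H' : IsLocal f' O') (hf : ∀ q ∈ slit O', f' q = f (tangentLift φ q))
include H H' hf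

/-- The geodesic sprays of related metrics are related. -/
theorem IsTransition.fderiv_tangentLift_sprayField (hp : p ∈ slit O') :
    fderiv ℝ (tangentLift φ) p (sprayField f' p) = sprayField f (tangentLift φ p) := by
  have he : (fun q => f' q ^ 2) =ᶠ[nhds p] ((fun q => f q ^ 2) ∘ tangentLift φ) :=
    Filter.eventually_of_mem (T.slit_mem_nhds hp) fun q hq => by simp [hf q hq]
  have h1 : fderiv ℝ (tangentLift φ) p (sprayField f' p) = ((tangentLift φ p).2,
      fderiv ℝ (fderiv ℝ φ) p.1 p.2 p.2 - fderiv ℝ φ p.1 (spray f' p)) := by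
    rw [T.fderiv_tangentLift hp.1]
    simp [sprayField, tangentLift, sub_eq_add_neg]
  rw [h1]
  refine H.eq_sprayField (T.tangentLift_mem hp) fun v' => ?_
  obtain ⟨v, rfl⟩ := T.surjective hp.1 v'
  rw [← h1]
  have h2 := H'.fderiv_fderiv_sprayField hp v
  rw [he.fderiv.fderiv_eq, T.fderiv_fderiv_comp H.smooth_energy hp, he.fderiv_eq,
    fderiv_comp p (H.smooth_energy.differentiableAt (T.tangentLift_mem hp))
      ((T.contDiffAt_tangentLift hp.1).differentiableAt (by simp)),
    ContinuousLinearMap.comp_apply, T.fderiv_tangentLift hp.1 (v, 0)] at h2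
  -- The vertical correction `D²φ(v, y)` appears identically on both sides of the transformed
  -- Euler-Lagrange equation and cancels.
  have h3 : ((fderiv ℝ φ p.1 v, fderiv ℝ (fderiv ℝ φ) p.1 v p.2 + fderiv ℝ φ p.1 0) :
      Coord n × Coord n) = (fderiv ℝ φ p.1 v, 0) +
        (0, fderiv ℝ (fderiv ℝ φ) p.1 (sprayField f' p).1 v) := by
    rw [T.hess_symm hp.1 v]
    simp [sprayField]
  rw [h3, map_add] at h2
  exact add_right_cancel h2

theorem IsTransition.spray_tangentLift (hp : p ∈ slit O') :
    spray f (tangentLift φ p) =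
      fderiv ℝ φ p.1 (spray f' p) - fderiv ℝ (fderiv ℝ φ) p.1 p.2 p.2 := by
  have h1 := congrArg Prod.snd (T.fderiv_tangentLift_sprayField H H' hf hp)
  rw [T.fderiv_tangentLift hp.1] at h1
  simp only [sprayField, map_neg] at h1
  rw [← neg_neg (spray f (tangentLift φ p)), ← h1]
  abel

/-- The transformation law of the nonlinear connection. -/
theorem IsTransition.fderiv_conn (hp : p ∈ slit O') (w : Coord n) :
    fderiv ℝ φ p.1 (conn f' p w) =
      conn f (tangentLift φ p) (fderiv ℝ φ p.1 w) + fderiv ℝ (fderiv ℝ φ) p.1 p.2 w := by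
  have e : (fun q => spray f (tangentLift φ q)) =ᶠ[nhds p] fun q =>
      fderiv ℝ φ q.1 (spray f' q) - fderiv ℝ (fderiv ℝ φ) q.1 q.2 q.2 :=
    Filter.eventually_of_mem (T.slit_mem_nhds hp) fun q hq => T.spray_tangentLift H H' hf hq
  -- Evaluation on the vertical vector `(0, w)` gives twice the connection from each spray, and
  -- twice `D²φ(y, w)` from the quadratic term; the common factor 2 is then removed.
  have h1 := congrArg (fun A : Coord n × Coord n →L[ℝ] Coord n => A (0, w)) e.fderiv_eq
  have hl : DifferentiableAt ℝ (tangentLift φ) p :=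
    (T.contDiffAt_tangentLift hp.1).differentiableAt (by simp)
  have hfst : HasFDerivAt (Prod.fst : Coord n × Coord n → Coord n)
    (ContinuousLinearMap.fst ℝ (Coord n) (Coord n)) p := hasFDerivAt_fst
  have hsnd : HasFDerivAt (Prod.snd : Coord n × Coord n → Coord n)
    (ContinuousLinearMap.snd ℝ (Coord n) (Coord n)) p := hasFDerivAt_snd
  have ha := ((T.contDiffAt_fderiv hp.1).differentiableAt (by simp)).hasFDerivAt.comp p hfst
  have hb := (((T.contDiffAt_fderiv hp.1).fderiv_right (m := ∞) (by simp)).differentiableAt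
    (by simp)).hasFDerivAt.comp p hfst
  have hc := (ha.clm_apply (H'.differentiableAt_spray hp).hasFDerivAt).fun_sub
    ((hb.clm_apply hsnd).clm_apply hsnd)
  simp only [Function.comp_def] at hc
  have hd := (H.differentiableAt_spray (T.tangentLift_mem hp)).hasFDerivAt.comp p hl.hasFDerivAt
  simp only [Function.comp_def] at hd
  simp only [hd.fderiv, hc.fderiv] at h1
  simp only [ContinuousLinearMap.comp_apply, T.fderiv_tangentLift hp.1, sub_apply, add_apply,
    ContinuousLinearMap.flip_apply, fderiv_spray_inr, ContinuousLinearMap.coe_fst',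
    ContinuousLinearMap.coe_snd', map_zero, zero_apply, add_zero, zero_add, map_smul] at h1
  rw [T.hess_symm hp.1 w, ← two_smul ℝ (fderiv ℝ (fderiv ℝ φ) p.1 p.2 w), ← smul_sub] at h1
  have h2 := smul_right_injective (Coord n) (two_ne_zero (α := ℝ)) h1
  rw [h2]
  abel

end Transition

end Finsler

namespace Finsler

/-! ### Tensoriality of the Jacobi endomorphism -/

section JacobiTransformation

variable {n : ℕ} {f f' : Coord n × Coord n → ℝ} {O O' : Set (Coord n)}
  {p : Coord n × Coord n} {φ : Coord n → Coord n}

theorem fderiv_spray_eq_add (p : Coord n × Coord n) (a b : Coord n) :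
    fderiv ℝ (spray f) p (a, b) = fderiv ℝ (spray f) p (a, 0) + (2 : ℝ) • conn f p b := by
  rw [← fderiv_spray_inr, ← map_add]
  simp

theorem IsLocal.fderiv_sprayField (H : IsLocal f O) (hp : p ∈ slit O) (z : Coord n × Coord n) :
    fderiv ℝ (sprayField f) p z = (z.2, -fderiv ℝ (spray f) p z) := by
  have h : HasFDerivAt (sprayField f) _ p :=
    hasFDerivAt_snd.prodMk (H.differentiableAt_spray hp).hasFDerivAt.neg
  rw [h.fderiv]
  simp

/-- The Jacobi endomorphism is a tensor. -/
theorem IsTransition.fderiv_jac (T : IsTransition φ O' O) (H : IsLocal f O) (H' : IsLocal f' O')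
    (hf : ∀ q ∈ slit O', f' q = f (tangentLift φ q)) (hp : p ∈ slit O') (u : Coord n) :
    fderiv ℝ φ p.1 (jac f' p u) = jac f (tangentLift φ p) (fderiv ℝ φ p.1 u) := by
  have hlc : ContDiffAt ℝ ∞ (tangentLift φ) p := T.contDiffAt_tangentLift hp.1
  have hl : DifferentiableAt ℝ (tangentLift φ) p := hlc.differentiableAt (by simp)
  have hl2 : DifferentiableAt ℝ (fderiv ℝ (tangentLift φ)) p :=
    (hlc.fderiv_right (m := ∞) (by simp)).differentiableAt (by simp)
  have hsf' : DifferentiableAt ℝ (sprayField f') p :=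
    (H'.contDiffAt_sprayField hp).differentiableAt (by simp)
  have hsf : DifferentiableAt ℝ (sprayField f) (tangentLift φ p) :=
    (H.contDiffAt_sprayField (T.tangentLift_mem hp)).differentiableAt (by simp)
  -- the derivative of `DΦ S' = S ∘ Φ` in the direction of the horizontal lift of `u`
  have e1 : (fun q => fderiv ℝ (tangentLift φ) q (sprayField f' q)) =ᶠ[nhds p]
      fun q => sprayField f (tangentLift φ q) :=
    Filter.eventually_of_mem (T.slit_mem_nhds hp) fun q hq =>
      T.fderiv_tangentLift_sprayField H H' hf hq
  have h1 := congrArg (fun A : Coord n × Coord n →L[ℝ] Coord n × Coord n =>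
    (A (u, -conn f' p u)).2) e1.fderiv_eq
  have hc1 := hsf.hasFDerivAt.comp p hl.hasFDerivAt
  simp only [Function.comp_def] at hc1
  simp only [(hl2.hasFDerivAt.clm_apply hsf'.hasFDerivAt).fderiv, hc1.fderiv, add_apply,
    ContinuousLinearMap.comp_apply, ContinuousLinearMap.flip_apply, H'.fderiv_sprayField hp,
    H.fderiv_sprayField (T.tangentLift_mem hp), T.fderiv_tangentLift hp.1, Prod.snd_add] at h1
  -- the derivative of the relation between the horizontal lifts in the direction of the spray
  have e2 : (fun q => fderiv ℝ (tangentLift φ) q (u, -conn f' q u)) =ᶠ[nhds p]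
      fun q => (fderiv ℝ φ q.1 u, -conn f (tangentLift φ q) (fderiv ℝ φ q.1 u)) :=
    Filter.eventually_of_mem (T.slit_mem_nhds hp) fun q hq => by
      simp only [T.fderiv_tangentLift hq.1, map_neg, T.fderiv_conn H H' hf hq, T.hess_symm hq.1 u]
      simp
  have h2 := congrArg (fun A : Coord n × Coord n →L[ℝ] Coord n × Coord n =>
    (A (sprayField f' p)).2) e2.fderiv_eq
  have hcu : HasFDerivAt (fun q => (u, -conn f' q u)) _ p :=
    (hasFDerivAt_const u p).prodMk
      ((H'.differentiableAt_conn hp).hasFDerivAt.clm_apply (hasFDerivAt_const u p)).neg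
  have hfst : HasFDerivAt (Prod.fst : Coord n × Coord n → Coord n)
    (ContinuousLinearMap.fst ℝ (Coord n) (Coord n)) p := hasFDerivAt_fst
  have hφu : HasFDerivAt (fun q : Coord n × Coord n => fderiv ℝ φ q.1 u) _ p :=
    (((T.contDiffAt_fderiv hp.1).differentiableAt (by simp)).hasFDerivAt.comp p hfst).clm_apply
      (hasFDerivAt_const u p)
  have hcl := (H.differentiableAt_conn (T.tangentLift_mem hp)).hasFDerivAt.comp p hl.hasFDerivAt
  simp only [Function.comp_def] at hcl
  have hr : HasFDerivAt (fun q =>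
      (fderiv ℝ φ q.1 u, -conn f (tangentLift φ q) (fderiv ℝ φ q.1 u))) _ p := hφu.prodMk (hcl.clm_apply hφu).neg
  simp only [(hl2.hasFDerivAt.clm_apply hcu).fderiv, hr.fderiv, add_apply,
    ContinuousLinearMap.comp_apply, ContinuousLinearMap.flip_apply,
    ContinuousLinearMap.prod_apply, neg_apply, T.fderiv_tangentLift_sprayField H H' hf hp,
    Prod.snd_add, zero_apply, map_zero, zero_add, T.fderiv_tangentLift hp.1,
    ContinuousLinearMap.coe_fst'] at h2
  -- Both differentiated relations contain the second derivative of the tangent map on the pair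
  -- (spray, horizontal lift of `u`). Its symmetry lets this term cancel on subtraction, and the
  -- difference is the claimed identity in the form given by `jac_eq`.
  have hsym : fderiv ℝ (fderiv ℝ (tangentLift φ)) p (u, -conn f' p u) (sprayField f' p) =
      fderiv ℝ (fderiv ℝ (tangentLift φ)) p (sprayField f' p) (u, -conn f' p u) :=
    hlc.isSymmSndFDerivAt (by
      rw [minSmoothness_of_isRCLikeNormedField]; exact WithTop.coe_le_coe.2 le_top) _ _
  rw [hsym] at h1
  have hN := T.fderiv_conn H H' hf hp
  have hfst' : (sprayField f' p).1 = p.2 := rfl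
  rw [H'.jac_eq hp, H.jac_eq (T.tangentLift_mem hp)]
  rw [fderiv_spray_eq_add p u, fderiv_spray_eq_add (f := f)] at h1
  rw [hfst'] at h2
  simp only [map_neg, map_add, map_sub, map_smul, hN, T.hess_symm hp.1 u,
    T.hess_symm hp.1 (conn f' p u), neg_apply, smul_add,
    smul_neg] at h1 h2 ⊢
  linear_combination (norm := module) h2 - h1

end JacobiTransformation

end Finsler

namespace Finsler

/-! ### A Finsler manifold in charts -/

section Charts

variable {n : ℕ} {M : Type*} [TopologicalSpace M] [ChartedSpace (Coord n) M]
  [IsManifold (𝓡 n) ∞ M]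

/-- The components of a tangent vector at `x` in the preferred chart at `q`. -/
noncomputable def toChart (q x : M) : TangentSpace (𝓡 n) x →L[ℝ] Coord n :=
  tangentCoordChange (𝓡 n) x q x

theorem coord_eq (q x : M) (v : TangentSpace (𝓡 n) x) :
    coord q ⟨x, v⟩ = (extChartAt (𝓡 n) q x, toChart q x v) := rfl

/-- The tangent vector at `x` with given components in the preferred chart at `q`. -/
noncomputable def fromChart (q x : M) : Coord n →L[ℝ] TangentSpace (𝓡 n) x :=
  tangentCoordChange (𝓡 n) q x x

theorem toChart_fromChart {q x : M} (hx : x ∈ (extChartAt (𝓡 n) q).source) (v : Coord n) :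
    toChart q x (fromChart q x v) = v := by
  refine (tangentCoordChange_comp (I := 𝓡 n) ⟨⟨hx, mem_extChartAt_source x⟩, hx⟩).trans ?_
  exact tangentCoordChange_self hx

theorem fromChart_toChart {q x : M} (hx : x ∈ (extChartAt (𝓡 n) q).source)
    (v : TangentSpace (𝓡 n) x) : fromChart q x (toChart q x v) = v := by
  refine (tangentCoordChange_comp (I := 𝓡 n)
    ⟨⟨mem_extChartAt_source x, hx⟩, mem_extChartAt_source x⟩).trans ?_
  exact tangentCoordChange_self (I := 𝓡 n) (mem_extChartAt_source (I := 𝓡 n) x)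

theorem toChart_injective {q x : M} (hx : x ∈ (extChartAt (𝓡 n) q).source) :
    Function.Injective (toChart (n := n) q x) :=
  Function.LeftInverse.injective (fromChart_toChart hx)

theorem toChart_ne_zero {q x : M} (hx : x ∈ (extChartAt (𝓡 n) q).source) {v : TangentSpace (𝓡 n) x}
    (hv : v ≠ 0) : toChart q x v ≠ 0 := fun h => hv (toChart_injective hx (by simpa using h))

theorem inCoord_coord (F : TangentBundle (𝓡 n) M → ℝ) {q : M} {w : TangentBundle (𝓡 n) M}
    (hw : w.1 ∈ (extChartAt (𝓡 n) q).source) : inCoord F q (coord q w) = F w := by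
  have h : w ∈ (extChartAt (𝓡 n).tangent (⟨q, 0⟩ : TangentBundle (𝓡 n) M)).source := by
    simpa using hw
  rw [inCoord, coord, PartialEquiv.left_inv _ h]

theorem exists_eq_coord {q : M} {p : Coord n × Coord n} (hp : p.1 ∈ (extChartAt (𝓡 n) q).target) :
    ∃ (x : M) (v : TangentSpace (𝓡 n) x), x ∈ (extChartAt (𝓡 n) q).source ∧
      x = (extChartAt (𝓡 n) q).symm p.1 ∧ v = fromChart q x p.2 ∧ coord q ⟨x, v⟩ = p := by
  have hx := (extChartAt (𝓡 n) q).map_target hp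
  refine ⟨(extChartAt (𝓡 n) q).symm p.1, fromChart q _ p.2, hx, rfl, rfl, ?_⟩
  rw [coord_eq, (extChartAt (𝓡 n) q).right_inv hp, toChart_fromChart hx]

theorem inCoord_eq (F : TangentBundle (𝓡 n) M → ℝ) {q : M} {p : Coord n × Coord n}
    (hp : p.1 ∈ (extChartAt (𝓡 n) q).target) :
    inCoord F q p =
      F ⟨(extChartAt (𝓡 n) q).symm p.1, fromChart q ((extChartAt (𝓡 n) q).symm p.1) p.2⟩ := by
  obtain ⟨x, v, hx, rfl, rfl, h⟩ := exists_eq_coord hp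
  conv_lhs => rw [← h]
  exact inCoord_coord F hx

/-- The change of coordinates from the preferred chart at `q'` to the one at `q`. -/
noncomputable def transition (q' q : M) : Coord n → Coord n :=
  extChartAt (𝓡 n) q ∘ (extChartAt (𝓡 n) q').symm

/-- The domain of the change of coordinates. -/
def overlap (q' q : M) : Set (Coord n) :=
  (extChartAt (𝓡 n) q').target ∩ (extChartAt (𝓡 n) q').symm ⁻¹' (extChartAt (𝓡 n) q).source

omit [IsManifold (𝓡 n) ∞ M] in
theorem mem_overlap {q' q x : M} (h' : x ∈ (extChartAt (𝓡 n) q').source)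
    (h : x ∈ (extChartAt (𝓡 n) q).source) : extChartAt (𝓡 n) q' x ∈ overlap q' q := by
  refine ⟨(extChartAt (𝓡 n) q').map_source h', ?_⟩
  rwa [mem_preimage, (extChartAt (𝓡 n) q').left_inv h']

omit [IsManifold (𝓡 n) ∞ M] in
theorem transition_apply {q' q x : M} (h' : x ∈ (extChartAt (𝓡 n) q').source) :
    transition q' q (extChartAt (𝓡 n) q' x) = extChartAt (𝓡 n) q x := by
  rw [transition, Function.comp_apply, (extChartAt (𝓡 n) q').left_inv h']

theorem fderiv_transition {q' q x : M} : fderiv ℝ (transition q' q) (extChartAt (𝓡 n) q' x) =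
    tangentCoordChange (𝓡 n) q' q x := by
  rw [tangentCoordChange_def, ModelWithCorners.range_eq_univ, fderivWithin_univ]; rfl

theorem fderiv_transition_toChart {q' q x : M} (h' : x ∈ (extChartAt (𝓡 n) q').source)
    (h : x ∈ (extChartAt (𝓡 n) q).source) (v : TangentSpace (𝓡 n) x) :
    fderiv ℝ (transition q' q) (extChartAt (𝓡 n) q' x) (toChart q' x v) = toChart q x v := by
  rw [fderiv_transition]
  exact tangentCoordChange_comp ⟨⟨mem_extChartAt_source x, h'⟩, h⟩

theorem tangentLift_coord {q' q x : M} (h' : x ∈ (extChartAt (𝓡 n) q').source)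
    (h : x ∈ (extChartAt (𝓡 n) q).source) (v : TangentSpace (𝓡 n) x) :
    tangentLift (transition q' q) (coord q' ⟨x, v⟩) = coord q ⟨x, v⟩ := by
  simp only [tangentLift, coord_eq, transition_apply h', fderiv_transition_toChart h' h]

theorem isTransition (q' q : M) :
    IsTransition (n := n) (transition q' q) (overlap q' q) (extChartAt (𝓡 n) q).target where
  isOpen := (continuousOn_extChartAt_symm q').isOpen_inter_preimage (isOpen_extChartAt_target q')
    (isOpen_extChartAt_source q)
  smooth x hx := by
    have := contDiffWithinAt_ext_coord_change (n := ∞) (I := 𝓡 n) q q' (y := x)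
      (by rwa [PartialEquiv.trans_source, PartialEquiv.symm_source])
    rwa [ModelWithCorners.range_eq_univ, contDiffWithinAt_univ] at this
  mapsTo x hx := (extChartAt (𝓡 n) q).map_source hx.2
  injective x hx y hy h0 := by
    have hx' := (extChartAt (𝓡 n) q').map_target hx.1
    have e : extChartAt (𝓡 n) q' ((extChartAt (𝓡 n) q').symm x) = x :=
      (extChartAt (𝓡 n) q').right_inv hx.1
    have h1 := fderiv_transition_toChart hx' hx.2 (fromChart q' ((extChartAt (𝓡 n) q').symm x) y)
    rw [toChart_fromChart hx', e, h0] at h1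
    have h2 := toChart_injective hx.2 (a₁ := fromChart q' _ y) (a₂ := 0)
      (by rw [← h1, map_zero])
    have h3 := toChart_fromChart hx' y
    rw [h2, map_zero] at h3
    exact hy h3.symm

theorem inCoord_tangentLift (F : TangentBundle (𝓡 n) M → ℝ) (q' q : M) {p : Coord n × Coord n}
    (hp : p ∈ slit (overlap q' q)) :
    inCoord F q' p = inCoord F q (tangentLift (transition q' q) p) := by
  obtain ⟨x, v, hx, hx', -, rfl⟩ := exists_eq_coord hp.1.1
  have h : x ∈ (extChartAt (𝓡 n) q).source := by
    have := hp.1.2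
    rwa [mem_preimage, ← hx'] at this
  rw [inCoord_coord F hx, tangentLift_coord hx h, inCoord_coord F h]

theorem coord_mem_slit {q x : M} (hx : x ∈ (extChartAt (𝓡 n) q).source)
    {v : TangentSpace (𝓡 n) x} (hv : v ≠ 0) :
    coord q ⟨x, v⟩ ∈ slit (extChartAt (𝓡 n) q).target :=
  ⟨(extChartAt (𝓡 n) q).map_source hx, toChart_ne_zero hx hv⟩

theorem coord_mem_slit_overlap {q' q x : M} (h' : x ∈ (extChartAt (𝓡 n) q').source)
    (h : x ∈ (extChartAt (𝓡 n) q).source) {v : TangentSpace (𝓡 n) x} (hv : v ≠ 0) :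
    coord q' ⟨x, v⟩ ∈ slit (overlap q' q) :=
  ⟨mem_overlap h' h, toChart_ne_zero h' hv⟩

variable {F : TangentBundle (𝓡 n) M → ℝ} (hF : IsFinsler F)
include hF

theorem IsFinsler.slitSmooth (q : M) : SlitSmooth (extChartAt (𝓡 n) q).target (inCoord F q) := by
  intro p hp
  have ht : p ∈ (extChartAt (𝓡 n).tangent (⟨q, 0⟩ : TangentBundle (𝓡 n) M)).target := by
    rw [FiberBundle.extChartAt_target]
    refine ⟨⟨hp.1, ?_⟩, mem_univ _⟩
    simpa using (extChartAt (𝓡 n) q).map_target hp.1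
  have h1 : ContMDiffAt 𝓘(ℝ, Coord n × Coord n) (𝓡 n).tangent ∞
      (extChartAt (𝓡 n).tangent (⟨q, 0⟩ : TangentBundle (𝓡 n) M)).symm p :=
    (contMDiffOn_extChartAt_symm _ p ht).contMDiffAt
      ((isOpen_extChartAt_target _).mem_nhds ht)
  have h2 : ContMDiffAt (𝓡 n).tangent 𝓘(ℝ, ℝ) ∞ F
      ((extChartAt (𝓡 n).tangent (⟨q, 0⟩ : TangentBundle (𝓡 n) M)).symm p) := by
    obtain ⟨x, v, hx, -, -, hxv⟩ := exists_eq_coord hp.1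
    have h3 : (extChartAt (𝓡 n).tangent (⟨q, 0⟩ : TangentBundle (𝓡 n) M)).symm p = ⟨x, v⟩ := by
      rw [← hxv, coord, PartialEquiv.left_inv]
      simpa using hx
    rw [h3]
    refine hF.smooth x v fun h0 => hp.2 ?_
    rw [← hxv, h0, coord_eq]
    exact map_zero _
  exact contMDiffAt_iff_contDiffAt.mp (h2.comp p h1)

/-- `metric` is defined in the chart preferred at the foot point. The tensor law allows one fixed
chart to serve for all nearby points of a curve, which is what differentiation in `t` needs. -/
theorem IsFinsler.metric_eq {q x : M} (hx : x ∈ (extChartAt (𝓡 n) q).source)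
    {y : TangentSpace (𝓡 n) x} (hy : y ≠ 0) (u v : TangentSpace (𝓡 n) x) :
    metric F x y u v =
      gForm (inCoord F q) (coord q ⟨x, y⟩) (toChart q x u) (toChart q x v) := by
  have hx' := mem_extChartAt_source (I := 𝓡 n) x
  have hp' := coord_mem_slit_overlap hx' hx hy
  have hE : SlitSmooth (extChartAt (𝓡 n) q).target fun p => inCoord F q p ^ 2 :=
    fun p hp => (hF.slitSmooth q p hp).pow 2
  have h1 := (isTransition x q).gForm_tangentLift (f' := inCoord F x) (f := inCoord F q) hE
    (fun p hp => inCoord_tangentLift F x q hp) hp' (toChart x x u) (toChart x x v)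
  rw [tangentLift_coord hx' hx, coord_eq, fderiv_transition_toChart hx' hx,
    fderiv_transition_toChart hx' hx] at h1
  exact h1

theorem IsFinsler.isLocal (q : M) : IsLocal (inCoord F q) (extChartAt (𝓡 n) q).target where
  isOpen := isOpen_extChartAt_target q
  smooth := hF.slitSmooth q
  homogeneous x hx a y := by
    rw [inCoord_eq F hx, inCoord_eq F hx]
    simp only [map_smul]
    exact hF.homogeneous _ _ _
  posDef p hp u hu := by
    obtain ⟨x, v, hx, -, -, rfl⟩ := exists_eq_coord hp.1
    have hv : v ≠ 0 := fun h0 => hp.2 (by rw [h0, coord_eq]; exact map_zero _)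
    have hw : fromChart q x u ≠ 0 := fun h0 => hu (by
      rw [← toChart_fromChart hx u, h0, map_zero])
    have h1 := hF.posDef x v hv _ hw
    rwa [hF.metric_eq hx hv, toChart_fromChart hx] at h1

end Charts

end Finsler

namespace Finsler

theorem IsLocal.mono {n : ℕ} {f : Coord n × Coord n → ℝ} {O O' : Set (Coord n)} (H : IsLocal f O)
    (hO : IsOpen O') (h : O' ⊆ O) : IsLocal f O' where
  isOpen := hO
  smooth p hp := H.smooth p ⟨h hp.1, hp.2⟩
  homogeneous x hx := H.homogeneous x (h hx)
  posDef p hp := H.posDef p ⟨h hp.1, hp.2⟩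

/-! ### Fields along a curve in a fixed chart -/

section Curves

open Filter Topology

variable {n : ℕ} {M : Type*} [TopologicalSpace M] [ChartedSpace (Coord n) M]
  [IsManifold (𝓡 n) ∞ M] {c : ℝ → M} {q : M} {s : ℝ}

/-- The curve `c` in the preferred chart at `q`. -/
noncomputable def chartCurve (c : ℝ → M) (q : M) (r : ℝ) : Coord n := extChartAt (𝓡 n) q (c r)

/-- The canonical lift `(c, ċ)` in the preferred chart at `q`. -/
noncomputable def chartLift (c : ℝ → M) (q : M) (r : ℝ) : Coord n × Coord n :=
  coord q ⟨c r, velocity c r⟩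

theorem comp_eq_toChart (c : ℝ → M) (q : M) (X : ∀ t, TangentSpace (𝓡 n) (c t)) (r : ℝ) :
    comp c q X r = toChart q (c r) (X r) := rfl

theorem toChart_ofComponents (x : M) (a : Fin n → ℝ) (i : Fin n) :
    toChart x x (ofComponents x a) i = a i := by
  have h : toChart x x (ofComponents (n := n) x a) = (WithLp.toLp 2 a : Coord n) :=
    tangentCoordChange_self (I := 𝓡 n) (mem_extChartAt_source (I := 𝓡 n) x)
  rw [h]

theorem uniqueDiffOn_unit : UniqueDiffOn ℝ (Icc (0 : ℝ) 1) := uniqueDiffOn_Icc one_pos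

omit [IsManifold (𝓡 n) ∞ M] in
theorem eventually_mem_source {S : Set ℝ} (hc : ContMDiffWithinAt 𝓘(ℝ, ℝ) (𝓡 n) ∞ c S s)
    (hq : c s ∈ (extChartAt (𝓡 n) q).source) :
    ∀ᶠ r in 𝓝[S] s, c r ∈ (extChartAt (𝓡 n) q).source :=
  hc.continuousWithinAt.eventually ((isOpen_extChartAt_source q).mem_nhds hq)

theorem contDiffWithinAt_chartCurve {S : Set ℝ}
    (hc : ContMDiffWithinAt 𝓘(ℝ, ℝ) (𝓡 n) ∞ c S s)
    (hq : c s ∈ (extChartAt (𝓡 n) q).source) :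
    ContDiffWithinAt ℝ ∞ (chartCurve (n := n) c q) S s := by
  rw [← contMDiffWithinAt_iff_contDiffWithinAt]
  exact (contMDiffAt_extChartAt' (by simpa using hq)).comp_contMDiffWithinAt s hc

/-- A field along `c` is smooth iff its components in a chart are. -/
theorem contMDiffWithinAt_field_iff {S : Set ℝ}
    (hc : ContMDiffWithinAt 𝓘(ℝ, ℝ) (𝓡 n) ∞ c S s)
    (hq : c s ∈ (extChartAt (𝓡 n) q).source) (X : ∀ t, TangentSpace (𝓡 n) (c t)) :
    ContMDiffWithinAt 𝓘(ℝ, ℝ) (𝓡 n).tangent ∞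
      (fun t => (⟨c t, X t⟩ : TangentBundle (𝓡 n) M)) S s ↔
    ContDiffWithinAt ℝ ∞ (comp c q X) S s := by
  have he : (⟨c s, X s⟩ : TangentBundle (𝓡 n) M) ∈
      (trivializationAt (Coord n) (TangentSpace (𝓡 n)) q).source := by simpa using hq
  rw [← contMDiffWithinAt_iff_contDiffWithinAt]
  exact (Bundle.Trivialization.contMDiffWithinAt_iff (IB := 𝓡 n) (n := ∞) (F := Coord n)
    (E := (TangentSpace (𝓡 n) : M → Type _)) (IM := 𝓘(ℝ, ℝ))
    (f := fun t => (⟨c t, X t⟩ : TangentBundle (𝓡 n) M))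
    (e := trivializationAt (Coord n) (TangentSpace (𝓡 n)) q) he).trans (and_iff_right hc)

theorem comp_transition {q' : M} {r : ℝ} (h' : c r ∈ (extChartAt (𝓡 n) q').source)
    (h : c r ∈ (extChartAt (𝓡 n) q).source) (X : ∀ t, TangentSpace (𝓡 n) (c t)) :
    comp c q X r = fderiv ℝ (transition q' q) (chartCurve c q' r) (comp c q' X r) :=
  (fderiv_transition_toChart h' h (X r)).symm

variable (hr : IsRegularCurve (n := n) c) (hs : s ∈ Icc (0 : ℝ) 1)
  (hq : c s ∈ (extChartAt (𝓡 n) q).source)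
include hr hs

/-- In the chart preferred at `c s` the manifold derivative is by definition the derivative of the
coordinate expression; other charts follow by the chain rule. -/
theorem IsRegularCurve.hasDerivWithinAt_self :
    HasDerivWithinAt (chartCurve (n := n) c (c s)) (comp c (c s) (velocity c) s)
      (Icc 0 1) s := by
  have h1 := (contDiffWithinAt_chartCurve (hr.1 s hs)
    (mem_extChartAt_source (I := 𝓡 n) (c s))).differentiableWithinAt (by simp)
  have h2 : comp c (c s) (velocity (n := n) c) s = velocity (n := n) c s :=
    tangentCoordChange_self (I := 𝓡 n) (mem_extChartAt_source (I := 𝓡 n) (c s))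
  have h3 : velocity (n := n) c s =
      fderivWithin ℝ (chartCurve (n := n) c (c s)) (Icc 0 1) s (1 : ℝ) := by
    rw [velocity, ((hr.1 s hs).mdifferentiableWithinAt (by simp)).mfderivWithin]
    simp only [mfld_simps]
    rfl
  rw [h2, h3]
  exact h1.hasFDerivWithinAt.hasDerivWithinAt

include hq

theorem IsRegularCurve.hasDerivWithinAt_chartCurve :
    HasDerivWithinAt (chartCurve (n := n) c q) (comp c q (velocity c) s) (Icc 0 1) s := by
  have hs' := mem_extChartAt_source (I := 𝓡 n) (c s)
  have hd := ((isTransition (n := n) (c s) q).smooth _ (mem_overlap hs' hq)).differentiableAt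
    (by simp)
  have h1 := hd.hasFDerivAt.comp_hasDerivWithinAt s (hr.hasDerivWithinAt_self hs)
  rw [comp_transition hs' hq]
  refine h1.congr_of_eventuallyEq ?_ (transition_apply hs').symm
  filter_upwards [eventually_mem_source (hr.1 s hs) hs'] with r hrq
  exact (transition_apply hrq).symm

theorem IsRegularCurve.contDiffWithinAt_velocity :
    ContDiffWithinAt ℝ ∞ (comp c q (velocity (n := n) c)) (Icc 0 1) s := by
  have h1 := contDiffWithinAt_chartCurve (hr.1 s hs) hq
  have h2 : ContDiffWithinAt ℝ ∞ (fun r => fderivWithin ℝ (chartCurve (n := n) c q) (Icc 0 1) r 1)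
      (Icc 0 1) s :=
    (h1.fderivWithin_right (m := ∞) uniqueDiffOn_unit (by simp) hs).clm_apply
      contDiffWithinAt_const
  have h3 : ∀ r ∈ Icc (0 : ℝ) 1, c r ∈ (extChartAt (𝓡 n) q).source →
      comp c q (velocity (n := n) c) r = fderivWithin ℝ (chartCurve (n := n) c q) (Icc 0 1) r 1 :=
    fun r hrs hrq => by
      rw [← derivWithin,
        (hr.hasDerivWithinAt_chartCurve hrs hrq).derivWithin (uniqueDiffOn_unit r hrs)]
  refine h2.congr_of_eventuallyEq ?_ (h3 s hs hq)
  filter_upwards [eventually_mem_source (hr.1 s hs) hq, self_mem_nhdsWithin] with r hrq hrs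
  exact h3 r hrs hrq

theorem IsRegularCurve.contDiffWithinAt_chartLift :
    ContDiffWithinAt ℝ ∞ (chartLift (n := n) c q) (Icc 0 1) s :=
  (contDiffWithinAt_chartCurve (hr.1 s hs) hq).prodMk (hr.contDiffWithinAt_velocity hs hq)

theorem IsRegularCurve.chartLift_mem :
    chartLift (n := n) c q s ∈ slit (extChartAt (𝓡 n) q).target :=
  coord_mem_slit hq (hr.2 s hs)

/-- Differentiating the transformed components produces the second-derivative term `D²φ(ċ, X)`, to
be compensated by the inhomogeneous term in the law of the nonlinear connection. -/
theorem IsRegularCurve.hasDerivWithinAt_comp_transition {q' : M}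
    (hq' : c s ∈ (extChartAt (𝓡 n) q').source) {X : ∀ t, TangentSpace (𝓡 n) (c t)} {x' : Coord n}
    (hX : HasDerivWithinAt (comp c q' X) x' (Icc 0 1) s) :
    HasDerivWithinAt (comp c q X)
      (fderiv ℝ (fderiv ℝ (transition q' q)) (chartCurve c q' s) (comp c q' (velocity c) s)
        (comp c q' X s) + fderiv ℝ (transition q' q) (chartCurve c q' s) x') (Icc 0 1) s := by
  have hd := ((isTransition (n := n) q' q).contDiffAt_fderiv
    (mem_overlap hq' hq)).differentiableAt (by simp)
  have h1 := hd.hasFDerivAt.comp_hasDerivWithinAt s (hr.hasDerivWithinAt_chartCurve hs hq')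
  refine (h1.clm_apply hX).congr_of_eventuallyEq ?_ (comp_transition hq' hq X)
  filter_upwards [eventually_mem_source (hr.1 s hs) hq, eventually_mem_source (hr.1 s hs) hq']
    with r hrq hrq'
  exact comp_transition hrq' hrq X

/-! ### The covariant derivative and the curvature along a geodesic in a chart -/

omit hr hs hq

variable {F : TangentBundle (𝓡 n) M → ℝ} (hF : IsFinsler F) (hc : IsGeodesic F c)
include hF hc hs

omit hs hc in
theorem IsFinsler.isLocal_overlap (q' q : M) : IsLocal (inCoord F q') (overlap q' q) :=
  (hF.isLocal q').mono (isTransition q' q).isOpen inter_subset_left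

/-- The geodesic equation removes the `C` term for all fields at once, and `L_y` turns the `L` term
into `N`. -/
theorem IsGeodesic.toChart_covDeriv_self (X : ∀ t, TangentSpace (𝓡 n) (c t)) :
    toChart (c s) (c s) (covDeriv F c X s) = derivWithin (comp c (c s) X) (Icc 0 1) s +
      conn (inCoord F (c s)) (chartLift c (c s) s) (comp c (c s) X s) := by
  have H := hF.isLocal (n := n) (c s)
  have hp := hc.1.chartLift_mem hs (mem_extChartAt_source (I := 𝓡 n) (c s))
  set f := inCoord F (c s)
  set p := chartLift (n := n) c (c s) s with hpdef
  have hp2 : comp c (c s) (velocity c) s = p.2 := rfl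
  have key : ∀ (X : ∀ t, TangentSpace (𝓡 n) (c t)) (i : Fin n),
      toChart (c s) (c s) (covDeriv F c X s) i = dcomp c (c s) X s i +
        ∑ m, comp c (c s) X s m * ∑ k, (L f i m k p * p.2 k + C f i m k p *
          (dcomp c (c s) (velocity c) s k + ∑ l, N f k l p * p.2 l)) := fun X i => by
    rw [covDeriv, toChart_ofComponents]
    rfl
  -- For `X = ċ` the `C` term drops because `C` is annihilated by `ċ`. So `∇ċ/dt = 0` says that `c̈
  -- + N ċ = 0`, which is the factor multiplying `C` in `∇X/dt` for arbitrary `X`.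
  have hgeo : ∀ i, dcomp c (c s) (velocity c) s i + ∑ l, N f i l p * p.2 l = 0 := by
    intro i
    have h1 := key (velocity c) i
    rw [hc.2 s hs] at h1
    simp only [map_zero, PiLp.zero_apply, hp2] at h1
    rw [h1]
    congr 1
    simp only [Finset.sum_add_distrib, mul_add, H.L_y hp]
    have h2 : ∑ m, p.2 m * ∑ k, C f i m k p *
        (dcomp c (c s) (velocity c) s k + ∑ l, N f k l p * p.2 l) = 0 := by
      simp only [Finset.mul_sum]
      rw [Finset.sum_comm]
      refine Finset.sum_eq_zero fun k _ => ?_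
      rw [← mul_zero (dcomp c (c s) (velocity c) s k + ∑ l, N f k l p * p.2 l),
        ← H.C_y hp i k, Finset.mul_sum]
      exact Finset.sum_congr rfl fun m _ => by ring
    simp only [mul_add, Finset.sum_add_distrib] at h2
    rw [h2, add_zero]
    exact Finset.sum_congr rfl fun m _ => mul_comm _ _
  ext i
  rw [key]
  simp only [hgeo, mul_zero, add_zero, H.L_y hp, PiLp.add_apply, H.conn_apply hp]
  refine congrArg₂ (· + ·) rfl ?_
  exact Finset.sum_congr rfl fun m _ => mul_comm _ _

include hq

/-- The covariant derivative along a geodesic in an arbitrary preferred chart. -/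
theorem IsGeodesic.toChart_covDeriv {X : ∀ t, TangentSpace (𝓡 n) (c t)}
    (hX : DifferentiableWithinAt ℝ (comp c q X) (Icc 0 1) s) :
    toChart q (c s) (covDeriv F c X s) = derivWithin (comp c q X) (Icc 0 1) s +
      conn (inCoord F q) (chartLift c q s) (comp c q X s) := by
  have hs' := mem_extChartAt_source (I := 𝓡 n) (c s)
  have hX' := (hc.1.hasDerivWithinAt_comp_transition hs hs' hq
    hX.hasDerivWithinAt).differentiableWithinAt
  have h1 := hc.1.hasDerivWithinAt_comp_transition hs hq hs' hX'.hasDerivWithinAt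
  rw [h1.derivWithin (uniqueDiffOn_unit s hs), ← fderiv_transition_toChart hs' hq,
    hc.toChart_covDeriv_self hs hF, map_add]
  -- The inhomogeneous term `D²φ(ċ, X)` here matches the one produced by differentiating the
  -- components, so the sum transforms as a vector.
  have h2 := (isTransition (n := n) (c s) q).fderiv_conn (hF.isLocal q) (hF.isLocal_overlap (c s) q)
    (fun p hp => inCoord_tangentLift F _ _ hp) (coord_mem_slit_overlap hs' hq (hc.1.2 s hs))
    (comp c (c s) X s)
  rw [tangentLift_coord hs' hq] at h2
  rw [comp_transition hs' hq]
  change _ + fderiv ℝ (transition (c s) q) (coord (c s) ⟨c s, velocity c s⟩).1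
    (conn (inCoord F (c s)) (coord (c s) ⟨c s, velocity c s⟩) (comp c (c s) X s)) = _
  rw [h2]
  change _ + (conn (inCoord F q) (chartLift c q s) _ + _) = _
  rw [add_comm (conn (inCoord F q) (chartLift c q s) _), ← add_assoc]
  congr 1
  exact add_comm _ _

/-- The geodesic equation in an arbitrary preferred chart. -/
theorem IsGeodesic.hasDerivWithinAt_velocity :
    HasDerivWithinAt (comp c q (velocity c)) (-spray (inCoord F q) (chartLift c q s))
      (Icc 0 1) s := by
  have hd := (hc.1.contDiffWithinAt_velocity hs hq).differentiableWithinAt (by simp)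
  have h1 := hc.toChart_covDeriv hs hq hF hd
  have hp := hc.1.chartLift_mem hs hq
  have h2 : conn (inCoord F q) (chartLift c q s) (comp c q (velocity c) s) =
      spray (inCoord F q) (chartLift c q s) := by
    ext i
    rw [(hF.isLocal q).conn_apply hp]
    exact (hF.isLocal q).N_y hp i
  rw [hc.2 s hs, map_zero, h2] at h1
  rw [← eq_neg_of_add_eq_zero_left h1.symm]
  exact hd.hasDerivWithinAt

theorem IsGeodesic.hasDerivWithinAt_chartLift :
    HasDerivWithinAt (chartLift c q) (sprayField (inCoord F q) (chartLift c q s)) (Icc 0 1) s :=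
  (hc.1.hasDerivWithinAt_chartCurve hs hq).prodMk (hc.hasDerivWithinAt_velocity hs hq hF)

theorem IsGeodesic.scalar_eq (X Y : ∀ t, TangentSpace (𝓡 n) (c t)) :
    scalar F c X Y s = gForm (inCoord F q) (chartLift c q s) (comp c q X s) (comp c q Y s) :=
  hF.metric_eq hq (hc.1.2 s hs) _ _

omit hq in
theorem IsGeodesic.toChart_curv_self (X : ∀ t, TangentSpace (𝓡 n) (c t)) :
    toChart (c s) (c s) (curv F c X s) =
      jac (inCoord F (c s)) (chartLift c (c s) s) (comp c (c s) X s) := by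
  have H := hF.isLocal (n := n) (c s)
  have hp := hc.1.chartLift_mem hs (mem_extChartAt_source (I := 𝓡 n) (c s))
  ext l
  rw [curv, toChart_ofComponents]
  simp only [jac, ← H.R_y_y hp, Finset.sum_mul]
  rw [sum_sum_sum_rotate]
  rfl

theorem IsGeodesic.toChart_curv (X : ∀ t, TangentSpace (𝓡 n) (c t)) :
    toChart q (c s) (curv F c X s) =
      jac (inCoord F q) (chartLift c q s) (comp c q X s) := by
  have hs' := mem_extChartAt_source (I := 𝓡 n) (c s)
  have h2 := (isTransition (n := n) (c s) q).fderiv_jac (hF.isLocal q) (hF.isLocal_overlap (c s) q)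
    (fun p hp => inCoord_tangentLift F _ _ hp) (coord_mem_slit_overlap hs' hq (hc.1.2 s hs))
    (comp c (c s) X s)
  rw [tangentLift_coord hs' hq] at h2
  rw [← fderiv_transition_toChart hs' hq, hc.toChart_curv_self hs hF, comp_transition hs' hq]
  exact h2

end Curves

end Finsler

namespace Finsler

/-! ### Linear ordinary differential equations on the unit interval -/

section LinearODE

open Filter Topology

/-- Local existence and uniqueness of the solutions of a local condition on functions on the unit
interval imply global existence. -/
theorem exists_global_solution {α : Type*} (Sol : (ℝ → α) → ℝ → Prop)
    (hcongr : ∀ f g t, t ∈ Icc (0 : ℝ) 1 → f =ᶠ[𝓝[Icc 0 1] t] g → Sol f t → Sol g t)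
    (hex : ∀ t₀ ∈ Icc (0 : ℝ) 1, ∃ r > 0, ∀ s ∈ Icc (0 : ℝ) 1, |s - t₀| < r → ∀ x, ∃ f : ℝ → α,
      f s = x ∧ ∀ t ∈ Icc (0 : ℝ) 1, |t - t₀| < r → Sol f t)
    (huniq : ∀ a b f g, (∀ t ∈ Icc (0 : ℝ) 1, t ∈ Ioo a b → Sol f t ∧ Sol g t) →
      ∀ s ∈ Icc (0 : ℝ) 1, s ∈ Ioo a b → f s = g s →
        ∀ t ∈ Icc (0 : ℝ) 1, t ∈ Ioo a b → f t = g t) (x : α) :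
    ∃ f : ℝ → α, f 0 = x ∧ ∀ t ∈ Icc (0 : ℝ) 1, Sol f t := by
  choose! r hr hloc using hex
  -- By compactness, a subdivision of the unit interval each of whose cells lies in one ball of
  -- local solvability.
  obtain ⟨τ, hτ0, hτm, ⟨m, hm⟩, hτ⟩ := exists_monotone_Icc_subset_open_cover_Icc
    (zero_le_one (α := ℝ))
    (c := fun t₀ : Icc (0 : ℝ) 1 => {t | |(t : ℝ) - t₀| < r t₀})
    (fun t₀ => isOpen_lt (by fun_prop) continuous_const)
    (fun t _ => mem_iUnion.mpr ⟨t, by simpa using hr t t.2⟩)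
  -- The margin `ε` makes the solution reach strictly beyond `τ k`. The next local solution then
  -- agrees with it on an open interval around `τ k`, so the function glued there satisfies the
  -- local condition at `τ k` too.
  have key : ∀ k, ∃ f : ℝ → α, ∃ ε > 0, f 0 = x ∧ ∀ t ∈ Icc (0 : ℝ) 1, t < τ k + ε → Sol f t := by
    intro k
    induction k with
    | zero =>
      obtain ⟨f, hf0, hf⟩ := hloc 0 (by simp) 0 (by simp) (by simpa using hr 0 (by simp)) x
      refine ⟨f, r 0, hr 0 (by simp), hf0, fun t ht htr => hf t ht ?_⟩
      rw [hτ0] at htr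
      rw [sub_zero, abs_of_nonneg ht.1]
      simpa using htr
    | succ k ih =>
      obtain ⟨f, ε, hε, hf0, hf⟩ := ih
      obtain ⟨t₀, ht₀⟩ := hτ k
      have hk : (τ k : ℝ) ≤ τ (k + 1) := hτm (Nat.le_succ k)
      have h1 : |(τ k : ℝ) - t₀| < r t₀ := ht₀ ⟨le_rfl, hτm (Nat.le_succ k)⟩
      have h2 : |(τ (k + 1) : ℝ) - t₀| < r t₀ := ht₀ ⟨hτm (Nat.le_succ k), le_rfl⟩
      obtain ⟨g, hg0, hg⟩ := hloc t₀ t₀.2 (τ k) (τ k).2 h1 (f (τ k))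
      rw [abs_lt] at h1 h2
      set a : ℝ := t₀ - r t₀ with ha
      set b : ℝ := min (τ k + ε) (t₀ + r t₀) with hb
      have hab : (τ k : ℝ) ∈ Ioo a b :=
        ⟨by linarith, lt_min (by linarith) (by linarith)⟩
      have heq : ∀ t ∈ Icc (0 : ℝ) 1, t ∈ Ioo a b → f t = g t := by
        refine huniq a b f g (fun t ht htab => ?_) (τ k) (τ k).2 hab hg0.symm
        have hb1 := htab.2.trans_le (min_le_left _ _)
        have hb2 := htab.2.trans_le (min_le_right _ _)
        refine ⟨hf t ht hb1, hg t ht ?_⟩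
        rw [abs_lt]
        constructor <;> linarith [htab.1]
      -- The new margin is the distance from `τ (k + 1)` to the right end of the ball on which `g`
      -- is a solution.
      refine ⟨fun t => if t < τ k then f t else g t, t₀ + r t₀ - τ (k + 1), by linarith, ?_, ?_⟩
      · by_cases h0 : (0 : ℝ) < τ k
        · simpa [h0] using hf0
        · have h00 : (τ k : ℝ) = 0 := le_antisymm (not_lt.mp h0) (τ k).2.1
          rw [h00] at hg0
          simp [h0, hg0, hf0]
      · intro t ht htr
        rcases lt_or_ge t (τ k) with hlt | hge
        · refine hcongr f _ t ht ?_ (hf t ht (by linarith))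
          refine nhdsWithin_le_nhds (Filter.eventually_of_mem (Iio_mem_nhds hlt) fun s hs => ?_)
          simp [mem_Iio.mp hs]
        · refine hcongr g _ t ht ?_ (hg t ht ?_)
          · have : ∀ᶠ s in 𝓝[Icc (0 : ℝ) 1] t, s ∈ Ioi a ∩ Icc (0 : ℝ) 1 :=
              inter_mem (nhdsWithin_le_nhds (Ioi_mem_nhds (hab.1.trans_le hge)))
                self_mem_nhdsWithin
            filter_upwards [this] with s hs
            by_cases hsk : s < τ k
            · simp only [hsk, if_true]
              exact (heq s hs.2 ⟨hs.1, hsk.trans hab.2⟩).symm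
            · simp [hsk]
          · rw [abs_lt]
            constructor <;> linarith
  obtain ⟨f, ε, hε, hf0, hf⟩ := key m
  refine ⟨f, hf0, fun t ht => hf t ht ?_⟩
  rw [hm m le_rfl]
  linarith [ht.2]

variable {E : Type*} [NormedAddCommGroup E] [NormedSpace ℝ E]

/-- Uniqueness for linear differential equations. -/
theorem linear_ode_unique {A : ℝ → E →L[ℝ] E} {a b : ℝ} {f g : ℝ → E}
    (hA : ContinuousOn A (Icc 0 1 ∩ Ioo a b))
    (hf : ∀ t ∈ Icc (0 : ℝ) 1, t ∈ Ioo a b → HasDerivWithinAt f (A t (f t)) (Icc 0 1) t)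
    (hg : ∀ t ∈ Icc (0 : ℝ) 1, t ∈ Ioo a b → HasDerivWithinAt g (A t (g t)) (Icc 0 1) t)
    {s : ℝ} (hs : s ∈ Icc (0 : ℝ) 1) (hsab : s ∈ Ioo a b) (hfg : f s = g s)
    {t : ℝ} (ht : t ∈ Icc (0 : ℝ) 1) (htab : t ∈ Ioo a b) : f t = g t := by
  have hd : ∀ t ∈ Icc (0 : ℝ) 1, t ∈ Ioo a b →
      HasDerivWithinAt (fun t => f t - g t) (A t (f t - g t)) (Icc 0 1) t := fun t ht htab => by
    rw [map_sub]
    exact (hf t ht htab).fun_sub (hg t ht htab)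
  set d : ℝ → E := fun t => f t - g t with hdd
  suffices d t = 0 from sub_eq_zero.mp this
  have hds : d s = 0 := sub_eq_zero.mpr hfg
  rcases le_total s t with hst | hts
  · have hsub : Icc s t ⊆ Icc 0 1 ∩ Ioo a b := fun r hr =>
      ⟨⟨hs.1.trans hr.1, hr.2.trans ht.2⟩, hsab.1.trans_le hr.1, hr.2.trans_lt htab.2⟩
    obtain ⟨K, hK⟩ := isCompact_Icc.exists_bound_of_continuousOn (hA.mono hsub)
    -- Grönwall: the difference satisfies `‖d'‖ ≤ K ‖d‖` on the compact interval between `s` and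
    -- `t`, and starts from zero.
    refine eq_zero_of_abs_deriv_le_mul_abs_self_of_eq_zero_right (f := d)
      (f' := fun r => A r (d r)) (K := K) (a := s) (b := t) ?_ ?_ hds ?_ t ⟨hst, le_rfl⟩
    · exact fun r hr => ((hd r (hsub hr).1 (hsub hr).2).continuousWithinAt).mono
        fun x hx => (hsub hx).1
    · intro r hr
      have hr' := hsub ⟨hr.1, hr.2.le⟩
      have hI : Icc r t ⊆ Icc 0 1 := Icc_subset_Icc hr'.1.1 ht.2
      exact ((hd r hr'.1 hr'.2).mono hI).mono_of_mem_nhdsWithin (Icc_mem_nhdsGE hr.2)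
    · exact fun r hr => (A r).le_of_opNorm_le (hK r ⟨hr.1, hr.2.le⟩) _
  · have hsub : Icc t s ⊆ Icc 0 1 ∩ Ioo a b := fun r hr =>
      ⟨⟨ht.1.trans hr.1, hr.2.trans hs.2⟩, htab.1.trans_le hr.1, hr.2.trans_lt hsab.2⟩
    obtain ⟨K, hK⟩ := isCompact_Icc.exists_bound_of_continuousOn (hA.mono hsub)
    -- Times before `s` are reached by reversing the parameter, since the Grönwall estimate runs
    -- forwards.
    have hmap : MapsTo (fun r : ℝ => -r) (Icc (-s) (-t)) (Icc t s) := fun r hr =>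
      ⟨by linarith [hr.2], by linarith [hr.1]⟩
    have h := eq_zero_of_abs_deriv_le_mul_abs_self_of_eq_zero_right (f := fun r => d (-r))
      (f' := fun r => -A (-r) (d (-r))) (K := K) (a := -s) (b := -t) ?_ ?_ (by simpa using hds)
      ?_ (-t) ⟨by linarith, le_rfl⟩
    · simpa using h
    · refine ContinuousOn.comp (g := d) (t := Icc t s) (fun r hr => ?_)
        continuousOn_neg hmap
      exact ((hd r (hsub hr).1 (hsub hr).2).continuousWithinAt).mono fun x hx => (hsub hx).1
    · intro r hr
      have hr' := hsub (hmap ⟨hr.1, hr.2.le⟩)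
      have h1 := (hd (-r) hr'.1 hr'.2).scomp_of_eq (h := fun r : ℝ => -r) (h' := -1)
        (s := Icc r (-t)) r (hasDerivAt_neg r).hasDerivWithinAt (fun x hx =>
          ⟨by linarith [hx.2, ht.1], by linarith [hx.1, hr'.1.2]⟩) rfl
      rw [neg_one_smul] at h1
      exact h1.mono_of_mem_nhdsWithin (Icc_mem_nhdsGE hr.2)
    · intro r hr
      rw [norm_neg]
      exact (A (-r)).le_of_opNorm_le (hK _ (hmap ⟨hr.1, hr.2.le⟩)) _

/-- Existence for linear differential equations on short intervals. -/
theorem linear_ode_exists_short [CompleteSpace E] {A : ℝ → E →L[ℝ] E} {a b : ℝ} {K : NNReal}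
    (hA : ContinuousOn A (Icc a b)) (hK : ∀ t ∈ Icc a b, ‖A t‖ ≤ K) (hab : 2 * K * (b - a) ≤ 1)
    {s : ℝ} (hs : s ∈ Icc a b) (x : E) :
    ∃ f : ℝ → E, f s = x ∧ ∀ t ∈ Icc a b, HasDerivWithinAt f (A t (f t)) (Icc a b) t := by
  -- On the ball of radius `‖x‖` about `x` the field `A t y` has norm at most `K · 2‖x‖`. The
  -- condition `2 K (b - a) ≤ 1` then keeps the iteration in that ball, whatever `x` is.
  have hPL : IsPicardLindelof (fun t x => A t x) (⟨s, hs⟩ : Icc a b) x ‖x‖₊ 0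
      (K * (‖x‖₊ + ‖x‖₊)) K := by
    refine ⟨fun t ht => ?_, fun y _ => hA.clm_apply continuousOn_const, fun t ht y hy => ?_, ?_⟩
    · exact ((A t).lipschitz.weaken (by exact_mod_cast hK t ht)).lipschitzOnWith
    · refine ((A t).le_of_opNorm_le (hK t ht) y).trans ?_
      push_cast
      gcongr
      have h1 : ‖y - x‖ ≤ ‖x‖ := by simpa [dist_eq_norm] using hy
      calc ‖y‖ = ‖x + (y - x)‖ := by simp
        _ ≤ ‖x‖ + ‖y - x‖ := norm_add_le _ _
        _ ≤ _ := by linarith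
    · push_cast
      have h1 : max (b - s) (s - a) ≤ b - a := max_le (by linarith [hs.1]) (by linarith [hs.2])
      calc (K : ℝ) * (‖x‖ + ‖x‖) * max (b - s) (s - a) ≤ K * (‖x‖ + ‖x‖) * (b - a) := by gcongr
        _ = ‖x‖ * (2 * K * (b - a)) := by ring
        _ ≤ ‖x‖ * 1 := by gcongr
        _ = ‖x‖ - 0 := by ring
  exact hPL.exists_eq_forall_mem_Icc_hasDerivWithinAt₀

/-- Local existence for linear differential equations on the unit interval. -/
theorem linear_ode_exists_local [CompleteSpace E] {A : ℝ → E →L[ℝ] E} {t₀ : ℝ}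
    (ht₀ : t₀ ∈ Icc (0 : ℝ) 1) (hA : ∀ᶠ t in 𝓝[Icc 0 1] t₀, ContinuousWithinAt A (Icc 0 1) t) :
    ∃ r > 0, ∀ s ∈ Icc (0 : ℝ) 1, |s - t₀| < r → ∀ x, ∃ f : ℝ → E,
      f s = x ∧ ∀ t ∈ Icc (0 : ℝ) 1, |t - t₀| < r →
        HasDerivWithinAt f (A t (f t)) (Icc 0 1) t := by
  have hb : ∀ᶠ t in 𝓝[Icc 0 1] t₀, ‖A t‖ < ‖A t₀‖ + 1 :=
    (hA.self_of_nhdsWithin ht₀).norm.eventually (gt_mem_nhds (by simp))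
  obtain ⟨ρ, hρ, hρA⟩ := Metric.mem_nhdsWithin_iff.mp (hA.and hb)
  set K : NNReal := ‖A t₀‖₊ + 1 with hK
  have hKpos : (0 : ℝ) < K := by positivity
  -- The bound `ρ / 2` stays where `A` is continuous and bounded by `K`; the bound `1 / (4 K)` makes
  -- an interval of length `2 r` short enough for `linear_ode_exists_short`.
  set r : ℝ := min (ρ / 2) (1 / (4 * K)) with hr
  have hrpos : 0 < r := by positivity
  have hsub : ∀ t ∈ Icc (max 0 (t₀ - r)) (min 1 (t₀ + r)),
      t ∈ Icc (0 : ℝ) 1 ∧ ContinuousWithinAt A (Icc 0 1) t ∧ ‖A t‖ < ‖A t₀‖ + 1 := by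
    intro t ht
    have h1 := (le_max_left _ _).trans ht.1
    have h2 := (le_max_right _ _).trans ht.1
    have h3 := ht.2.trans (min_le_left _ _)
    have h4 := ht.2.trans (min_le_right _ _)
    have h5 : r ≤ ρ / 2 := min_le_left _ _
    refine ⟨⟨h1, h3⟩, hρA ⟨?_, h1, h3⟩⟩
    rw [Metric.mem_ball, Real.dist_eq, abs_lt]
    constructor <;> linarith
  refine ⟨r, hrpos, fun s hs hsr x => ?_⟩
  have hmem : ∀ t ∈ Icc (0 : ℝ) 1, |t - t₀| < r →
      t ∈ Icc (max 0 (t₀ - r)) (min 1 (t₀ + r)) := fun t ht htr => by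
    rw [abs_lt] at htr
    exact ⟨max_le ht.1 (by linarith), le_min ht.2 (by linarith)⟩
  have hlen : 2 * (K : ℝ) * (min 1 (t₀ + r) - max 0 (t₀ - r)) ≤ 1 := by
    have h1 : min 1 (t₀ + r) - max 0 (t₀ - r) ≤ 2 * r := by
      linarith [min_le_right 1 (t₀ + r), le_max_right 0 (t₀ - r)]
    have h2 : r ≤ 1 / (4 * K) := min_le_right _ _
    calc 2 * (K : ℝ) * (min 1 (t₀ + r) - max 0 (t₀ - r)) ≤ 2 * K * (2 * (1 / (4 * K))) := by
          gcongr; linarith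
      _ = 1 := by field_simp; norm_num
  obtain ⟨f, hf0, hf⟩ := linear_ode_exists_short (A := A) (K := K)
    (fun t ht => (hsub t ht).2.1.mono fun y hy => (hsub y hy).1)
    (fun t ht => by simpa [hK] using (hsub t ht).2.2.le) hlen (hmem s hs hsr) x
  refine ⟨f, hf0, fun t ht htr => (hf t (hmem t ht htr)).mono_of_mem_nhdsWithin ?_⟩
  rw [abs_lt] at htr
  filter_upwards [self_mem_nhdsWithin, nhdsWithin_le_nhds (Ioo_mem_nhds
    (show t₀ - r < t by linarith) (show t < t₀ + r by linarith))] with y hy hy'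
  exact ⟨max_le hy.1 hy'.1.le, le_min hy.2 hy'.2.le⟩

/-- Global existence for linear differential equations on the unit interval. -/
theorem linear_ode_exists [CompleteSpace E] {A : ℝ → E →L[ℝ] E} (hA : ContinuousOn A (Icc 0 1))
    (x : E) : ∃ f : ℝ → E, f 0 = x ∧
      ∀ t ∈ Icc (0 : ℝ) 1, HasDerivWithinAt f (A t (f t)) (Icc 0 1) t := by
  refine exists_global_solution (fun f t => HasDerivWithinAt f (A t (f t)) (Icc 0 1) t)
    (fun f g t ht hfg hf => ?_) (fun t₀ ht₀ => linear_ode_exists_local ht₀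
      (Filter.eventually_of_mem self_mem_nhdsWithin hA)) (fun a b f g hfg s hs hsab h t ht htab =>
      linear_ode_unique (hA.mono inter_subset_left) (fun t ht htab => (hfg t ht htab).1)
        (fun t ht htab => (hfg t ht htab).2) hs hsab h ht htab) x
  have h0 : f t = g t := hfg.self_of_nhdsWithin ht
  rw [← h0]
  exact hf.congr_of_eventuallyEq hfg.symm h0.symm

/-- Solutions of smooth linear differential equations are smooth. -/
theorem linear_ode_contDiffOn {A : ℝ → E →L[ℝ] E} {K : Set ℝ} (hK : UniqueDiffOn ℝ K)
    (hA : ContDiffOn ℝ ∞ A K) {f : ℝ → E}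
    (hf : ∀ t ∈ K, HasDerivWithinAt f (A t (f t)) K t) : ContDiffOn ℝ ∞ f K := by
  rw [contDiffOn_infty]
  intro k
  induction k with
  | zero => exact contDiffOn_zero.mpr fun t ht => (hf t ht).continuousWithinAt
  | succ k ih =>
    push_cast
    rw [contDiffOn_succ_iff_derivWithin hK]
    refine ⟨fun t ht => (hf t ht).differentiableWithinAt, by simp, ?_⟩
    -- Bootstrap: the derivative is `A f`, hence of class `C^k` as soon as `f` is.
    refine ((hA.of_le (by exact_mod_cast le_top)).clm_apply ih).congr fun t ht => ?_
    exact (hf t ht).derivWithin (hK t ht)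

end LinearODE

end Finsler

namespace Finsler

/-! ### The linear Jacobi equation on the unit interval -/

section JacobiEquation

open Filter Topology MeasureTheory
open scoped InnerProductSpace

/-- `u' = du/dt` and `u'' + S u = 0` on the unit interval. -/
structure JacobiSol {G : Type*} [NormedAddCommGroup G] [NormedSpace ℝ G] (S : ℝ → G →L[ℝ] G)
    (u u' : ℝ → G) : Prop where
  deriv : ∀ t ∈ Icc (0 : ℝ) 1, HasDerivWithinAt u (u' t) (Icc 0 1) t
  deriv' : ∀ t ∈ Icc (0 : ℝ) 1, HasDerivWithinAt u' (-(S t (u t))) (Icc 0 1) t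

section Normed

variable {G : Type*} [NormedAddCommGroup G] [NormedSpace ℝ G]

/-- The first-order system on `G × G` of the Jacobi equation. -/
noncomputable def jacobiSystem (S : ℝ → G →L[ℝ] G) (t : ℝ) : (G × G) →L[ℝ] (G × G) :=
  (ContinuousLinearMap.snd ℝ G G).prod (-((S t).comp (ContinuousLinearMap.fst ℝ G G)))

theorem jacobiSystem_eq (S : ℝ → G →L[ℝ] G) : jacobiSystem S = fun t =>
    (ContinuousLinearMap.inl ℝ G G).comp (ContinuousLinearMap.snd ℝ G G) -
      (ContinuousLinearMap.inr ℝ G G).comp ((S t).comp (ContinuousLinearMap.fst ℝ G G)) := by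
  funext t
  ext p <;> simp [jacobiSystem]

theorem continuousOn_jacobiSystem {S : ℝ → G →L[ℝ] G} (hS : ContinuousOn S (Icc 0 1)) :
    ContinuousOn (jacobiSystem S) (Icc 0 1) := by
  rw [jacobiSystem_eq]
  exact continuousOn_const.sub (continuousOn_const.clm_comp (hS.clm_comp continuousOn_const))

theorem contDiffOn_jacobiSystem {S : ℝ → G →L[ℝ] G} (hS : ContDiffOn ℝ ∞ S (Icc 0 1)) :
    ContDiffOn ℝ ∞ (jacobiSystem S) (Icc 0 1) := by
  rw [jacobiSystem_eq]
  exact contDiffOn_const.sub (contDiffOn_const.clm_comp (hS.clm_comp contDiffOn_const))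

theorem JacobiSol.hasDerivWithinAt_prodMk {S : ℝ → G →L[ℝ] G} {u u' : ℝ → G}
    (h : JacobiSol S u u') :
    ∀ t ∈ Icc (0 : ℝ) 1, HasDerivWithinAt (fun t => (u t, u' t))
      (jacobiSystem S t (u t, u' t)) (Icc 0 1) t :=
  fun t ht => (h.deriv t ht).prodMk (h.deriv' t ht)

theorem JacobiSol.contDiffOn {S : ℝ → G →L[ℝ] G} {u u' : ℝ → G} (h : JacobiSol S u u')
    (hS : ContDiffOn ℝ ∞ S (Icc 0 1)) : ContDiffOn ℝ ∞ u (Icc 0 1) :=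
  contDiff_fst.comp_contDiffOn
    (linear_ode_contDiffOn uniqueDiffOn_unit (contDiffOn_jacobiSystem hS) h.hasDerivWithinAt_prodMk)

theorem JacobiSol.eq_zero {S : ℝ → G →L[ℝ] G} {u u' : ℝ → G} (h : JacobiSol S u u')
    (hS : ContinuousOn S (Icc 0 1)) {s t : ℝ} (hs : s ∈ Icc (0 : ℝ) 1) (hu : u s = 0)
    (hu' : u' s = 0) (ht : t ∈ Icc (0 : ℝ) 1) : u t = 0 := by
  have hI : ∀ r ∈ Icc (0 : ℝ) 1, r ∈ Ioo (-1 : ℝ) 2 := fun r hr =>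
    ⟨by linarith [hr.1], by linarith [hr.2]⟩
  have := linear_ode_unique (A := jacobiSystem S) (a := -1) (b := 2) (f := fun t => (u t, u' t))
    (g := fun _ => 0) ((continuousOn_jacobiSystem hS).mono inter_subset_left)
    (fun r hr _ => h.hasDerivWithinAt_prodMk r hr)
    (fun r hr _ => by rw [map_zero]; exact hasDerivWithinAt_const _ _ _) hs (hI s hs)
    (by simp [hu, hu']) ht (hI t ht)
  exact congrArg Prod.fst this

theorem exists_jacobiSol [CompleteSpace G] {S : ℝ → G →L[ℝ] G} (hS : ContinuousOn S (Icc 0 1))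
    (x y : G) : ∃ u u' : ℝ → G, JacobiSol S u u' ∧ u 0 = x ∧ u' 0 = y := by
  obtain ⟨f, hf0, hf⟩ := linear_ode_exists (continuousOn_jacobiSystem hS) (x, y)
  refine ⟨fun t => (f t).1, fun t => (f t).2, ⟨fun t ht => ?_, fun t ht => ?_⟩, by simp [hf0],
    by simp [hf0]⟩
  · exact (ContinuousLinearMap.fst ℝ G G).hasFDerivAt.comp_hasDerivWithinAt t (hf t ht)
  · exact (ContinuousLinearMap.snd ℝ G G).hasFDerivAt.comp_hasDerivWithinAt t (hf t ht)

/-- The operator solution `𝒜` with `𝒜 0 = 0`, `𝒜' 0 = 1`. -/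
theorem exists_operator_jacobiSol [CompleteSpace G] {S : ℝ → G →L[ℝ] G}
    (hS : ContinuousOn S (Icc 0 1)) : ∃ A B : ℝ → G →L[ℝ] G,
      (∀ t ∈ Icc (0 : ℝ) 1, HasDerivWithinAt A (B t) (Icc 0 1) t) ∧
      (∀ t ∈ Icc (0 : ℝ) 1, HasDerivWithinAt B (-((S t) * (A t))) (Icc 0 1) t) ∧
      A 0 = 0 ∧ B 0 = 1 := by
  -- The operator equation is the Jacobi equation in the space of operators, with `S t` acting by
  -- left composition.
  obtain ⟨A, B, h, hA, hB⟩ := exists_jacobiSol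
    (S := fun t => ContinuousLinearMap.compL ℝ G G G (S t))
    ((ContinuousLinearMap.compL ℝ G G G).continuous.comp_continuousOn hS) 0 1
  exact ⟨A, B, h.deriv, h.deriv', hA, hB⟩

end Normed

variable {E : Type*} [NormedAddCommGroup E] [InnerProductSpace ℝ E]

/-- The integrand of the index form of a Jacobi field is the derivative of `⟪u', u⟫`. -/
theorem JacobiSol.integral_eq_zero {S : ℝ → E →L[ℝ] E} {u u' : ℝ → E} (h : JacobiSol S u u')
    (hS : ContinuousOn S (Icc 0 1)) {b : ℝ} (hb : b ∈ Icc (0 : ℝ) 1) (h0 : u 0 = 0)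
    (hub : u b = 0) : ∫ t in (0 : ℝ)..b, (‖u' t‖ ^ 2 - ⟪S t (u t), u t⟫_ℝ) = 0 := by
  have hsub : Icc 0 b ⊆ Icc (0 : ℝ) 1 := Icc_subset_Icc_right hb.2
  have hcu : ContinuousOn u (Icc 0 1) := fun t ht => (h.deriv t ht).continuousWithinAt
  have hcu' : ContinuousOn u' (Icc 0 1) := fun t ht => (h.deriv' t ht).continuousWithinAt
  rw [intervalIntegral.integral_eq_sub_of_hasDerivAt_of_le (f := fun t => ⟪u' t, u t⟫_ℝ) hb.1]
  · simp [h0, hub]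
  · exact (hcu'.inner hcu).mono hsub
  · intro t ht
    have ht' : t ∈ Icc (0 : ℝ) 1 := hsub ⟨ht.1.le, ht.2.le⟩
    have hn : Icc (0 : ℝ) 1 ∈ 𝓝 t := Icc_mem_nhds ht.1 (ht.2.trans_le hb.2)
    refine (((h.deriv' t ht').hasDerivAt hn).inner ℝ
      ((h.deriv t ht').hasDerivAt hn)).congr_deriv ?_
    rw [real_inner_self_eq_norm_sq, inner_neg_left]
    ring
  · refine ContinuousOn.intervalIntegrable ?_
    rw [uIcc_of_le hb.1]
    exact ((hcu'.norm.pow 2).sub ((hS.clm_apply hcu).inner hcu)).mono hsub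

/-- A component of a Jacobi field along a parallel null direction of the curvature is affine. -/
theorem JacobiSol.inner_eq_zero {S : ℝ → E →L[ℝ] E} {u u' : ℝ → E} (h : JacobiSol S u u')
    {v : E} (hsymm : ∀ t ∈ Icc (0 : ℝ) 1, ∀ x y, ⟪S t x, y⟫_ℝ = ⟪x, S t y⟫_ℝ)
    (hv : ∀ t ∈ Icc (0 : ℝ) 1, S t v = 0) {b : ℝ} (hb : b ∈ Ioc (0 : ℝ) 1) (h0 : u 0 = 0)
    (hub : u b = 0) {t : ℝ} (ht : t ∈ Icc (0 : ℝ) 1) : ⟪u t, v⟫_ℝ = 0 := by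
  -- The derivative is `-⟪S u, v⟫ = -⟪u, S v⟫ = 0`.
  have hconst : ∀ t ∈ Icc (0 : ℝ) 1, ⟪u' t, v⟫_ℝ = ⟪u' 0, v⟫_ℝ := by
    refine constant_of_has_deriv_right_zero
      (fun t ht => ((h.deriv' t ht).continuousWithinAt).inner continuousWithinAt_const)
      fun t ht => ?_
    have ht' : t ∈ Icc (0 : ℝ) 1 := ⟨ht.1, ht.2.le⟩
    have := ((h.deriv' t ht').inner ℝ (hasDerivWithinAt_const t (Icc (0 : ℝ) 1) v)).mono
      (Icc_subset_Icc_left ht.1)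
    rw [inner_neg_left, hsymm t ht', hv t ht'] at this
    simpa using this.mono_of_mem_nhdsWithin (Icc_mem_nhdsGE ht.2)
  have haff : ∀ t ∈ Icc (0 : ℝ) 1, ⟪u t, v⟫_ℝ - t * ⟪u' 0, v⟫_ℝ = ⟪u 0, v⟫_ℝ - 0 * ⟪u' 0, v⟫_ℝ := by
    refine constant_of_has_deriv_right_zero (fun t ht =>
      (((h.deriv t ht).continuousWithinAt).inner continuousWithinAt_const).sub
        (continuousWithinAt_id.mul continuousWithinAt_const)) fun t ht => ?_
    have ht' : t ∈ Icc (0 : ℝ) 1 := ⟨ht.1, ht.2.le⟩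
    have := ((h.deriv t ht').inner ℝ (hasDerivWithinAt_const t (Icc (0 : ℝ) 1) v)).fun_sub
      ((hasDerivWithinAt_id t (Icc (0 : ℝ) 1)).mul_const ⟪u' 0, v⟫_ℝ)
    rw [hconst t ht'] at this
    simpa using (this.mono (Icc_subset_Icc_left ht.1)).mono_of_mem_nhdsWithin
      (Icc_mem_nhdsGE ht.2)
  have hb' := haff b ⟨hb.1.le, hb.2⟩
  rw [hub, h0] at hb'
  have hz : ⟪u' 0, v⟫_ℝ = 0 := by
    have : b * ⟪u' 0, v⟫_ℝ = 0 := by simpa using hb'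
    exact (mul_eq_zero.mp this).resolve_left hb.1.ne'
  simpa [h0, hz] using haff t ht

end JacobiEquation

end Finsler

namespace Finsler

/-! ### The Riccati equation and the Jacobi condition -/

section Riccati

open Filter Topology MeasureTheory
open scoped InnerProductSpace

variable {E : Type*} [NormedAddCommGroup E] [InnerProductSpace ℝ E]

theorem hasDerivWithinAt_ringInverse {R : Type*} [NormedRing R] [NormedAlgebra ℝ R]
    [HasSummableGeomSeries R] {A : ℝ → R} {B : R} {s : Set ℝ} {t : ℝ}
    (hA : HasDerivWithinAt A B s t) (hu : IsUnit (A t)) :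
    HasDerivWithinAt (fun r => Ring.inverse (A r)) (-(Ring.inverse (A t) * B * Ring.inverse (A t)))
      s t := by
  obtain ⟨x, hx⟩ := hu
  have h := hasFDerivAt_ringInverse (𝕜 := ℝ) x
  rw [hx] at h
  have h2 := h.comp_hasDerivWithinAt t hA
  rw [← hx, Ring.inverse_unit]
  refine h2.congr_deriv ?_
  simp

/-- In the absence of conjugate points the operator Jacobi fields give a symmetric solution `U` of
the Riccati equation on `(0,1]`. -/
theorem exists_riccati [FiniteDimensional ℝ E] {S : ℝ → E →L[ℝ] E}
    (hS : ContinuousOn S (Icc 0 1))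
    (hsymm : ∀ t ∈ Icc (0 : ℝ) 1, ∀ x y, ⟪S t x, y⟫_ℝ = ⟪x, S t y⟫_ℝ)
    (hconj : ∀ u u' : ℝ → E, JacobiSol S u u' → u 0 = 0 → ∀ b ∈ Ioc (0 : ℝ) 1, u b = 0 →
      ∀ t ∈ Icc (0 : ℝ) 1, u t = 0) :
    ∃ V U : ℝ → E →L[ℝ] E,
      (∀ t ∈ Ioc (0 : ℝ) 1, HasDerivWithinAt V (-(V t * U t)) (Icc 0 1) t) ∧
      (∀ t ∈ Ioc (0 : ℝ) 1, HasDerivWithinAt U (-S t - U t * U t) (Icc 0 1) t) ∧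
      (∀ t ∈ Ioc (0 : ℝ) 1, ∀ x y, ⟪U t x, y⟫_ℝ = ⟪x, U t y⟫_ℝ) ∧
      (∀ t ∈ Ioc (0 : ℝ) 1, ∀ x, V t x = 0 → x = 0) ∧
      ∀ (w : ℝ → E) (w₀ : E), w 0 = 0 → HasDerivWithinAt w w₀ (Icc 0 1) 0 →
        Tendsto (fun t => ⟪U t (w t), w t⟫_ℝ) (𝓝[Ioc 0 1] 0) (𝓝 0) := by
  have : CompleteSpace E := FiniteDimensional.complete ℝ E
  obtain ⟨A, B, hA, hB, hA0, hB0⟩ := exists_operator_jacobiSol hS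
  have hsol : ∀ x, JacobiSol S (fun t => A t x) (fun t => B t x) := fun x =>
    ⟨fun t ht => by
        simpa using (hA t ht).clm_apply (hasDerivWithinAt_const t (Icc (0 : ℝ) 1) x),
      fun t ht => by
        simpa using (hB t ht).clm_apply (hasDerivWithinAt_const t (Icc (0 : ℝ) 1) x)⟩
  -- A kernel vector `x` of `A t` gives a Jacobi field `A x` vanishing at `0` and at `t`. It is
  -- identically zero by assumption, so its initial derivative `x` is zero.
  have hinj : ∀ t ∈ Ioc (0 : ℝ) 1, IsUnit (A t) := by
    intro t ht
    have hi : Function.Injective (A t) := by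
      rw [injective_iff_map_eq_zero]
      intro x hx
      have hz := hconj _ _ (hsol x) (by simp [hA0]) t ht hx
      have hd := ((hsol x).deriv 0 (by simp))
      have hd0 : HasDerivWithinAt (fun t => A t x) 0 (Icc 0 1) 0 :=
        (hasDerivWithinAt_const 0 (Icc (0 : ℝ) 1) (0 : E)).congr hz (hz 0 (by simp))
      have := (uniqueDiffOn_unit 0 (by simp)).eq_deriv _ hd hd0
      simpa [hB0] using this
    rw [ContinuousLinearMap.isUnit_iff_bijective]
    exact ⟨hi, (LinearMap.injective_iff_surjective (f := (A t : E →ₗ[ℝ] E))).mp hi⟩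
  set V : ℝ → E →L[ℝ] E := fun t => Ring.inverse (A t) with hVdef
  have hVA : ∀ t ∈ Ioc (0 : ℝ) 1, V t * A t = 1 := fun t ht => Ring.inverse_mul_cancel _ (hinj t ht)
  have hAV : ∀ t ∈ Ioc (0 : ℝ) 1, A t * V t = 1 := fun t ht => Ring.mul_inverse_cancel _ (hinj t ht)
  have hAV' : ∀ t ∈ Ioc (0 : ℝ) 1, ∀ x, A t (V t x) = x := fun t ht x => by
    simpa using congrArg (fun T : E →L[ℝ] E => T x) (hAV t ht)
  have hV : ∀ t ∈ Ioc (0 : ℝ) 1, HasDerivWithinAt V (-(V t * (B t * V t))) (Icc 0 1) t := by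
    intro t ht
    rw [← mul_assoc]
    exact hasDerivWithinAt_ringInverse (hA t ⟨ht.1.le, ht.2⟩) (hinj t ht)
  -- The Wronskian of two columns of `A` is constant because `S` is symmetric, and it vanishes at
  -- `0`. Evaluated at `V x`, `V y` it expresses the symmetry of `U = B V`.
  have hwron : ∀ x y, ∀ t ∈ Icc (0 : ℝ) 1, ⟪B t x, A t y⟫_ℝ - ⟪A t x, B t y⟫_ℝ = 0 := by
    intro x y t ht
    have := constant_of_has_deriv_right_zero (a := 0) (b := 1)
      (f := fun t => ⟪B t x, A t y⟫_ℝ - ⟪A t x, B t y⟫_ℝ)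
      (fun t ht => (((hsol x).deriv' t ht).continuousWithinAt.inner
          ((hsol y).deriv t ht).continuousWithinAt).sub
        (((hsol x).deriv t ht).continuousWithinAt.inner
          ((hsol y).deriv' t ht).continuousWithinAt)) (fun t ht => ?_) t ht
    · rw [this]; simp [hA0]
    · have ht' : t ∈ Icc (0 : ℝ) 1 := ⟨ht.1, ht.2.le⟩
      have := (((hsol x).deriv' t ht').inner ℝ ((hsol y).deriv t ht')).fun_sub
        (((hsol x).deriv t ht').inner ℝ ((hsol y).deriv' t ht'))
      refine ((this.mono (Icc_subset_Icc_left ht.1)).mono_of_mem_nhdsWithin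
        (Icc_mem_nhdsGE ht.2)).congr_deriv ?_
      rw [inner_neg_left, inner_neg_right, hsymm t ht']
      ring
  refine ⟨V, fun t => B t * V t, hV, fun t ht => ?_, fun t ht x y => ?_, fun t ht x hx => ?_, ?_⟩
  · refine ((hB t ⟨ht.1.le, ht.2⟩).mul (hV t ht)).congr_deriv ?_
    rw [neg_mul, mul_assoc, hAV t ht]
    simp only [mul_one, mul_neg, mul_assoc]
    abel
  · have h := hwron (V t x) (V t y) t ⟨ht.1.le, ht.2⟩
    rw [hAV' t ht, hAV' t ht] at h
    exact sub_eq_zero.mp h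
  · rw [← hAV' t ht x, hx, map_zero]
  · intro w w₀ hw0 hw
    have hmono : 𝓝[Ioc (0 : ℝ) 1] 0 ≤ 𝓝[Icc 0 1 \ {0}] 0 :=
      nhdsWithin_mono _ fun t ht => ⟨⟨ht.1.le, ht.2⟩, ht.1.ne'⟩
    have hmono' : 𝓝[Ioc (0 : ℝ) 1] 0 ≤ 𝓝[Icc 0 1] 0 := nhdsWithin_mono _ Ioc_subset_Icc_self
    have happly : ∀ {T : ℝ → E →L[ℝ] E} {T₀ : E →L[ℝ] E} {v : ℝ → E} {v₀ : E},
        Tendsto T (𝓝[Ioc 0 1] 0) (𝓝 T₀) → Tendsto v (𝓝[Ioc 0 1] 0) (𝓝 v₀) →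
          Tendsto (fun t => T t (v t)) (𝓝[Ioc 0 1] 0) (𝓝 (T₀ v₀)) := fun {T T₀ v v₀} hT hv =>
      (isBoundedBilinearMap_apply.continuous.tendsto (T₀, v₀)).comp (hT.prodMk_nhds hv)
    -- The inverse `V` of `A` is singular at `0`, but `V w = (A/t)⁻¹ (w/t)`, where `A/t → 1` and
    -- `w/t → w₀`. So `U w = B (V w)` has the limit `w₀`, and pairing it with `w → 0` gives zero.
    have h1 : Tendsto (fun t : ℝ => t⁻¹ • A t) (𝓝[Ioc 0 1] 0) (𝓝 1) := by
      have := (hasDerivWithinAt_iff_tendsto_slope.mp (hA 0 (by simp))).mono_left hmono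
      rw [hB0] at this
      refine this.congr fun t => ?_
      simp [slope, hA0]
    have h2 : Tendsto (fun t : ℝ => t⁻¹ • w t) (𝓝[Ioc 0 1] 0) (𝓝 w₀) := by
      refine ((hasDerivWithinAt_iff_tendsto_slope.mp hw).mono_left hmono).congr fun t => ?_
      simp [slope, hw0]
    have h3 : Tendsto (fun t : ℝ => Ring.inverse (t⁻¹ • A t)) (𝓝[Ioc 0 1] 0)
        (𝓝 (1 : E →L[ℝ] E)) := by
      have := (NormedRing.inverse_continuousAt (1 : (E →L[ℝ] E)ˣ)).tendsto.comp h1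
      rwa [Units.val_one, Ring.inverse_one] at this
    have h4 : Tendsto (fun t => V t (w t)) (𝓝[Ioc 0 1] 0) (𝓝 w₀) := by
      have := happly h3 h2
      refine (this.congr' ?_)
      filter_upwards [self_mem_nhdsWithin] with t ht
      have hu : IsUnit (t⁻¹ • A t) := by
        have := (hinj t ht).smul (Units.mk0 t⁻¹ (inv_ne_zero ht.1.ne'))
        simpa using this
      have hc := congrArg (fun T : E →L[ℝ] E => T (V t (w t))) (Ring.inverse_mul_cancel _ hu)
      simp only [mul_apply_eq_comp, smul_apply, one_apply_eq_self] at hc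
      rwa [hAV' t ht] at hc
    have h5 : Tendsto B (𝓝[Ioc 0 1] 0) (𝓝 1) := by
      have := (hB 0 (by simp)).continuousWithinAt.tendsto.mono_left hmono'
      rwa [hB0] at this
    have h6 : Tendsto w (𝓝[Ioc 0 1] 0) (𝓝 0) := by
      have := hw.continuousWithinAt.tendsto.mono_left hmono'
      rwa [hw0] at this
    simpa using (happly h5 h4).inner h6

end Riccati

end Finsler

namespace Finsler

/-! ### Positivity of the index integral by completing the square -/

section JacobiCondition

open Filter Topology MeasureTheory
open scoped InnerProductSpace

variable {E : Type*} [NormedAddCommGroup E] [InnerProductSpace ℝ E]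

theorem intervalIntegrable_inner_of_continuousOn {f h : ℝ → E} {a b : ℝ}
    (hf : IntervalIntegrable f volume a b) (hh : ContinuousOn h (uIcc a b)) :
    IntervalIntegrable (fun t => ⟪f t, h t⟫_ℝ) volume a b := by
  obtain ⟨K, hK⟩ := isCompact_uIcc.exists_bound_of_continuousOn hh
  rw [intervalIntegrable_iff] at hf ⊢
  refine (hf.norm.mul_const K).mono' (hf.aestronglyMeasurable.inner
    ((hh.mono uIoc_subset_uIcc).aestronglyMeasurable measurableSet_uIoc)) ?_
  refine (ae_restrict_iff' measurableSet_uIoc).mpr (Eventually.of_forall fun t ht => ?_)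
  exact (norm_inner_le_norm _ _).trans
    (mul_le_mul_of_nonneg_left (hK t (uIoc_subset_uIcc ht)) (norm_nonneg _))

/-- In the absence of conjugate points the index form is positive. -/
theorem integral_pos_of_no_conjugate [FiniteDimensional ℝ E] {S : ℝ → E →L[ℝ] E}
    (hS : ContinuousOn S (Icc 0 1))
    (hsymm : ∀ t ∈ Icc (0 : ℝ) 1, ∀ x y, ⟪S t x, y⟫_ℝ = ⟪x, S t y⟫_ℝ)
    (hconj : ∀ u u' : ℝ → E, JacobiSol S u u' → u 0 = 0 → ∀ b ∈ Ioc (0 : ℝ) 1, u b = 0 →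
      ∀ t ∈ Icc (0 : ℝ) 1, u t = 0)
    {w w' : ℝ → E} {w₀ : E} {Z : Set ℝ} (hZ : Z.Countable) (hw : ContinuousOn w (Icc 0 1))
    (hw' : ∀ t ∈ Ioo (0 : ℝ) 1 \ Z, HasDerivAt w (w' t) t)
    (hi : IntervalIntegrable w' volume 0 1)
    (hi2 : IntervalIntegrable (fun t => ‖w' t‖ ^ 2) volume 0 1)
    (h0 : w 0 = 0) (h1 : w 1 = 0) (hd0 : HasDerivWithinAt w w₀ (Icc 0 1) 0)
    (hne : ∃ t ∈ Icc (0 : ℝ) 1, w t ≠ 0) :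
    0 < ∫ t in (0 : ℝ)..1, (‖w' t‖ ^ 2 - ⟪S t (w t), w t⟫_ℝ) := by
  have : CompleteSpace E := FiniteDimensional.complete ℝ E
  obtain ⟨V, U, hV, hU, hUs, hVi, hlim⟩ := exists_riccati hS hsymm hconj
  obtain ⟨t₀, ht₀, hwt₀⟩ := hne
  have ht0 : t₀ ∈ Ioo (0 : ℝ) 1 :=
    ⟨ht₀.1.lt_of_ne fun h => hwt₀ (h ▸ h0), ht₀.2.lt_of_ne fun h => hwt₀ (h ▸ h1)⟩
  set φ : ℝ → ℝ := fun t => ‖w' t‖ ^ 2 - ⟪S t (w t), w t⟫_ℝ with hφ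
  have hφi : IntervalIntegrable φ volume 0 1 := by
    refine hi2.sub (ContinuousOn.intervalIntegrable ?_)
    rw [uIcc_of_le zero_le_one]
    exact (hS.clm_apply hw).inner hw
  -- The Riccati equation and the symmetry of `U` give `d/dt ⟪U w, w⟫ = φ - ‖r‖²` away from `Z`.
  set r : ℝ → E := fun t => w' t - U t (w t) with hr
  have hsubI : ∀ ε ∈ Ioo (0 : ℝ) 1, Icc ε 1 ⊆ Ioc 0 1 := fun ε hε t ht =>
    ⟨hε.1.trans_le ht.1, ht.2⟩
  have hUc : ∀ ε ∈ Ioo (0 : ℝ) 1, ContinuousOn U (Icc ε 1) := fun ε hε t ht =>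
    (hU t (hsubI ε hε ht)).continuousWithinAt.mono (Icc_subset_Icc_left hε.1.le)
  have hVc : ∀ ε ∈ Ioo (0 : ℝ) 1, ContinuousOn V (Icc ε 1) := fun ε hε t ht =>
    (hV t (hsubI ε hε ht)).continuousWithinAt.mono (Icc_subset_Icc_left hε.1.le)
  have hwc : ∀ ε ∈ Ioo (0 : ℝ) 1, ContinuousOn w (Icc ε 1) := fun ε hε =>
    hw.mono (Icc_subset_Icc_left hε.1.le)
  have hsubu : ∀ ε ∈ Ioo (0 : ℝ) 1, uIcc ε 1 ⊆ uIcc (0 : ℝ) 1 := fun ε hε => by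
    rw [uIcc_of_le hε.2.le, uIcc_of_le zero_le_one]
    exact Icc_subset_Icc_left hε.1.le
  have hri : ∀ ε ∈ Ioo (0 : ℝ) 1, IntervalIntegrable (fun t => ‖r t‖ ^ 2) volume ε 1 := by
    intro ε hε
    have hc : ContinuousOn (fun t => U t (w t)) (uIcc ε 1) := by
      rw [uIcc_of_le hε.2.le]
      exact (hUc ε hε).clm_apply (hwc ε hε)
    refine (((hi2.mono_set (hsubu ε hε)).sub ((intervalIntegrable_inner_of_continuousOn
      (hi.mono_set (hsubu ε hε)) hc).const_mul 2)).add
      (hc.norm.pow 2).intervalIntegrable).congr fun t _ => ?_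
    simp only [hr]
    rw [norm_sub_sq_real]
    rfl
  -- Integration starts at `ε > 0` because `U` need not extend to `0`. The boundary term at `1`
  -- vanishes since `w 1 = 0`; the one at `ε` tends to zero by `hlim`.
  have hFTC : ∀ ε ∈ Ioo (0 : ℝ) 1,
      ∫ t in ε..1, ‖r t‖ ^ 2 = (∫ t in ε..1, φ t) + ⟪U ε (w ε), w ε⟫_ℝ := by
    intro ε hε
    have hφε := hφi.mono_set (hsubu ε hε)
    have h := integral_eq_of_hasDerivAt_off_countable_of_le (fun t => ⟪U t (w t), w t⟫_ℝ)
      (fun t => φ t - ‖r t‖ ^ 2) hε.2.le hZ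
      (((hUc ε hε).clm_apply (hwc ε hε)).inner (hwc ε hε)) (fun t ht => ?_) (hφε.sub (hri ε hε))
    · rw [intervalIntegral.integral_sub hφε (hri ε hε), h1, inner_zero_right] at h
      linarith
    · have ht' : t ∈ Ioc (0 : ℝ) 1 := ⟨hε.1.trans ht.1.1, ht.1.2.le⟩
      have hn : Icc (0 : ℝ) 1 ∈ 𝓝 t := Icc_mem_nhds ht'.1 ht.1.2
      have hwt := hw' t ⟨⟨ht'.1, ht.1.2⟩, ht.2⟩
      refine ((((hU t ht').hasDerivAt hn).clm_apply hwt).inner ℝ hwt).congr_deriv ?_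
      simp only [hφ, hr, norm_sub_sq_real, sub_apply, neg_apply, mul_apply_eq_comp,
        inner_add_left, inner_sub_left, inner_neg_left]
      rw [hUs t ht' (U t (w t)), hUs t ht' (w' t), real_inner_self_eq_norm_sq,
        real_inner_comm (w' t)]
      ring
  by_contra! hneg
  -- For `ε < t₀` the integral over `[t₀, 1]` is at most that over `[ε, 1]`, whose limit as `ε → 0`
  -- is the index integral, assumed nonpositive.
  have hG : ∫ t in t₀..1, ‖r t‖ ^ 2 ≤ 0 := by
    have hK : Tendsto (fun ε => (∫ t in ε..1, φ t) + ⟪U ε (w ε), w ε⟫_ℝ) (𝓝[Ioc 0 1] 0)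
        (𝓝 ((∫ t in (0 : ℝ)..1, φ t) + 0)) := by
      refine Tendsto.add ?_ (hlim w w₀ h0 hd0)
      have := intervalIntegral.continuousOn_primitive_interval_left (μ := volume)
        (f := φ) (a := 0) (b := 1) (by
          rw [uIcc_of_le zero_le_one, integrableOn_Icc_iff_integrableOn_Ioc]
          exact (intervalIntegrable_iff_integrableOn_Ioc_of_le zero_le_one).mp hφi)
      rw [uIcc_of_le zero_le_one] at this
      exact (this 0 (by simp)).tendsto.mono_left (nhdsWithin_mono _ Ioc_subset_Icc_self)
    have : (𝓝[Ioc (0 : ℝ) 1] 0).NeBot := by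
      rw [nhdsWithin_Ioc_eq_nhdsGT one_pos]; infer_instance
    refine (ge_of_tendsto hK ?_).trans (by simpa using hneg)
    filter_upwards [self_mem_nhdsWithin, nhdsWithin_le_nhds (Iio_mem_nhds ht0.1)] with ε hε hε'
    have hε1 : ε ∈ Ioo (0 : ℝ) 1 := ⟨hε.1, (mem_Iio.mp hε').trans ht0.2⟩
    rw [← hFTC ε hε1]
    exact intervalIntegral.integral_mono_interval (mem_Iio.mp hε').le ht0.2.le le_rfl
      (Eventually.of_forall fun t => sq_nonneg _) (hri ε hε1)
  have hG0 : ∫ t in t₀..1, ‖r t‖ ^ 2 = 0 :=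
    le_antisymm hG (intervalIntegral.integral_nonneg ht0.2.le fun t _ => sq_nonneg _)
  have hr0 : r =ᵐ[volume.restrict (Ioc t₀ 1)] 0 := by
    have := (intervalIntegral.integral_eq_zero_iff_of_le_of_nonneg_ae ht0.2.le
      (Eventually.of_forall fun t => sq_nonneg _) (hri t₀ ht0)).mp hG0
    filter_upwards [this] with t ht
    simpa using ht
  have hVr : (fun t => V t (r t)) =ᵐ[volume.restrict (Ioc t₀ 1)] 0 := by
    filter_upwards [hr0] with t ht
    simp [ht]
  -- Away from `Z` the derivative of `V w` is `V (w' - U w) = V r`, zero almost everywhere. So `V w`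
  -- takes the same value at `t₀` as at `1`, namely zero, and injectivity of `V t₀` contradicts `w
  -- t₀ ≠ 0`.
  have hz := integral_eq_of_hasDerivAt_off_countable_of_le (fun t => V t (w t))
    (fun t => V t (r t)) ht0.2.le hZ ((hVc t₀ ht0).clm_apply (hwc t₀ ht0)) (fun t ht => ?_)
    ((intervalIntegrable_iff_integrableOn_Ioc_of_le ht0.2.le).mpr
      ((integrable_zero _ _ _).congr hVr.symm))
  · rw [intervalIntegral.integral_of_le ht0.2.le, integral_congr_ae hVr, h1, map_zero] at hz
    refine hwt₀ (hVi t₀ ⟨ht0.1, ht0.2.le⟩ _ ?_)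
    simpa using hz.symm
  · have ht' : t ∈ Ioc (0 : ℝ) 1 := ⟨ht0.1.trans ht.1.1, ht.1.2.le⟩
    have hn : Icc (0 : ℝ) 1 ∈ 𝓝 t := Icc_mem_nhds ht'.1 ht.1.2
    refine (((hV t ht').hasDerivAt hn).clm_apply
      (hw' t ⟨⟨ht'.1, ht.1.2⟩, ht.2⟩)).congr_deriv ?_
    simp only [hr, neg_apply, mul_apply_eq_comp, map_sub]
    abel

end JacobiCondition

end Finsler

namespace Finsler

/-! ### The fundamental tensor as an inner product and its derivative along the spray -/

section Metric

variable {n : ℕ} {f : Coord n × Coord n → ℝ} {O : Set (Coord n)} {p : Coord n × Coord n}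

/-- The fundamental tensor as a bilinear form on `ℝⁿ`. -/
noncomputable def gBilin (f : Coord n × Coord n → ℝ) (p : Coord n × Coord n) :
    LinearMap.BilinForm ℝ (Coord n) :=
  LinearMap.mk₂ ℝ (gForm f p)
    (fun u v w => by
      simp only [gForm, PiLp.add_apply, mul_add, add_mul, Finset.sum_add_distrib])
    (fun a u v => by
      simp only [gForm, PiLp.smul_apply, smul_eq_mul, Finset.mul_sum]
      exact Finset.sum_congr rfl fun i _ => Finset.sum_congr rfl fun j _ => by ring)
    (fun u v w => by
      simp only [gForm, PiLp.add_apply, mul_add, Finset.sum_add_distrib])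
    (fun a u v => by
      simp only [gForm, PiLp.smul_apply, smul_eq_mul, Finset.mul_sum]
      exact Finset.sum_congr rfl fun i _ => Finset.sum_congr rfl fun j _ => by ring)

theorem gBilin_apply (u v : Coord n) : gBilin f p u v = gForm f p u v := rfl

theorem isLinearMap_jac (f : Coord n × Coord n → ℝ) (p : Coord n × Coord n) :
    IsLinearMap ℝ (jac f p) where
  map_add u v := by
    ext i
    simp only [jac, PiLp.add_apply, mul_add, Finset.sum_add_distrib]
  map_smul a u := by
    ext i
    simp only [jac, PiLp.smul_apply, smul_eq_mul, Finset.mul_sum]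
    exact Finset.sum_congr rfl fun j _ => by ring

/-- `R^i_{jk}` is antisymmetric in `j, k`, so its contraction with `yʲ yᵏ` equals its own negative.
-/
theorem jac_self (f : Coord n × Coord n → ℝ) (p : Coord n × Coord n) : jac f p p.2 = 0 := by
  ext i
  simp only [jac, jacobiCoeff, PiLp.zero_apply, Finset.sum_mul]
  have h : ∑ k, ∑ j, RN f i j k p * p.2 j * p.2 k =
      -∑ k, ∑ j, RN f i j k p * p.2 j * p.2 k := by
    conv_lhs => rw [Finset.sum_comm]
    simp only [← Finset.sum_neg_distrib]
    exact Finset.sum_congr rfl fun k _ => Finset.sum_congr rfl fun j _ => by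
      simp only [RN]; ring
  linarith

/-- A positive definite symmetric bilinear form on `ℝⁿ` has an orthonormal family of `n` vectors. -/
theorem exists_orthonormal_family (B : LinearMap.BilinForm ℝ (Coord n))
    (hs : ∀ u v, B u v = B v u) (hB : ∀ u, u ≠ 0 → 0 < B u u) :
    ∃ v : Fin n → Coord n, ∀ i j, B (v i) (v j) = if i = j then 1 else 0 := by
  obtain ⟨b, hb⟩ := LinearMap.BilinForm.exists_orthogonal_basis (B := B) ⟨hs⟩
  have hn : Module.finrank ℝ (Coord n) = n := by simp
  have hpos : ∀ i, 0 < B (b i) (b i) := fun i => hB _ (b.ne_zero i)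
  refine ⟨fun i => (√(B (b (Fin.cast hn.symm i)) (b (Fin.cast hn.symm i))))⁻¹ •
    b (Fin.cast hn.symm i), fun i j => ?_⟩
  simp only [map_smul, LinearMap.smul_apply, smul_eq_mul]
  split_ifs with hij
  · subst hij
    have h := hpos (Fin.cast hn.symm i)
    have h2 := Real.mul_self_sqrt h.le
    have h3 := (Real.sqrt_pos.mpr h).ne'
    field_simp
    rw [pow_two, h2]
  · have : B (b (Fin.cast hn.symm i)) (b (Fin.cast hn.symm j)) = 0 :=
      hb (fun h => hij (Fin.cast_injective _ h))
    simp [this]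

/-- The covariant derivative along an integral curve of the spray is compatible with the
fundamental tensor. -/
theorem IsLocal.hasDerivWithinAt_gForm (H : IsLocal f O) {γ : ℝ → Coord n × Coord n}
    {x y : ℝ → Coord n} {x' y' : Coord n} {S : Set ℝ} {s : ℝ} (hp : γ s ∈ slit O)
    (hγ : HasDerivWithinAt γ (sprayField f (γ s)) S s) (hx : HasDerivWithinAt x x' S s)
    (hy : HasDerivWithinAt y y' S s) :
    HasDerivWithinAt (fun t => gForm f (γ t) (x t) (y t))
      (gForm f (γ s) (x' + conn f (γ s) (x s)) (y s) +
        gForm f (γ s) (x s) (y' + conn f (γ s) (y s))) S s := by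
  have hg : ∀ i j, HasDerivWithinAt (fun t => g f i j (γ t)) (sprayDeriv f (g f i j) (γ s)) S s :=
    fun i j => (((H.smooth_g i j _ hp).differentiableAt
      (by simp)).hasFDerivAt.comp_hasDerivWithinAt s hγ).congr_deriv rfl
  have hxi : ∀ i, HasDerivWithinAt (fun t => x t i) (x' i) S s := fun i =>
    (EuclideanSpace.proj i : Coord n →L[ℝ] ℝ).hasFDerivAt.comp_hasDerivWithinAt s hx
  have hyi : ∀ i, HasDerivWithinAt (fun t => y t i) (y' i) S s := fun i =>
    (EuclideanSpace.proj i : Coord n →L[ℝ] ℝ).hasFDerivAt.comp_hasDerivWithinAt s hy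
  have h : HasDerivWithinAt (fun t => gForm f (γ t) (x t) (y t)) _ S s :=
    HasDerivWithinAt.fun_sum fun i _ => HasDerivWithinAt.fun_sum fun j _ =>
      ((hg i j).fun_mul (hxi i)).fun_mul (hyi j)
  refine h.congr_deriv ?_
  have e1 : ∑ i, ∑ j, (∑ k, g f i k (γ s) * N f k j (γ s)) * x s i * y s j =
      gForm f (γ s) (x s) (conn f (γ s) (y s)) := by
    simp only [gForm, H.conn_apply hp, Finset.mul_sum, Finset.sum_mul]
    refine Finset.sum_congr rfl fun i _ => ?_
    rw [Finset.sum_comm]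
    exact Finset.sum_congr rfl fun k _ => Finset.sum_congr rfl fun j _ => by ring
  have e2 : ∑ i, ∑ j, (∑ k, g f j k (γ s) * N f k i (γ s)) * x s i * y s j =
      gForm f (γ s) (conn f (γ s) (x s)) (y s) := by
    rw [H.gForm_symm hp]
    simp only [gForm, H.conn_apply hp, Finset.mul_sum, Finset.sum_mul]
    rw [Finset.sum_comm]
    refine Finset.sum_congr rfl fun j _ => ?_
    rw [Finset.sum_comm]
    exact Finset.sum_congr rfl fun k _ => Finset.sum_congr rfl fun i _ => by ring
  simp only [← gBilin_apply, map_add, LinearMap.add_apply]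
  simp only [gBilin_apply, ← e1, ← e2]
  simp only [gForm, ← Finset.sum_add_distrib]
  refine Finset.sum_congr rfl fun i _ => Finset.sum_congr rfl fun j _ => ?_
  rw [H.sprayDeriv_g hp]
  ring

theorem IsLocal.contDiffWithinAt_gForm (H : IsLocal f O) {γ : ℝ → Coord n × Coord n}
    {x y : ℝ → Coord n} {S : Set ℝ} {s : ℝ} (hp : γ s ∈ slit O)
    (hγ : ContDiffWithinAt ℝ ∞ γ S s) (hx : ContDiffWithinAt ℝ ∞ x S s)
    (hy : ContDiffWithinAt ℝ ∞ y S s) :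
    ContDiffWithinAt ℝ ∞ (fun t => gForm f (γ t) (x t) (y t)) S s :=
  ContDiffWithinAt.sum fun i _ => ContDiffWithinAt.sum fun j _ =>
    (((H.smooth_g i j _ hp).comp_contDiffWithinAt s hγ).mul
      (contDiffWithinAt_euclidean.mp hx i)).mul (contDiffWithinAt_euclidean.mp hy j)

theorem IsLocal.continuousWithinAt_gForm (H : IsLocal f O) {γ : ℝ → Coord n × Coord n}
    {x y : ℝ → Coord n} {S : Set ℝ} {s : ℝ} (hp : γ s ∈ slit O)
    (hγ : ContinuousWithinAt γ S s) (hx : ContinuousWithinAt x S s)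
    (hy : ContinuousWithinAt y S s) :
    ContinuousWithinAt (fun t => gForm f (γ t) (x t) (y t)) S s :=
  tendsto_finsetSum _ fun i _ => tendsto_finsetSum _ fun j _ =>
    (((H.smooth_g i j _ hp).continuousAt.comp_continuousWithinAt hγ).mul
      ((EuclideanSpace.proj i : Coord n →L[ℝ] ℝ).continuous.continuousAt.comp_continuousWithinAt
        hx)).mul ((EuclideanSpace.proj j : Coord n →L[ℝ] ℝ).continuous.continuousAt
          |>.comp_continuousWithinAt hy)

end Metric

end Finsler

namespace Finsler

/-! ### Parallel fields along a geodesic -/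

section Parallel

open Filter Topology

variable {n : ℕ} {M : Type*} [TopologicalSpace M] [ChartedSpace (Coord n) M]
  [IsManifold (𝓡 n) ∞ M] {F : TangentBundle (𝓡 n) M → ℝ} {c : ℝ → M} {s : ℝ}

/-- The field `X` along `c` is smooth at the parameter `s`. -/
def SmoothFieldAt (c : ℝ → M) (X : ∀ t, TangentSpace (𝓡 n) (c t)) (s : ℝ) : Prop :=
  ContMDiffWithinAt 𝓘(ℝ, ℝ) (𝓡 n).tangent ∞
    (fun t => (⟨c t, X t⟩ : TangentBundle (𝓡 n) M)) (Icc 0 1) s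

/-- The field `X` along `c` is smooth and parallel at the parameter `s`. -/
def IsParallelAt (F : TangentBundle (𝓡 n) M → ℝ) (c : ℝ → M)
    (X : ∀ t, TangentSpace (𝓡 n) (c t)) (s : ℝ) : Prop :=
  SmoothFieldAt c X s ∧ covDeriv F c X s = 0

theorem comp_congr {q : M} {X Y : ∀ t, TangentSpace (𝓡 n) (c t)} {t : ℝ} (h : X t = Y t) :
    comp c q X t = comp c q Y t := by
  rw [comp, comp, h]

theorem SmoothFieldAt.congr {X Y : ∀ t, TangentSpace (𝓡 n) (c t)} (hX : SmoothFieldAt c X s)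
    (hs : s ∈ Icc (0 : ℝ) 1) (h : ∀ᶠ t in 𝓝[Icc 0 1] s, X t = Y t) : SmoothFieldAt c Y s := by
  refine ContMDiffWithinAt.congr_of_eventuallyEq hX ?_ ?_
  · filter_upwards [h] with t ht
    rw [ht]
  · rw [h.self_of_nhdsWithin hs]

variable (hc : IsGeodesic F c) (hs : s ∈ Icc (0 : ℝ) 1) (hF : IsFinsler F)
include hc hs

theorem IsGeodesic.smoothFieldAt_iff {q : M} (hq : c s ∈ (extChartAt (𝓡 n) q).source)
    (X : ∀ t, TangentSpace (𝓡 n) (c t)) :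
    SmoothFieldAt c X s ↔ ContDiffWithinAt ℝ ∞ (comp c q X) (Icc 0 1) s :=
  contMDiffWithinAt_field_iff (hc.1.1 s hs) hq X

theorem IsGeodesic.differentiableWithinAt_comp {X : ∀ t, TangentSpace (𝓡 n) (c t)}
    (hX : SmoothFieldAt c X s) :
    DifferentiableWithinAt ℝ (comp c (c s) X) (Icc 0 1) s :=
  ((hc.smoothFieldAt_iff hs (mem_extChartAt_source _) X).mp hX).differentiableWithinAt (by simp)

include hF

/-- The covariant derivative depends only on the germ of the field relative to the unit interval, so
values outside it are irrelevant. -/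
theorem IsGeodesic.covDeriv_congr {X Y : ∀ t, TangentSpace (𝓡 n) (c t)}
    (h : ∀ᶠ t in 𝓝[Icc 0 1] s, X t = Y t) : covDeriv F c X s = covDeriv F c Y s := by
  apply toChart_injective (mem_extChartAt_source (I := 𝓡 n) (c s))
  have h1 : comp c (c s) X =ᶠ[𝓝[Icc 0 1] s] comp c (c s) Y := h.mono fun t ht => comp_congr ht
  have h2 : comp c (c s) X s = comp c (c s) Y s := h1.self_of_nhdsWithin hs
  rw [hc.toChart_covDeriv_self hs hF, hc.toChart_covDeriv_self hs hF, h1.derivWithin_eq h2, h2]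

theorem IsGeodesic.comp_covDeriv_self (X : ∀ t, TangentSpace (𝓡 n) (c t)) :
    comp c (c s) (covDeriv F c X) s = derivWithin (comp c (c s) X) (Icc 0 1) s +
      conn (inCoord F (c s)) (chartLift c (c s) s) (comp c (c s) X s) :=
  hc.toChart_covDeriv_self hs hF X

omit hs in
theorem IsGeodesic.eventually_scalar_eq {q : M} {S : Set ℝ} (hS : S ⊆ Icc 0 1)
    (hs : s ∈ Icc (0 : ℝ) 1) (hq : c s ∈ (extChartAt (𝓡 n) q).source)
    (X Y : ∀ t, TangentSpace (𝓡 n) (c t)) :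
    scalar F c X Y =ᶠ[𝓝[S] s]
      fun t => gForm (inCoord F q) (chartLift c q t) (comp c q X t) (comp c q Y t) := by
  filter_upwards [nhdsWithin_mono _ hS (eventually_mem_source (hc.1.1 s hs) hq),
    self_mem_nhdsWithin] with t ht hts
  exact hc.scalar_eq (hS hts) ht hF X Y

/-- The covariant derivative along a geodesic is compatible with the metric. -/
theorem IsGeodesic.hasDerivWithinAt_scalar {X Y : ∀ t, TangentSpace (𝓡 n) (c t)}
    (hX : DifferentiableWithinAt ℝ (comp c (c s) X) (Icc 0 1) s)
    (hY : DifferentiableWithinAt ℝ (comp c (c s) Y) (Icc 0 1) s) :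
    HasDerivWithinAt (scalar F c X Y)
      (scalar F c (covDeriv F c X) Y s + scalar F c X (covDeriv F c Y) s) (Icc 0 1) s := by
  have hq := mem_extChartAt_source (I := 𝓡 n) (c s)
  have h := (hF.isLocal (c s)).hasDerivWithinAt_gForm (hc.1.chartLift_mem hs hq)
    (hc.hasDerivWithinAt_chartLift hs hq hF) hX.hasDerivWithinAt hY.hasDerivWithinAt
  rw [hc.scalar_eq hs hq hF, hc.scalar_eq hs hq hF, hc.comp_covDeriv_self hs hF,
    hc.comp_covDeriv_self hs hF]
  exact h.congr_of_eventuallyEq (hc.eventually_scalar_eq hF subset_rfl hs hq X Y)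
    (hc.scalar_eq hs hq hF X Y)

omit hs in
/-- Local existence of parallel fields. -/
theorem IsGeodesic.exists_parallel_local {t₀ : ℝ} (ht₀ : t₀ ∈ Icc (0 : ℝ) 1) :
    ∃ r > 0, ∀ s ∈ Icc (0 : ℝ) 1, |s - t₀| < r → ∀ x : Coord n,
      ∃ X : ∀ t, TangentSpace (𝓡 n) (c t), X s = x ∧
        ∀ t ∈ Icc (0 : ℝ) 1, |t - t₀| < r → IsParallelAt F c X t := by
  set q := c t₀ with hq
  obtain ⟨ρ, hρ, hρs⟩ := Metric.mem_nhdsWithin_iff.mp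
    (eventually_mem_source (hc.1.1 t₀ ht₀) (mem_extChartAt_source (I := 𝓡 n) (c t₀)))
  have hsrc : ∀ t ∈ Icc (0 : ℝ) 1, |t - t₀| < ρ → c t ∈ (extChartAt (𝓡 n) q).source :=
    fun t ht htr => hρs ⟨by simpa [Real.dist_eq] using htr, ht⟩
  -- In the single chart at `q = c t₀`, the parallel equation is the linear equation `x' = -N(c, ċ)
  -- x` with smooth coefficients.
  set A : ℝ → Coord n →L[ℝ] Coord n := fun t => -conn (inCoord F q) (chartLift c q t) with hA
  have hAs : ∀ t ∈ Icc (0 : ℝ) 1, |t - t₀| < ρ → ContDiffWithinAt ℝ ∞ A (Icc 0 1) t :=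
    fun t ht htr => (((hF.isLocal q).contDiffAt_conn
      (hc.1.chartLift_mem ht (hsrc t ht htr))).comp_contDiffWithinAt t
        (hc.1.contDiffWithinAt_chartLift ht (hsrc t ht htr))).neg
  obtain ⟨r₁, hr₁, hex⟩ := linear_ode_exists_local (A := A) ht₀ (by
    filter_upwards [self_mem_nhdsWithin, nhdsWithin_le_nhds (Metric.ball_mem_nhds t₀ hρ)]
      with t ht htr
    exact (hAs t ht (by simpa [Real.dist_eq] using htr)).continuousWithinAt)
  refine ⟨min ρ r₁, lt_min hρ hr₁, fun s hs hsr x => ?_⟩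
  obtain ⟨f, hfs, hf⟩ := hex s hs (hsr.trans_le (min_le_right _ _))
    (toChart (n := n) q (c s) (x : TangentSpace (𝓡 n) (c s)))
  refine ⟨fun t => fromChart q (c t) (f t), ?_, fun t ht htr => ?_⟩
  · change fromChart q (c s) (f s) = _
    rw [hfs]
    exact fromChart_toChart (hsrc s hs (hsr.trans_le (min_le_left _ _))) _
  set K : Set ℝ := Icc 0 1 ∩ Metric.ball t₀ (min ρ r₁) with hK
  have hKu : UniqueDiffOn ℝ K := uniqueDiffOn_unit.inter Metric.isOpen_ball
  have hKmem : ∀ t ∈ K, t ∈ Icc (0 : ℝ) 1 ∧ |t - t₀| < ρ ∧ |t - t₀| < r₁ := fun t ht =>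
    ⟨ht.1, lt_min_iff.mp (by simpa [Real.dist_eq] using ht.2)⟩
  have htK : t ∈ K := ⟨ht, by simpa [Real.dist_eq] using htr⟩
  have hKn : K ∈ 𝓝[Icc 0 1] t :=
    inter_mem self_mem_nhdsWithin (nhdsWithin_le_nhds (Metric.isOpen_ball.mem_nhds htK.2))
  have hfK : ContDiffOn ℝ ∞ f K := linear_ode_contDiffOn hKu (A := A)
    (fun t ht => (hAs t (hKmem t ht).1 (hKmem t ht).2.1).mono inter_subset_left)
    (fun t ht => (hf t (hKmem t ht).1 (hKmem t ht).2.2).mono inter_subset_left)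
  have hcomp : ∀ t ∈ K, comp c q (fun t => fromChart q (c t) (f t)) t = f t := fun t ht =>
    toChart_fromChart (hsrc t (hKmem t ht).1 (hKmem t ht).2.1) (f t)
  have hev : comp c q (fun t => fromChart q (c t) (f t)) =ᶠ[𝓝[Icc 0 1] t] f :=
    eventually_of_mem hKn hcomp
  have hqt := hsrc t ht (hKmem t htK).2.1
  have hd := (hf t ht (hKmem t htK).2.2).congr_of_eventuallyEq hev (hcomp t htK)
  refine ⟨(hc.smoothFieldAt_iff ht hqt _).mpr
    (((hfK t htK).mono_of_mem_nhdsWithin hKn).congr_of_eventuallyEq hev (hcomp t htK)), ?_⟩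
  apply toChart_injective hqt
  rw [hc.toChart_covDeriv ht hqt hF hd.differentiableWithinAt,
    hd.derivWithin (uniqueDiffOn_unit t ht), hcomp t htK, map_zero, hA, neg_apply,
    neg_add_cancel]

omit hs in
/-- The scalar product of two parallel fields is constant. -/
theorem IsGeodesic.scalar_const {X Y : ∀ t, TangentSpace (𝓡 n) (c t)} {S : Set ℝ}
    (hS : Convex ℝ S) (hX : ∀ t ∈ S ∩ Icc 0 1, IsParallelAt F c X t)
    (hY : ∀ t ∈ S ∩ Icc 0 1, IsParallelAt F c Y t) {s t : ℝ} (hs : s ∈ S ∩ Icc 0 1)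
    (ht : t ∈ S ∩ Icc 0 1) : scalar F c X Y t = scalar F c X Y s := by
  have h : ∀ r ∈ S ∩ Icc 0 1, HasDerivWithinAt (scalar F c X Y) 0 (S ∩ Icc 0 1) r := by
    intro r hr
    have := hc.hasDerivWithinAt_scalar hr.2 hF (hc.differentiableWithinAt_comp hr.2 (hX r hr).1)
      (hc.differentiableWithinAt_comp hr.2 (hY r hr).1)
        |>.mono (show S ∩ Icc 0 1 ⊆ Icc 0 1 from inter_subset_right)
    refine this.congr_deriv ?_
    have hq := mem_extChartAt_source (I := 𝓡 n) (c r)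
    rw [hc.scalar_eq hr.2 hq hF, hc.scalar_eq hr.2 hq hF, comp_eq_toChart, comp_eq_toChart,
      comp_eq_toChart, comp_eq_toChart, (hX r hr).2, (hY r hr).2]
    simp [← gBilin_apply]
  have h2 := Convex.norm_image_sub_le_of_norm_hasDerivWithin_le (C := 0) h (fun _ _ => by simp)
    (hS.inter (convex_Icc 0 1)) hs ht
  rw [zero_mul, norm_le_zero_iff, sub_eq_zero] at h2
  exact h2

-- The products `g(X,X)`, `g(X,Y)`, `g(Y,Y)` are constant and coincide at `s`, so expanding `g(X -
-- Y, X - Y)` at `t` gives zero; positive definiteness concludes.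
omit hs in
theorem IsGeodesic.parallel_unique {X Y : ∀ t, TangentSpace (𝓡 n) (c t)} {S : Set ℝ}
    (hS : Convex ℝ S) (hX : ∀ t ∈ S ∩ Icc 0 1, IsParallelAt F c X t)
    (hY : ∀ t ∈ S ∩ Icc 0 1, IsParallelAt F c Y t) {s t : ℝ} (hs : s ∈ S ∩ Icc 0 1)
    (ht : t ∈ S ∩ Icc 0 1) (hst : X s = Y s) : X t = Y t := by
  have e := fun {X Y : ∀ t, TangentSpace (𝓡 n) (c t)} hX hY =>
    hc.scalar_const hF (X := X) (Y := Y) hS hX hY hs ht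
  have hqt := mem_extChartAt_source (I := 𝓡 n) (c t)
  have hqs := mem_extChartAt_source (I := 𝓡 n) (c s)
  have h1 := e hX hX
  have h2 := e hX hY
  have h3 := e hY hY
  have hcs : comp c (c s) X s = comp c (c s) Y s := comp_congr (c := c) hst
  rw [hc.scalar_eq ht.2 hqt hF, hc.scalar_eq hs.2 hqs hF, hcs] at h1 h2
  rw [hc.scalar_eq ht.2 hqt hF, hc.scalar_eq hs.2 hqs hF] at h3
  by_contra hne
  have hp := hc.1.chartLift_mem ht.2 hqt
  have hpos := (hF.isLocal (c t)).posDef _ hp (comp c (c t) X t - comp c (c t) Y t)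
    (sub_ne_zero.mpr fun h => hne (toChart_injective hqt h))
  have hz : gBilin (inCoord F (c t)) (chartLift c (c t) t)
      (comp c (c t) X t - comp c (c t) Y t) (comp c (c t) X t - comp c (c t) Y t) = 0 := by
    simp only [map_sub, LinearMap.sub_apply, gBilin_apply]
    rw [(hF.isLocal (c t)).gForm_symm hp (comp c (c t) Y t) (comp c (c t) X t), h1, h2, h3]
    ring
  exact hpos.ne' hz

omit hs in
theorem IsGeodesic.exists_parallel (v : Coord n) :
    ∃ X : ∀ t, TangentSpace (𝓡 n) (c t), X 0 = v ∧
      ∀ t ∈ Icc (0 : ℝ) 1, IsParallelAt F c X t := by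
  have h := exists_global_solution (α := Coord n)
    (fun (X : ℝ → Coord n) t => IsParallelAt F c (fun t => (X t : TangentSpace (𝓡 n) (c t))) t)
    (fun X Y t ht hXY hX => ⟨hX.1.congr ht hXY, by
      rw [← hX.2]; exact (hc.covDeriv_congr ht hF hXY).symm⟩)
    (fun t₀ ht₀ => hc.exists_parallel_local hF ht₀) (fun a b X Y hXY s hs hsab hst t ht htab =>
      hc.parallel_unique hF (X := X) (Y := Y) (convex_Ioo a b) (fun t ht => (hXY t ht.2 ht.1).1)
        (fun t ht => (hXY t ht.2 ht.1).2) ⟨hsab, hs⟩ ⟨htab, ht⟩ hst) v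
  exact h

end Parallel

end Finsler

namespace Finsler

/-! ### Parallel orthonormal frames -/

section Frame

open Filter Topology
open scoped InnerProductSpace

/-- Pairing with the family recovers coefficients, so the combination map on `ℝⁿ` is injective,
hence surjective by dimension. -/
theorem orthonormal_family_expand {n : ℕ} (B : LinearMap.BilinForm ℝ (Coord n))
    {x : Fin n → Coord n} (hx : ∀ i j, B (x i) (x j) = if i = j then 1 else 0) (y : Coord n) :
    ∑ i, B y (x i) • x i = y := by
  have key : ∀ (a : Coord n) i, B (∑ j, a j • x j) (x i) = a i := fun a i => by
    simp [map_sum, LinearMap.sum_apply, hx]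
  let T : Coord n →ₗ[ℝ] Coord n :=
    ∑ j, ((EuclideanSpace.proj j : Coord n →L[ℝ] ℝ) : Coord n →ₗ[ℝ] ℝ).smulRight (x j)
  have hT : ∀ a, T a = ∑ j, a j • x j := fun a => by simp [T, LinearMap.sum_apply]
  have hinj : Function.Injective T := by
    rw [injective_iff_map_eq_zero]
    intro a ha
    ext i
    rw [← key a i, ← hT, ha]
    simp
  obtain ⟨a, rfl⟩ := LinearMap.injective_iff_surjective.mp hinj y
  rw [hT]
  exact Finset.sum_congr rfl fun i _ => by rw [key]

variable {n : ℕ} {M : Type*} [TopologicalSpace M] [ChartedSpace (Coord n) M]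
  [IsManifold (𝓡 n) ∞ M] {F : TangentBundle (𝓡 n) M → ℝ} {c : ℝ → M} {s : ℝ}

/-- `X` is a parallel orthonormal frame along `c`. -/
structure IsParallelFrame (F : TangentBundle (𝓡 n) M → ℝ) (c : ℝ → M)
    (X : Fin n → ∀ t, TangentSpace (𝓡 n) (c t)) : Prop where
  parallel : ∀ i, ∀ t ∈ Icc (0 : ℝ) 1, IsParallelAt F c (X i) t
  orthonormal : ∀ i j, ∀ t ∈ Icc (0 : ℝ) 1, scalar F c (X i) (X j) t = if i = j then 1 else 0

/-- An orthonormal basis at `c 0` is transported in parallel; it stays orthonormal because scalar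
products of parallel fields are constant. -/
theorem IsGeodesic.exists_parallelFrame (hc : IsGeodesic F c) (hF : IsFinsler F) :
    ∃ X : Fin n → ∀ t, TangentSpace (𝓡 n) (c t), IsParallelFrame F c X := by
  have h0 : (0 : ℝ) ∈ Icc (0 : ℝ) 1 := by simp
  have hq := mem_extChartAt_source (I := 𝓡 n) (c 0)
  have hp := hc.1.chartLift_mem h0 hq
  have H := hF.isLocal (n := n) (c 0)
  obtain ⟨v, hv⟩ := exists_orthonormal_family (gBilin (inCoord F (c 0)) (chartLift c (c 0) 0))
    (H.gForm_symm hp) (H.posDef _ hp)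
  choose X hX0 hX using fun i => hc.exists_parallel hF (fromChart (n := n) (c 0) (c 0) (v i))
  refine ⟨X, hX, fun i j t ht => ?_⟩
  rw [hc.scalar_const hF (S := univ) convex_univ (fun t ht => hX i t ht.2) (fun t ht => hX j t ht.2)
    ⟨mem_univ 0, h0⟩ ⟨mem_univ t, ht⟩, hc.scalar_eq h0 hq hF, ← hv i j, gBilin_apply]
  have e : ∀ i, comp c (c 0) (X i) 0 = v i := fun i => by
    rw [comp_eq_toChart, hX0 i]
    exact toChart_fromChart hq (v i)
  rw [e, e]

/-- The field with components `uⁱ` in the frame `X`. -/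
noncomputable def frameField {c : ℝ → M} (X : Fin n → ∀ t, TangentSpace (𝓡 n) (c t))
    (u : ℝ → Coord n) : ∀ t, TangentSpace (𝓡 n) (c t) := fun t => ∑ i, u t i • X i t

/-- The components of a field in an orthonormal frame. -/
noncomputable def frameCoord (F : TangentBundle (𝓡 n) M → ℝ) (c : ℝ → M)
    (X : Fin n → ∀ t, TangentSpace (𝓡 n) (c t)) (Y : ∀ t, TangentSpace (𝓡 n) (c t)) (t : ℝ) :
    Coord n := WithLp.toLp 2 fun i => scalar F c Y (X i) t

theorem frameCoord_apply (X : Fin n → ∀ t, TangentSpace (𝓡 n) (c t))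
    (Y : ∀ t, TangentSpace (𝓡 n) (c t)) (t : ℝ) (i : Fin n) :
    frameCoord F c X Y t i = scalar F c Y (X i) t := rfl

theorem frameCoord_congr (X : Fin n → ∀ t, TangentSpace (𝓡 n) (c t))
    {Y Z : ∀ t, TangentSpace (𝓡 n) (c t)} (h : Y s = Z s) :
    frameCoord F c X Y s = frameCoord F c X Z s := by
  ext i
  rw [frameCoord_apply, frameCoord_apply, scalar, scalar, h]

omit [IsManifold (𝓡 n) ∞ M] in
theorem frameField_eq_zero (X : Fin n → ∀ t, TangentSpace (𝓡 n) (c t))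
    {u : ℝ → Coord n} (h : u s = 0) : frameField X u s = 0 := by
  simp [frameField, h]

theorem comp_frameField (q : M) (X : Fin n → ∀ t, TangentSpace (𝓡 n) (c t))
    (u : ℝ → Coord n) (t : ℝ) :
    comp c q (frameField X u) t = ∑ i, u t i • comp c q (X i) t := by
  simp only [comp_eq_toChart, frameField, map_sum, map_smul]

variable {X : Fin n → ∀ t, TangentSpace (𝓡 n) (c t)} (hX : IsParallelFrame F c X)
  (hc : IsGeodesic F c) (hF : IsFinsler F) (hs : s ∈ Icc (0 : ℝ) 1)
include hX hc hF hs

theorem IsParallelFrame.gBilin_comp (i j : Fin n) :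
    gBilin (inCoord F (c s)) (chartLift c (c s) s) (comp c (c s) (X i) s) (comp c (c s) (X j) s) =
      if i = j then 1 else 0 := by
  rw [← hX.orthonormal i j s hs, hc.scalar_eq hs (mem_extChartAt_source _) hF, gBilin_apply]

theorem IsParallelFrame.scalar_frameField (u v : ℝ → Coord n) :
    scalar F c (frameField X u) (frameField X v) s = ⟪u s, v s⟫_ℝ := by
  rw [hc.scalar_eq hs (mem_extChartAt_source _) hF, ← gBilin_apply, comp_frameField,
    comp_frameField]
  simp [map_sum, LinearMap.sum_apply, hX.gBilin_comp hc hF hs, PiLp.inner_apply, mul_comm]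

theorem IsParallelFrame.frameCoord_frameField (u : ℝ → Coord n) :
    frameCoord F c X (frameField X u) s = u s := by
  ext i
  rw [frameCoord_apply, hc.scalar_eq hs (mem_extChartAt_source _) hF, ← gBilin_apply,
    comp_frameField]
  simp [map_sum, LinearMap.sum_apply, hX.gBilin_comp hc hF hs]

theorem IsParallelFrame.frameField_frameCoord (Y : ∀ t, TangentSpace (𝓡 n) (c t)) :
    frameField X (frameCoord F c X Y) s = Y s := by
  have hq := mem_extChartAt_source (I := 𝓡 n) (c s)
  apply toChart_injective hq
  rw [← comp_eq_toChart, ← comp_eq_toChart, comp_frameField]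
  refine (Finset.sum_congr rfl fun i _ => ?_).trans (orthonormal_family_expand
    (gBilin (inCoord F (c s)) (chartLift c (c s) s)) (hX.gBilin_comp hc hF hs) (comp c (c s) Y s))
  rw [frameCoord_apply, hc.scalar_eq hs hq hF, gBilin_apply]

theorem IsParallelFrame.scalar_eq_inner (Y Z : ∀ t, TangentSpace (𝓡 n) (c t)) :
    scalar F c Y Z s = ⟪frameCoord F c X Y s, frameCoord F c X Z s⟫_ℝ := by
  rw [← hX.scalar_frameField hc hF hs, scalar, scalar, hX.frameField_frameCoord hc hF hs,
    hX.frameField_frameCoord hc hF hs]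

theorem IsParallelFrame.frameCoord_eq_zero_iff {Y : ∀ t, TangentSpace (𝓡 n) (c t)} :
    frameCoord F c X Y s = 0 ↔ Y s = 0 := by
  refine ⟨fun h => ?_, fun h => ?_⟩
  · rw [← hX.frameField_frameCoord hc hF hs Y, frameField_eq_zero X h]
  · have h0 : Y s = frameField X (fun _ => 0) s := by rw [h, frameField_eq_zero X rfl]
    rw [frameCoord_congr X h0, hX.frameCoord_frameField hc hF hs]

theorem IsParallelFrame.contDiffWithinAt_frameCoord {S : Set ℝ} (hS : S ⊆ Icc 0 1)
    {Y : ∀ t, TangentSpace (𝓡 n) (c t)} (hY : ContMDiffWithinAt 𝓘(ℝ, ℝ) (𝓡 n).tangent ∞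
      (fun t => (⟨c t, Y t⟩ : TangentBundle (𝓡 n) M)) S s) :
    ContDiffWithinAt ℝ ∞ (frameCoord F c X Y) S s := by
  have hq := mem_extChartAt_source (I := 𝓡 n) (c s)
  have hYc := (contMDiffWithinAt_field_iff ((hc.1.1 s hs).mono hS) hq Y).mp hY
  refine contDiffWithinAt_euclidean.mpr fun i => ?_
  have hXc := ((hc.smoothFieldAt_iff hs hq (X i)).mp (hX.parallel i s hs).1).mono hS
  exact ((hF.isLocal (c s)).contDiffWithinAt_gForm (hc.1.chartLift_mem hs hq)
    ((hc.1.contDiffWithinAt_chartLift hs hq).mono hS) hYc hXc).congr_of_eventuallyEq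
      (hc.eventually_scalar_eq hF hS hs hq Y (X i)) (hc.scalar_eq hs hq hF Y (X i))

omit hF in
theorem IsParallelFrame.contMDiffWithinAt_frameField {S : Set ℝ} (hS : S ⊆ Icc 0 1)
    {u : ℝ → Coord n} (hu : ContDiffWithinAt ℝ ∞ u S s) :
    ContMDiffWithinAt 𝓘(ℝ, ℝ) (𝓡 n).tangent ∞
      (fun t => (⟨c t, frameField X u t⟩ : TangentBundle (𝓡 n) M)) S s := by
  have hq := mem_extChartAt_source (I := 𝓡 n) (c s)
  rw [contMDiffWithinAt_field_iff ((hc.1.1 s hs).mono hS) hq]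
  have e : comp c (c s) (frameField X u) = fun t => ∑ i, u t i • comp c (c s) (X i) t :=
    funext (comp_frameField _ X u)
  rw [e]
  exact ContDiffWithinAt.sum fun i _ => (contDiffWithinAt_euclidean.mp hu i).smul
    (((hc.smoothFieldAt_iff hs hq (X i)).mp (hX.parallel i s hs).1).mono hS)

theorem IsParallelFrame.continuousWithinAt_frameCoord {Y : ∀ t, TangentSpace (𝓡 n) (c t)}
    (hY : ContinuousWithinAt (fun t => (⟨c t, Y t⟩ : TangentBundle (𝓡 n) M)) (Icc 0 1) s) :
    ContinuousWithinAt (frameCoord F c X Y) (Icc 0 1) s := by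
  have hq := mem_extChartAt_source (I := 𝓡 n) (c s)
  have hYc : ContinuousWithinAt (comp c (c s) Y) (Icc 0 1) s :=
    ((FiberBundle.continuousWithinAt_totalSpace _ _).mp hY).2
  have hi : ∀ i, ContinuousWithinAt (fun t => frameCoord F c X Y t i) (Icc 0 1) s := fun i =>
    ((hF.isLocal (c s)).continuousWithinAt_gForm (hc.1.chartLift_mem hs hq)
      (hc.1.contDiffWithinAt_chartLift hs hq).continuousWithinAt hYc
      ((hc.smoothFieldAt_iff hs hq (X i)).mp
        (hX.parallel i s hs).1).continuousWithinAt).congr_of_eventuallyEq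
      (hc.eventually_scalar_eq hF subset_rfl hs hq Y (X i)) (hc.scalar_eq hs hq hF Y (X i))
  exact (PiLp.continuous_toLp 2 _).continuousAt.comp_continuousWithinAt
    (continuousWithinAt_pi.mpr hi)

omit hF in
theorem IsParallelFrame.continuousWithinAt_frameField {u : ℝ → Coord n}
    (hu : ContinuousWithinAt u (Icc 0 1) s) :
    ContinuousWithinAt (fun t => (⟨c t, frameField X u t⟩ : TangentBundle (𝓡 n) M))
      (Icc 0 1) s := by
  have hq := mem_extChartAt_source (I := 𝓡 n) (c s)
  refine (FiberBundle.continuousWithinAt_totalSpace _ _).mpr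
    ⟨(hc.1.1 s hs).continuousWithinAt, ?_⟩
  have e : comp c (c s) (frameField X u) = fun t => ∑ i, u t i • comp c (c s) (X i) t :=
    funext (comp_frameField _ X u)
  change ContinuousWithinAt (comp c (c s) (frameField X u)) (Icc 0 1) s
  rw [e]
  exact tendsto_finsetSum _ fun i _ => ContinuousWithinAt.smul
    ((EuclideanSpace.proj i : Coord n →L[ℝ] ℝ).continuous.continuousAt.comp_continuousWithinAt hu)
    ((hc.smoothFieldAt_iff hs hq (X i)).mp (hX.parallel i s hs).1).continuousWithinAt

/-- In a parallel frame the covariant derivative is the derivative of the components. -/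
theorem IsParallelFrame.covDeriv_frameField {u : ℝ → Coord n} {u' : ℝ → Coord n}
    (hu : HasDerivWithinAt u (u' s) (Icc 0 1) s) :
    covDeriv F c (frameField X u) s = frameField X u' s := by
  have hq := mem_extChartAt_source (I := 𝓡 n) (c s)
  apply toChart_injective hq
  rw [hc.toChart_covDeriv_self hs hF, ← comp_eq_toChart, comp_frameField, comp_frameField]
  have e : comp c (c s) (frameField X u) = fun t => ∑ i, u t i • comp c (c s) (X i) t :=
    funext (comp_frameField _ X u)
  have hd : HasDerivWithinAt (comp c (c s) (frameField X u)) (∑ i, (u s i •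
      derivWithin (comp c (c s) (X i)) (Icc 0 1) s + u' s i • comp c (c s) (X i) s))
      (Icc 0 1) s := by
    rw [e]
    exact HasDerivWithinAt.fun_sum fun i _ => HasDerivWithinAt.smul
      ((EuclideanSpace.proj i : Coord n →L[ℝ] ℝ).hasFDerivAt.comp_hasDerivWithinAt s hu)
      (hc.differentiableWithinAt_comp hs (hX.parallel i s hs).1).hasDerivWithinAt
  rw [hd.derivWithin (uniqueDiffOn_unit s hs), map_sum, ← Finset.sum_add_distrib]
  refine Finset.sum_congr rfl fun i _ => ?_
  have h0 := hc.toChart_covDeriv_self hs hF (X i)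
  rw [(hX.parallel i s hs).2, map_zero] at h0
  rw [map_smul, add_right_comm, ← smul_add, ← h0, smul_zero, zero_add]

end Frame

end Finsler

namespace Finsler

/-! ### The Jacobi equation in a parallel frame -/

section FrameCurvature

open Filter Topology
open scoped InnerProductSpace

/-- Linearity in the vector argument reduces the claim to constant basis vectors. -/
theorem IsLocal.contDiffWithinAt_jac {n : ℕ} {f : Coord n × Coord n → ℝ} {O : Set (Coord n)}
    (H : IsLocal f O) {γ : ℝ → Coord n × Coord n} {x : ℝ → Coord n} {S : Set ℝ} {s : ℝ}
    (hp : γ s ∈ slit O) (hγ : ContDiffWithinAt ℝ ∞ γ S s) (hx : ContDiffWithinAt ℝ ∞ x S s) :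
    ContDiffWithinAt ℝ ∞ (fun t => jac f (γ t) (x t)) S s := by
  have e : (fun t => jac f (γ t) (x t)) =
      fun t => ∑ k, x t k • jac f (γ t) (EuclideanSpace.single k 1) := by
    funext t
    ext i
    simp [jac, mul_comm]
  rw [e]
  exact ContDiffWithinAt.sum fun k _ => (contDiffWithinAt_euclidean.mp hx k).smul
    ((H.contDiffAt_jac hp contDiffAt_const).comp_contDiffWithinAt s hγ)

variable {n : ℕ} {M : Type*} [TopologicalSpace M] [ChartedSpace (Coord n) M]
  [IsManifold (𝓡 n) ∞ M] {F : TangentBundle (𝓡 n) M → ℝ} {c : ℝ → M} {s : ℝ}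

/-- The operator `R²(·, ċ)ċ` in a frame. -/
noncomputable def frameCurv (F : TangentBundle (𝓡 n) M → ℝ) (c : ℝ → M)
    (X : Fin n → ∀ t, TangentSpace (𝓡 n) (c t)) (t : ℝ) : Coord n →L[ℝ] Coord n :=
  ∑ i, ∑ j, scalar F c (curv F c (X j)) (X i) t •
    (EuclideanSpace.proj j : Coord n →L[ℝ] ℝ).smulRight (EuclideanSpace.single i (1 : ℝ))

theorem frameCurv_apply (X : Fin n → ∀ t, TangentSpace (𝓡 n) (c t)) (t : ℝ) (a : Coord n)
    (i : Fin n) :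
    frameCurv F c X t a i = ∑ j, scalar F c (curv F c (X j)) (X i) t * a j := by
  simp [frameCurv, sum_apply, smul_apply, Finset.sum_apply, Pi.single_apply]

omit [IsManifold (𝓡 n) ∞ M] in
theorem frameField_add (X : Fin n → ∀ t, TangentSpace (𝓡 n) (c t)) (u v : ℝ → Coord n) (t : ℝ) :
    frameField X u t + frameField X v t = frameField X (fun t => u t + v t) t := by
  simp [frameField, add_smul, Finset.sum_add_distrib]

variable {X : Fin n → ∀ t, TangentSpace (𝓡 n) (c t)} (hX : IsParallelFrame F c X)
  (hc : IsGeodesic F c) (hF : IsFinsler F)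
include hc

theorem IsGeodesic.isParallelAt_velocity (hs : s ∈ Icc (0 : ℝ) 1) :
    IsParallelAt F c (velocity c) s :=
  ⟨(hc.smoothFieldAt_iff hs (mem_extChartAt_source _) _).mpr
    (hc.1.contDiffWithinAt_velocity hs (mem_extChartAt_source _)), hc.2 s hs⟩

include hF

theorem IsGeodesic.comp_curv {q : M} (hs : s ∈ Icc (0 : ℝ) 1)
    (hq : c s ∈ (extChartAt (𝓡 n) q).source) (Y : ∀ t, TangentSpace (𝓡 n) (c t)) :
    comp c q (curv F c Y) s = jac (inCoord F q) (chartLift c q s) (comp c q Y s) :=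
  hc.toChart_curv hs hq hF Y

/-- The self-adjointness of the Jacobi endomorphism, read along the curve; it makes the coefficient
matrix of the Jacobi equation symmetric. -/
theorem IsGeodesic.scalar_curv_comm (hs : s ∈ Icc (0 : ℝ) 1)
    (Y Z : ∀ t, TangentSpace (𝓡 n) (c t)) :
    scalar F c (curv F c Y) Z s = scalar F c (curv F c Z) Y s := by
  have hq := mem_extChartAt_source (I := 𝓡 n) (c s)
  have hp := hc.1.chartLift_mem hs hq
  rw [hc.scalar_eq hs hq hF, hc.scalar_eq hs hq hF, hc.comp_curv hF hs hq, hc.comp_curv hF hs hq,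
    (hF.isLocal (c s)).gForm_jac hp, (hF.isLocal (c s)).gForm_symm hp]

theorem IsGeodesic.curv_velocity (hs : s ∈ Icc (0 : ℝ) 1) : curv F c (velocity c) s = 0 := by
  apply toChart_injective (mem_extChartAt_source (I := 𝓡 n) (c s))
  rw [hc.toChart_curv_self hs hF, map_zero]
  exact jac_self _ _

theorem IsGeodesic.frameCurv_symm (hs : s ∈ Icc (0 : ℝ) 1)
    (X : Fin n → ∀ t, TangentSpace (𝓡 n) (c t)) (a b : Coord n) :
    ⟪frameCurv F c X s a, b⟫_ℝ = ⟪a, frameCurv F c X s b⟫_ℝ := by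
  simp only [PiLp.inner_apply, frameCurv_apply, RCLike.inner_apply, conj_trivial, Finset.mul_sum,
    Finset.sum_mul]
  rw [Finset.sum_comm]
  refine Finset.sum_congr rfl fun i _ => Finset.sum_congr rfl fun j _ => ?_
  rw [hc.scalar_curv_comm hF hs (X i)]
  ring

include hX

theorem IsParallelFrame.contDiffOn_frameCurv : ContDiffOn ℝ ∞ (frameCurv F c X) (Icc 0 1) := by
  suffices h : ∀ i j, ContDiffOn ℝ ∞ (scalar F c (curv F c (X j)) (X i)) (Icc 0 1) from
    ContDiffOn.sum fun i _ => ContDiffOn.sum fun j _ => (h i j).smul contDiffOn_const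
  intro i j s hs
  have hq := mem_extChartAt_source (I := 𝓡 n) (c s)
  have hp := hc.1.chartLift_mem hs hq
  have hγ := hc.1.contDiffWithinAt_chartLift hs hq
  have hXc := fun i => (hc.smoothFieldAt_iff hs hq (X i)).mp (hX.parallel i s hs).1
  refine ((hF.isLocal (c s)).contDiffWithinAt_gForm hp hγ
    ((hF.isLocal (c s)).contDiffWithinAt_jac hp hγ (hXc j)) (hXc i)).congr_of_eventuallyEq ?_ ?_
  · filter_upwards [eventually_mem_source (hc.1.1 s hs) hq, self_mem_nhdsWithin] with t ht hts
    rw [hc.scalar_eq hts ht hF, hc.comp_curv hF hts ht]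
  · rw [hc.scalar_eq hs hq hF, hc.comp_curv hF hs hq]

theorem IsParallelFrame.frameCoord_curv (hs : s ∈ Icc (0 : ℝ) 1)
    (Y : ∀ t, TangentSpace (𝓡 n) (c t)) :
    frameCoord F c X (curv F c Y) s = frameCurv F c X s (frameCoord F c X Y s) := by
  have hq := mem_extChartAt_source (I := 𝓡 n) (c s)
  ext i
  have hY : comp c (c s) Y s = ∑ j, frameCoord F c X Y s j • comp c (c s) (X j) s := by
    rw [← comp_frameField]
    exact comp_congr (hX.frameField_frameCoord hc hF hs Y).symm
  rw [frameCoord_apply, frameCurv_apply, hc.scalar_eq hs hq hF, hc.comp_curv hF hs hq, hY,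
    ← (isLinearMap_jac _ _).mk'_apply, map_sum, ← gBilin_apply, map_sum, LinearMap.sum_apply]
  refine Finset.sum_congr rfl fun j _ => ?_
  rw [map_smul, map_smul, LinearMap.smul_apply, smul_eq_mul, mul_comm, gBilin_apply,
    (isLinearMap_jac _ _).mk'_apply, hc.scalar_eq hs hq hF, hc.comp_curv hF hs hq]

/-- The velocity of a geodesic is itself parallel, so the tangential direction is one fixed vector
in the frame. -/
theorem IsParallelFrame.frameCoord_velocity (hs : s ∈ Icc (0 : ℝ) 1) :
    frameCoord F c X (velocity c) s = frameCoord F c X (velocity c) 0 := by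
  ext i
  rw [frameCoord_apply, frameCoord_apply]
  exact hc.scalar_const hF (S := univ) convex_univ (fun t ht => hc.isParallelAt_velocity ht.2)
    (fun t ht => hX.parallel i t ht.2) ⟨mem_univ 0, by simp⟩ ⟨mem_univ s, hs⟩

theorem IsParallelFrame.frameCurv_velocity (hs : s ∈ Icc (0 : ℝ) 1) :
    frameCurv F c X s (frameCoord F c X (velocity c) 0) = 0 := by
  rw [← hX.frameCoord_velocity hc hF hs, ← hX.frameCoord_curv hc hF hs,
    hX.frameCoord_eq_zero_iff hc hF hs, hc.curv_velocity hF hs]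

/-- The covariant derivative of a field in terms of its components in a parallel frame. -/
theorem IsParallelFrame.covDeriv_eq (hs : s ∈ Icc (0 : ℝ) 1) {Y : ∀ t, TangentSpace (𝓡 n) (c t)}
    {u' : ℝ → Coord n} (hu : HasDerivWithinAt (frameCoord F c X Y) (u' s) (Icc 0 1) s) :
    covDeriv F c Y s = frameField X u' s := by
  rw [← hX.covDeriv_frameField hc hF hs hu]
  refine hc.covDeriv_congr hs hF ?_
  filter_upwards [self_mem_nhdsWithin] with t ht
  exact (hX.frameField_frameCoord hc hF ht Y).symm

/-- Covariant differentiation acts on components as `d/dt`, twice. With `jacobiSol_frameCoord` this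
identifies Jacobi fields with solutions of the linear system, so conjugacy can be tested on either
side. -/
theorem IsParallelFrame.isJacobi_frameField {u u' : ℝ → Coord n}
    (h : JacobiSol (frameCurv F c X) u u') : IsJacobi F c (frameField X u) := by
  refine ⟨fun t ht => hX.contMDiffWithinAt_frameField hc ht subset_rfl
    (h.contDiffOn (hX.contDiffOn_frameCurv hc hF) t ht), fun t ht => ?_⟩
  have h1 : covDeriv F c (covDeriv F c (frameField X u)) t = covDeriv F c (frameField X u') t := by
    refine hc.covDeriv_congr ht hF ?_
    filter_upwards [self_mem_nhdsWithin] with r hr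
    exact hX.covDeriv_frameField hc hF hr (h.deriv r hr)
  have h2 := hX.frameField_frameCoord hc hF ht (curv F c (frameField X u))
  have h3 := hX.frameCoord_curv hc hF ht (frameField X u)
  rw [hX.frameCoord_frameField hc hF ht] at h3
  rw [h1, hX.covDeriv_frameField hc hF ht (u' := fun t => -(frameCurv F c X t (u t)))
    (h.deriv' t ht), ← h2, frameField_add]
  exact frameField_eq_zero X (by rw [h3, neg_add_cancel])

theorem IsParallelFrame.jacobiSol_frameCoord {Y : ∀ t, TangentSpace (𝓡 n) (c t)}
    (hY : IsJacobi F c Y) : JacobiSol (frameCurv F c X) (frameCoord F c X Y)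
      (derivWithin (frameCoord F c X Y) (Icc 0 1)) := by
  set u := frameCoord F c X Y with hu
  have hus : ContDiffOn ℝ ∞ u (Icc 0 1) := fun t ht =>
    hX.contDiffWithinAt_frameCoord hc hF ht subset_rfl (hY.1 t ht)
  have hu's : ContDiffOn ℝ ∞ (derivWithin u (Icc 0 1)) (Icc 0 1) :=
    hus.derivWithin uniqueDiffOn_unit (by simp)
  have hd : ∀ t ∈ Icc (0 : ℝ) 1, HasDerivWithinAt u (derivWithin u (Icc 0 1) t) (Icc 0 1) t :=
    fun t ht => ((hus t ht).differentiableWithinAt (by simp)).hasDerivWithinAt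
  refine ⟨hd, fun t ht => ?_⟩
  have hd' := ((hu's t ht).differentiableWithinAt (by simp)).hasDerivWithinAt
  refine hd'.congr_deriv ?_
  have h1 : covDeriv F c (covDeriv F c Y) t =
      covDeriv F c (frameField X (derivWithin u (Icc 0 1))) t := by
    refine hc.covDeriv_congr ht hF ?_
    filter_upwards [self_mem_nhdsWithin] with r hr
    exact hX.covDeriv_eq hc hF hr (hd r hr)
  have h2 := hX.frameField_frameCoord hc hF ht (curv F c Y)
  have h4 := hY.2 t ht
  rw [h1, hX.covDeriv_frameField hc hF ht
    (u' := derivWithin (derivWithin u (Icc 0 1)) (Icc 0 1)) hd', ← h2, frameField_add,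
    ← hX.frameCoord_eq_zero_iff hc hF ht, hX.frameCoord_frameField hc hF ht,
    hX.frameCoord_curv hc hF ht] at h4
  exact eq_neg_of_add_eq_zero_left h4

end FrameCurvature

end Finsler

namespace Finsler

/-! ### The index form in a parallel frame -/

section IndexForm

open Filter Topology MeasureTheory
open scoped InnerProductSpace

/-! ### Piecewise smooth curves in a normed space -/

section Piecewise

variable {E : Type*} [NormedAddCommGroup E] [NormedSpace ℝ E] {k : ℕ} {τ : Fin (k + 1) → ℝ}

theorem exists_mem_Ioo_of_notMem_range (h0 : τ 0 = 0) (h1 : τ (Fin.last k) = 1) {t : ℝ}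
    (ht : t ∈ Ioo (0 : ℝ) 1) (hτ : t ∉ range τ) :
    ∃ i : Fin k, t ∈ Ioo (τ i.castSucc) (τ i.succ) := by
  have key : ∀ i : Fin (k + 1), t < τ i → ∃ i : Fin k, t ∈ Ioo (τ i.castSucc) (τ i.succ) := by
    intro i
    induction i using Fin.induction with
    | zero => intro h; exact absurd h (by rw [h0]; exact ht.1.le.not_gt)
    | succ i ih =>
      intro h
      rcases lt_or_ge t (τ i.castSucc) with hlt | hge
      · exact ih hlt
      · exact ⟨i, hge.lt_of_ne fun h' => hτ ⟨_, h'⟩, h⟩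
  exact key (Fin.last k) (by rw [h1]; exact ht.2)

variable {u : ℝ → E} (hτ : StrictMono τ) (h0 : τ 0 = 0) (h1 : τ (Fin.last k) = 1)
  (hu : ∀ i : Fin k, ContDiffOn ℝ ∞ u (Icc (τ i.castSucc) (τ i.succ)))
include hτ h0 h1 hu

theorem hasDerivAt_of_piecewise {i : Fin k} {t : ℝ} (ht : t ∈ Ioo (τ i.castSucc) (τ i.succ)) :
    HasDerivAt u (derivWithin u (Icc 0 1) t) t := by
  have hn := Icc_mem_nhds ht.1 ht.2
  have hd := ((hu i).differentiableOn (by simp) t ⟨ht.1.le, ht.2.le⟩).differentiableAt hn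
  have h0' : (0 : ℝ) ≤ τ i.castSucc := h0 ▸ hτ.monotone (Fin.zero_le _)
  have h1' : τ i.succ ≤ 1 := h1 ▸ hτ.monotone (Fin.le_last _)
  rw [derivWithin_of_mem_nhds (Icc_mem_nhds (h0'.trans_lt ht.1) (ht.2.trans_le h1'))]
  exact hd.hasDerivAt

/-- On the interior of each piece the derivative agrees with the one taken within the closed piece,
which is continuous up to the end points. The cases needed are `Φ = id` and `Φ = ‖·‖²`. -/
theorem intervalIntegrable_comp_derivWithin {G : Type*} [NormedAddCommGroup G]
    {Φ : E → G} (hΦ : Continuous Φ) :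
    IntervalIntegrable (fun t => Φ (derivWithin u (Icc 0 1) t)) volume 0 1 := by
  have key : ∀ i : Fin (k + 1),
      IntervalIntegrable (fun t => Φ (derivWithin u (Icc 0 1) t)) volume 0 (τ i) := by
    intro i
    induction i using Fin.induction with
    | zero => rw [h0]
    | succ i ih =>
      have hlt : τ i.castSucc < τ i.succ := hτ i.castSucc_lt_succ
      refine ih.trans ?_
      have hc : ContinuousOn (fun t => Φ (derivWithin u (Icc (τ i.castSucc) (τ i.succ)) t))
          (uIcc (τ i.castSucc) (τ i.succ)) := by
        rw [uIcc_of_le hlt.le]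
        exact hΦ.comp_continuousOn
          ((hu i).continuousOn_derivWithin (uniqueDiffOn_Icc hlt) (by simp))
      refine hc.intervalIntegrable.congr_uIoo fun t ht => ?_
      rw [uIoo_of_le hlt.le] at ht
      have hd := hasDerivAt_of_piecewise hτ h0 h1 hu ht
      simp only
      rw [hd.hasDerivWithinAt.derivWithin (uniqueDiffOn_Icc hlt t ⟨ht.1.le, ht.2.le⟩)]
  exact h1 ▸ key (Fin.last k)

/-- The first piece is smooth up to its left end. This one-sided derivative at `0` is what controls
the singular boundary term of the Riccati argument. -/
theorem exists_hasDerivWithinAt_zero : ∃ w, HasDerivWithinAt u w (Icc 0 1) 0 := by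
  rcases k with _ | k
  · have : (Fin.last 0) = 0 := rfl
    rw [this, h0] at h1
    exact absurd h1 zero_ne_one
  · have hlt : τ (Fin.castSucc 0) < τ (Fin.succ 0) := hτ (Fin.castSucc_lt_succ)
    have hd := (hu 0).differentiableOn (by simp) _ ⟨le_rfl, hlt.le⟩
    rw [Fin.castSucc_zero, h0] at hd hlt
    refine ⟨_, hd.hasDerivWithinAt.mono_of_mem_nhdsWithin ?_⟩
    filter_upwards [self_mem_nhdsWithin, nhdsWithin_le_nhds (Iio_mem_nhds hlt)] with t ht ht'
    exact ⟨ht.1, ht'.le⟩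

end Piecewise

variable {n : ℕ} {M : Type*} [TopologicalSpace M] [ChartedSpace (Coord n) M]
  [IsManifold (𝓡 n) ∞ M] {F : TangentBundle (𝓡 n) M → ℝ} {c : ℝ → M} {s : ℝ}
  {X : Fin n → ∀ t, TangentSpace (𝓡 n) (c t)} (hX : IsParallelFrame F c X)
  (hc : IsGeodesic F c) (hF : IsFinsler F)
include hX hc hF

/-- A countable set of exceptional parameters is harmless under the integral, so break points may be
ignored. -/
theorem IsParallelFrame.indexForm_eq {Y : ∀ t, TangentSpace (𝓡 n) (c t)} {u' : ℝ → Coord n}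
    {Z : Set ℝ} (hZ : Z.Countable)
    (hu : ∀ t ∈ Ioo (0 : ℝ) 1 \ Z, HasDerivAt (frameCoord F c X Y) (u' t) t) :
    indexForm F c Y = ∫ t in (0 : ℝ)..1, (‖u' t‖ ^ 2 -
      ⟪frameCurv F c X t (frameCoord F c X Y t), frameCoord F c X Y t⟫_ℝ) := by
  refine intervalIntegral.integral_congr_ae ?_
  filter_upwards [hZ.ae_notMem volume, (countable_singleton (1 : ℝ)).ae_notMem volume]
    with t htZ ht1 ht
  rw [uIoc_of_le zero_le_one] at ht
  have htI : t ∈ Icc (0 : ℝ) 1 := ⟨ht.1.le, ht.2⟩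
  have hd := hu t ⟨⟨ht.1, ht.2.lt_of_ne ht1⟩, htZ⟩
  have h1 : frameCoord F c X (covDeriv F c Y) t = u' t := by
    rw [frameCoord_congr X (hX.covDeriv_eq hc hF htI hd.hasDerivWithinAt),
      hX.frameCoord_frameField hc hF htI]
  rw [curv₂, hX.scalar_eq_inner hc hF htI, hX.scalar_eq_inner hc hF htI, h1,
    hX.frameCoord_curv hc hF htI, real_inner_self_eq_norm_sq]

/-- Absence of conjugate points implies positivity of the index form. -/
theorem IsParallelFrame.indexForm_pos (hconj : ∀ b : ℝ, ¬ IsConjugate F c 0 b)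
    {Y : ∀ t, TangentSpace (𝓡 n) (c t)} (hY : Y ∈ variationFields c)
    (hne : ∃ t ∈ Icc (0 : ℝ) 1, Y t ≠ 0) : 0 < indexForm F c Y := by
  obtain ⟨hcont, ⟨k, τ, hτ, h0, h1, hsm⟩, hY0, hY1⟩ := hY
  set u := frameCoord F c X Y with hudef
  have hpiece : ∀ i : Fin k, ContDiffOn ℝ ∞ u (Icc (τ i.castSucc) (τ i.succ)) := by
    intro i t ht
    have hsub : Icc (τ i.castSucc) (τ i.succ) ⊆ Icc (0 : ℝ) 1 :=
      Icc_subset_Icc (h0 ▸ hτ.monotone (Fin.zero_le _)) (h1 ▸ hτ.monotone (Fin.le_last _))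
    exact hX.contDiffWithinAt_frameCoord hc hF (hsub ht) hsub (hsm i t ht)
  have hd : ∀ t ∈ Ioo (0 : ℝ) 1 \ range τ, HasDerivAt u (derivWithin u (Icc 0 1) t) t := by
    intro t ht
    obtain ⟨i, hi⟩ := exists_mem_Ioo_of_notMem_range h0 h1 ht.1 ht.2
    exact hasDerivAt_of_piecewise hτ h0 h1 hpiece hi
  obtain ⟨w₀, hw₀⟩ := exists_hasDerivWithinAt_zero hτ h0 h1 hpiece
  have hZ : (range τ).Countable := countable_range τ
  have hz : ∀ t ∈ Icc (0 : ℝ) 1, u t = 0 ↔ Y t = 0 := fun t ht =>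
    hX.frameCoord_eq_zero_iff hc hF ht
  rw [hX.indexForm_eq hc hF hZ hd]
  refine integral_pos_of_no_conjugate (hX.contDiffOn_frameCurv hc hF).continuousOn
    (fun t ht => hc.frameCurv_symm hF ht X) (fun v v' hv hv0 b hb hvb => ?_) hZ
    (fun t ht => hX.continuousWithinAt_frameCoord hc hF ht (hcont t ht)) hd
    (intervalIntegrable_comp_derivWithin hτ h0 h1 hpiece continuous_id)
    (intervalIntegrable_comp_derivWithin hτ h0 h1 hpiece (continuous_norm.pow 2))
    ((hz 0 (by simp)).mpr hY0) ((hz 1 (by simp)).mpr hY1) hw₀ ?_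
  -- A nonzero solution of the linear system vanishing at `0` and `b` would give a Jacobi field
  -- making `c b` conjugate to `c 0`.
  · by_contra! hvt
    obtain ⟨t, ht, hvt⟩ := hvt
    refine hconj b ⟨le_rfl, hb.1, hb.2, frameField X v, hX.isJacobi_frameField hc hF hv,
      frameField_eq_zero X hv0, frameField_eq_zero X hvb, t, ht, fun h => hvt ?_⟩
    rw [← hX.frameCoord_frameField hc hF ht v, hX.frameCoord_eq_zero_iff hc hF ht, h]
  · obtain ⟨t, ht, hne⟩ := hne
    exact ⟨t, ht, fun h => hne ((hz t ht).mp h)⟩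

end IndexForm

end Finsler

namespace Finsler

/-! ### A conjugate point gives a null direction of the index form -/

section Conjugate

open Filter Topology MeasureTheory
open scoped InnerProductSpace

variable {n : ℕ} {M : Type*} [TopologicalSpace M] [ChartedSpace (Coord n) M]
  [IsManifold (𝓡 n) ∞ M] {F : TangentBundle (𝓡 n) M → ℝ} {c : ℝ → M}
  {X : Fin n → ∀ t, TangentSpace (𝓡 n) (c t)} (hX : IsParallelFrame F c X)
  (hc : IsGeodesic F c) (hF : IsFinsler F)
include hX hc

theorem IsParallelFrame.frameField_mem_variationFields {w : ℝ → Coord n} {b : ℝ}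
    (hb : b ∈ Ioc (0 : ℝ) 1) (hw : ContinuousOn w (Icc 0 1)) (hw0 : w 0 = 0) (hw1 : w 1 = 0)
    (h₁ : ContDiffOn ℝ ∞ w (Icc 0 b)) (h₂ : ContDiffOn ℝ ∞ w (Icc b 1)) :
    frameField X w ∈ variationFields c := by
  have hs₁ : SmoothFieldOn c (frameField X w) (Icc 0 b) := fun t ht =>
    hX.contMDiffWithinAt_frameField hc ⟨ht.1, ht.2.trans hb.2⟩ (Icc_subset_Icc_right hb.2) (h₁ t ht)
  have hs₂ : SmoothFieldOn c (frameField X w) (Icc b 1) := fun t ht =>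
    hX.contMDiffWithinAt_frameField hc ⟨hb.1.le.trans ht.1, ht.2⟩ (Icc_subset_Icc_left hb.1.le)
      (h₂ t ht)
  refine ⟨fun t ht => hX.continuousWithinAt_frameField hc ht (hw t ht), ?_,
    frameField_eq_zero X hw0, frameField_eq_zero X hw1⟩
  -- A subdivision must be strictly increasing, so `b` is a break point only if `b < 1`; for `b = 1`
  -- a single piece suffices.
  rcases hb.2.lt_or_eq with hlt | rfl
  · refine ⟨2, ![0, b, 1], ?_, rfl, rfl, fun i => ?_⟩
    · rw [Fin.strictMono_iff_lt_succ]
      intro i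
      fin_cases i
      · exact hb.1
      · exact hlt
    · fin_cases i
      · exact hs₁
      · exact hs₂
  · refine ⟨1, ![0, 1], ?_, rfl, rfl, fun i => ?_⟩
    · rw [Fin.strictMono_iff_lt_succ]
      intro i
      fin_cases i
      exact hb.1
    · fin_cases i
      exact hs₁

include hF

/-- A conjugate point gives a nonzero orthogonal variation field with vanishing index form. -/
theorem IsParallelFrame.exists_indexForm_eq_zero {b : ℝ} (hb : IsConjugate F c 0 b) :
    ∃ Y ∈ orthogonalFields F c, (∃ t ∈ Icc (0 : ℝ) 1, Y t ≠ 0) ∧ indexForm F c Y = 0 := by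
  obtain ⟨-, hb0, hb1, J, hJ, hJ0, hJb, t₀, ht₀, hJt₀⟩ := hb
  have hbI : b ∈ Icc (0 : ℝ) 1 := ⟨hb0.le, hb1⟩
  have h0I : (0 : ℝ) ∈ Icc (0 : ℝ) 1 := by simp
  have hsol := hX.jacobiSol_frameCoord hc hF hJ
  set u := frameCoord F c X J
  set u' := derivWithin u (Icc 0 1)
  have hS := hX.contDiffOn_frameCurv hc hF
  have hu : ContDiffOn ℝ ∞ u (Icc 0 1) := hsol.contDiffOn hS
  have hu0 : u 0 = 0 := (hX.frameCoord_eq_zero_iff hc hF h0I).mpr hJ0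
  have hub : u b = 0 := (hX.frameCoord_eq_zero_iff hc hF hbI).mpr hJb
  -- The Jacobi field up to `b`, continued by zero; continuity at `b` holds because `u b = 0`.
  set w : ℝ → Coord n := indicator (Iic b) u with hw
  have hw₁ : ∀ t ∈ Icc 0 b, w t = u t := fun t ht => indicator_of_mem (mem_Iic.mpr ht.2) u
  have hw₂ : ∀ t ∈ Icc b 1, w t = 0 := fun t ht => by
    rcases ht.1.eq_or_lt with rfl | hlt
    · rw [hw₁ b ⟨hb0.le, le_rfl⟩, hub]
    · exact indicator_of_notMem (notMem_Iic.mpr hlt) u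
  have hs₁ : ContDiffOn ℝ ∞ w (Icc 0 b) := (hu.mono (Icc_subset_Icc_right hb1)).congr hw₁
  have hs₂ : ContDiffOn ℝ ∞ w (Icc b 1) := contDiffOn_const.congr hw₂
  have hw0 : w 0 = 0 := by rw [hw₁ 0 ⟨le_rfl, hb0.le⟩, hu0]
  have hw1 : w 1 = 0 := hw₂ 1 ⟨hb1, le_rfl⟩
  have hwc : ContinuousOn w (Icc 0 1) := by
    rw [← Icc_union_Icc_eq_Icc hb0.le hb1]
    exact hs₁.continuousOn.union_of_isClosed hs₂.continuousOn isClosed_Icc isClosed_Icc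
  have hcoord : ∀ t ∈ Icc (0 : ℝ) 1, frameCoord F c X (frameField X w) t = w t := fun t ht =>
    hX.frameCoord_frameField hc hF ht w
  refine ⟨frameField X w, ⟨hX.frameField_mem_variationFields hc ⟨hb0, hb1⟩ hwc hw0 hw1 hs₁ hs₂,
    fun t ht => ?_⟩, ?_, ?_⟩
  -- Up to `b`, orthogonality is forced: the component of `u` along the constant vector of `ċ` is
  -- affine in `t` and vanishes at `0` and `b`.
  · rw [hX.scalar_eq_inner hc hF ht, hcoord t ht, hX.frameCoord_velocity hc hF ht]
    rcases le_total t b with htb | htb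
    · rw [hw₁ t ⟨ht.1, htb⟩]
      exact hsol.inner_eq_zero (fun t ht => hc.frameCurv_symm hF ht X)
        (fun t ht => hX.frameCurv_velocity hc hF ht) ⟨hb0, hb1⟩ hu0 hub ht
    · rw [hw₂ t ⟨htb, ht.2⟩, inner_zero_left]
  · by_contra! hz
    -- If the truncated field were zero, `u` would vanish on `[0, b]`. Its initial value and initial
    -- derivative would then vanish, and uniqueness would make `J` identically zero.
    have huz : ∀ t ∈ Icc 0 b, u t = 0 := fun t ht => by
      have htI : t ∈ Icc (0 : ℝ) 1 := ⟨ht.1, ht.2.trans hb1⟩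
      rw [← hw₁ t ht, ← hcoord t htI]
      exact (hX.frameCoord_eq_zero_iff hc hF htI).mpr (hz t htI)
    have hd : HasDerivWithinAt u 0 (Icc 0 b) 0 :=
      (hasDerivWithinAt_const 0 (Icc 0 b) (0 : Coord n)).congr huz hu0
    have hu'0 : u' 0 = 0 := (uniqueDiffOn_Icc hb0 0 ⟨le_rfl, hb0.le⟩).eq_deriv _
      ((hsol.deriv 0 h0I).mono (Icc_subset_Icc_right hb1)) hd
    exact hJt₀ ((hX.frameCoord_eq_zero_iff hc hF ht₀).mp
      (hsol.eq_zero hS.continuousOn h0I hu0 hu'0 ht₀))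
  · have hd : ∀ t ∈ Ioo (0 : ℝ) 1 \ {b},
        HasDerivAt (frameCoord F c X (frameField X w)) (indicator (Iic b) u' t) t := by
      intro t ht
      have hn : Icc (0 : ℝ) 1 ∈ 𝓝 t := Icc_mem_nhds ht.1.1 ht.1.2
      have htI : t ∈ Icc (0 : ℝ) 1 := mem_of_mem_nhds hn
      have hcw : frameCoord F c X (frameField X w) =ᶠ[𝓝 t] w := eventually_of_mem hn hcoord
      refine HasDerivAt.congr_of_eventuallyEq ?_ hcw
      rcases lt_or_gt_of_ne (fun h => ht.2 h : t ≠ b) with hlt | hgt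
      · rw [indicator_of_mem (mem_Iic.mpr hlt.le)]
        refine ((hsol.deriv t htI).hasDerivAt hn).congr_of_eventuallyEq ?_
        filter_upwards [Ioo_mem_nhds ht.1.1 hlt] with r hr
        exact hw₁ r ⟨hr.1.le, hr.2.le⟩
      · rw [indicator_of_notMem (notMem_Iic.mpr hgt)]
        refine (hasDerivAt_const t (0 : Coord n)).congr_of_eventuallyEq ?_
        filter_upwards [Ioo_mem_nhds hgt ht.1.2] with r hr
        exact hw₂ r ⟨hr.1.le, hr.2.le⟩
    rw [hX.indexForm_eq hc hF (countable_singleton b) hd]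
    refine Eq.trans ?_ (hsol.integral_eq_zero hS.continuousOn hbI hu0 hub)
    -- Beyond `b` the integrand is zero, so the index form is the integral of the Jacobi field over
    -- `[0, b]`, where it is the increment of `⟪u', u⟫`.
    rw [← intervalIntegral.integral_indicator hbI]
    refine intervalIntegral.integral_congr fun t ht => ?_
    rw [uIcc_of_le zero_le_one] at ht
    beta_reduce
    rw [hcoord t ht]
    simp only [hw, indicator, mem_Iic, mem_ofPred_eq]
    split_ifs <;> simp

end Conjugate

end Finsler

/-! ### The equivalence -/

theorem lemma2 {n : ℕ} {M : Type*} [TopologicalSpace M] [T2Space M] [ConnectedSpace M]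
    [ChartedSpace (EuclideanSpace ℝ (Fin n)) M] [IsManifold (𝓡 n) ∞ M]
    (F : TangentBundle (𝓡 n) M → ℝ) (hF : Finsler.IsFinsler F)
    (c : ℝ → M) (hc : Finsler.IsGeodesic F c) :
    (∀ b : ℝ, ¬ Finsler.IsConjugate F c 0 b) ↔
      (∀ X ∈ Finsler.orthogonalFields F c, (∃ t ∈ Icc (0 : ℝ) 1, X t ≠ 0) →
        0 < Finsler.indexForm F c X) := by
  obtain ⟨X, hX⟩ := hc.exists_parallelFrame hF
  refine ⟨fun h Y hY hne => hX.indexForm_pos hc hF h hY.1 hne, fun h b hb => ?_⟩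
  obtain ⟨Y, hY, hne, h0⟩ := hX.exists_indexForm_eq_zero hc hF hb
  exact (h Y hY hne).ne' h0
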